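/- Let $(M,g)$ be a compact smooth Riemannian manifold without boundary, $n=\dim M$, and let $H\subset M$ be a compact embedded submanifold, $d=\dim H$. Let $p(x,\xi)=|\xi|_{g(x)}$ on $\dot T^*M=T^*M\setminus 0$ and let $G^t$ be the flow of its Hamilton vector field (the homogeneous geodesic flow). Let $\dot N^*H\subset \dot T^*M$ be the conormal bundle of $H$ without its zero section and $SN^*H=\dot N^*H\cap p^{-1}(1)$. In local coordinates $x=(x',x'')\in\mathbb R^d\times\mathbb R^{n-d}$ of $M$ in which $H=\{x''=0\}$, $\dot N^*H$ is parametrized by $(x',\xi'')$ and carries the natural density $\frac{|g_H(x')|}{|g(x)|^{1/2}}\,|dx'\,d\xi''|$, $x=(x',0)$ (where $|\cdot|$ is the determinant of the metric matrix and $g_H$ is the induced metric); $SN^*H$ carries the Leray measure induced by this density and the condition $p=1$. For $t\in\mathbb R$ let $\Sigma_t$ be the set of $(x,\xi)\in\dot N^*H$ such that $G^t(x,\xi)\in\dot N^*H$ and $dG^t$ maps $T_{(x,\xi)}\dot N^*H$ isomorphically onto $T_{G^t(x,\xi)}\dot N^*H$; for such $(x,\xi)$ let $J_t(x,\xi)>0$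 be the absolute value of the determinant of this isomorphism with respect to the natural densities, and put $S\Sigma_t=\Sigma_t\cap SN^*H$. Let $\sigma_t(x,\xi)\in\mathbb Z$ be the Maslov index of the path of Lagrangian subspaces $dG^s(T_{(x,\xi)}\dot N^*H)$, $s$ from $0$ to $t$, relative to the vertical spaces $V=\ker d\pi$ of $\pi:T^*M\to M$, i.e. $$\sigma_t=\operatorname{sgn}(t)\Big((n-d-1)+\sum_{s\text{ strictly between }0\text{ and }t}\big(\dim\big(dG^s(T_{(x,\xi)}\dot N^*H)\cap V\big)-1\big)\Big).$$ Set $$q(t)=(2\pi)^{-n+d}\int_{S\Sigma_t} i^{\sigma_t}\sqrt{J_t},\qquad \mathcal T=\{t\neq 0: S\Sigma_t\text{ has positive measure in }SN^*H\}.$$ For $(x,\xi)\in SN^*H$ let $\mathbf T(x,\xi)\in(0,\infty]$ be the smallest $t>0$ with $(x,\xi)\in S\Sigma_t$ ($\infty$ if there is none). An $L^1$ measure on $SN^*H$, i.e. one with a nonnegative integrable density $f$ with respect to the natural measure of $SN^*H$, is called invariant under the first return map if, almost everywhere, $$f=\begin{cases}(f\circ G^{\mathbf T})\,J_{\mathbf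 T}&\text{if }\mathbf T<\infty,\\ 0&\text{if }\mathbf T=\infty.\end{cases}$$ Theorem. Suppose that the only $L^1$ measure on $SN^*H$ which is invariant under the first return map is the trivial one, $f=0$ almost everywhere. Then, for each $T>0$, the sum $\sum_{t\in\mathcal T\cap[-T,T]}|q(t)|$ is finite, and $$\lim_{T\to\infty}\frac1T\sum_{t\in\mathcal T\cap[-T,T]}|q(t)|=0.$$ -/

import Mathlib

open Set Filter Topology MeasureTheory Bundle Module
open scoped Manifold ContDiff ENNReal

noncomputable section

namespace ConormalFlow

/-- The model space `ℝⁿ` with its Euclidean norm. -/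
abbrev Rn (n : ℕ) : Type := EuclideanSpace ℝ (Fin n)

/-! ### The cotangent bundle, the Riemannian symbol and the geodesic flow -/

/-- The cotangent bundle `T*M` of a smooth `n`-manifold, as a smooth vector bundle. A point `z` is a
pair `(x, ξ) = (z.1, z.2)` where `ξ` is a linear form on `T_x M`. The preferred chart of this
manifold at `z` consists of the canonical coordinates `(x, ξ)` induced by the preferred chart of `M`
at the base point of `z`. -/
abbrev Cot (n : ℕ) (M : Type*) [TopologicalSpace M] [ChartedSpace (Rn n) M] : Type _ :=
  TotalSpace (Rn n →L[ℝ] ℝ) (fun x : M => TangentSpace 𝓘(ℝ, Rn n) x →L[ℝ] ℝ)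

/-- The model with corners of `T*M`, with model space `ℝⁿ × (ℝⁿ)*`. -/
abbrev cotModel (n : ℕ) : ModelWithCorners ℝ (Rn n × (Rn n →L[ℝ] ℝ))
    (ModelProd (Rn n) (Rn n →L[ℝ] ℝ)) :=
  𝓘(ℝ, Rn n).prod 𝓘(ℝ, Rn n →L[ℝ] ℝ)

/-- Riemannian metrics of class `C^∞` on `M`. -/
abbrev Metric (n : ℕ) (M : Type*) [TopologicalSpace M] [ChartedSpace (Rn n) M]
    [IsManifold 𝓘(ℝ, Rn n) ∞ M] : Type _ :=
  ContMDiffRiemannianMetric 𝓘(ℝ, Rn n) ∞ (Rn n) (fun x : M => TangentSpace 𝓘(ℝ, Rn n) x)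

section

variable {n : ℕ} {M : Type*} [TopologicalSpace M] [ChartedSpace (Rn n) M]

/-- The differential of the chart `φ` at `x`, whose `i`-th component is the covector `dx_i`. -/
def chartDeriv (φ : OpenPartialHomeomorph M (Rn n)) (x : M) :
    TangentSpace 𝓘(ℝ, Rn n) x →L[ℝ] Rn n :=
  mfderiv 𝓘(ℝ, Rn n) 𝓘(ℝ, Rn n) φ x

/-- The coordinate vector field `∂/∂x_i` of the chart `φ`, at the point `x`. -/
def frame (φ : OpenPartialHomeomorph M (Rn n)) (x : M) (i : Fin n) : TangentSpace 𝓘(ℝ, Rn n) x :=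
  (chartDeriv φ x).inverse (EuclideanSpace.single i (1 : ℝ))

/-- The coordinate covector `dx_i` of the chart `φ`, at the point `x`. -/
def coframe (φ : OpenPartialHomeomorph M (Rn n)) (x : M) (i : Fin n) :
    TangentSpace 𝓘(ℝ, Rn n) x →L[ℝ] ℝ :=
  (EuclideanSpace.proj i : Rn n →L[ℝ] ℝ).comp (chartDeriv φ x)

/-- The Borel σ-algebra of `T*M`. -/
instance cotMeasurableSpace [IsManifold 𝓘(ℝ, Rn n) ∞ M] : MeasurableSpace (Cot n M) := borel _

instance cotBorelSpace [IsManifold 𝓘(ℝ, Rn n) ∞ M] : BorelSpace (Cot n M) := ⟨rfl⟩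

variable [IsManifold 𝓘(ℝ, Rn n) ∞ M]

/-- The matrix `(g_ij(x))` of the metric in the coordinates of the chart `φ`. -/
def metricMatrix (g : Metric n M) (φ : OpenPartialHomeomorph M (Rn n)) (x : M) :
    Matrix (Fin n) (Fin n) ℝ :=
  Matrix.of fun i j => g.inner x (frame φ x i) (frame φ x j)

/-- The principal symbol `p(x, ξ) = |ξ|_{g(x)} = (∑ g^{ij}(x) ξ_i ξ_j)^{1/2}`. -/
def symbol (g : Metric n M) (z : Cot n M) : ℝ :=
  √(∑ i, ∑ j, (metricMatrix g (chartAt (Rn n) z.1) z.1)⁻¹ i j *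
    z.2 (frame (chartAt (Rn n) z.1) z.1 i) * z.2 (frame (chartAt (Rn n) z.1) z.1 j))

/-- The Hamilton vector field `H_p = ∑ (∂p/∂ξ_j) ∂/∂x_j - (∂p/∂x_j) ∂/∂ξ_j` of the symbol `p`. Both
the derivative of `p` at `z` and the tangent vector `H_p(z)` are expressed in the preferred chart
of `T*M` at `z`, that is in canonical coordinates. -/
def hamiltonField (g : Metric n M) (z : Cot n M) : TangentSpace (cotModel n) z :=
  let D : (Rn n × (Rn n →L[ℝ] ℝ)) →L[ℝ] ℝ := mfderiv (cotModel n) 𝓘(ℝ, ℝ) (symbol g) z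
  ((WithLp.toLp 2 fun j => D (0, (EuclideanSpace.proj j : Rn n →L[ℝ] ℝ)),
    -(D.comp (ContinuousLinearMap.inl ℝ (Rn n) (Rn n →L[ℝ] ℝ)))) :
      Rn n × (Rn n →L[ℝ] ℝ))

/-- `γ` is a complete integral curve of `H_p` in `T*M` without its zero section. -/
def IsBicharacteristic (g : Metric n M) (γ : ℝ → Cot n M) : Prop :=
  (∀ t, (γ t).2 ≠ 0) ∧ IsMIntegralCurve (I := cotModel n) γ (hamiltonField g)

open Classical in
/-- The homogeneous geodesic flow `G^t`: the point at time `t` of the integral curve of `H_p` which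
is at `z` at time `0`. (Points of the zero section, where the flow is not defined, are left fixed;
they are never used.) -/
def geodesicFlow (g : Metric n M) (t : ℝ) (z : Cot n M) : Cot n M :=
  if h : ∃ γ : ℝ → Cot n M, IsBicharacteristic g γ ∧ γ 0 = z then h.choose t else z

/-- The differential `dG^t` at `z`. -/
def flowDeriv (g : Metric n M) (t : ℝ) (z : Cot n M) :
    TangentSpace (cotModel n) z →L[ℝ] TangentSpace (cotModel n) (geodesicFlow g t z) :=
  mfderiv (cotModel n) (cotModel n) (geodesicFlow g t) z

/-- The vertical subspace of the tangent space of `T*M` at `z`: the kernel of the differential of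
the projection `T*M → M`. -/
def verticalSpace (z : Cot n M) : Submodule ℝ (TangentSpace (cotModel n) z) :=
  LinearMap.ker (mfderiv (cotModel n) 𝓘(ℝ, Rn n) (fun w : Cot n M => w.1) z).toLinearMap

/-! ### Embedded submanifolds and their conormal bundles -/

/-- `φ` is a smooth chart of `M` in which `H` is given by the vanishing of the coordinates
`x'' = (x_{d+1}, …, x_n)`. -/
def IsSliceChart (d : ℕ) (H : Set M) (φ : OpenPartialHomeomorph M (Rn n)) : Prop :=
  φ ∈ IsManifold.maximalAtlas 𝓘(ℝ, Rn n) ∞ M ∧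
    ∀ x ∈ φ.source, (x ∈ H ↔ ∀ i : Fin n, d ≤ (i : ℕ) → φ x i = 0)

/-- `H` is an embedded submanifold of dimension `d` of the `n`-dimensional manifold `M`. -/
def IsEmbeddedSubmanifold (d : ℕ) (H : Set M) : Prop :=
  d ≤ n ∧ ∀ x ∈ H, ∃ φ : OpenPartialHomeomorph M (Rn n), IsSliceChart d H φ ∧ x ∈ φ.source

/-- The conormal bundle without its zero section, `Ṅ*H`: the `(x, ξ)` with `x ∈ H`, `ξ ≠ 0` and `ξ`
vanishing on `T_x H`, which is spanned by the first `d` coordinate vectors of any slice chart. -/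
def conormal (d : ℕ) (H : Set M) : Set (Cot n M) :=
  {z | z.1 ∈ H ∧ z.2 ≠ 0 ∧ ∀ φ : OpenPartialHomeomorph M (Rn n), IsSliceChart d H φ →
    z.1 ∈ φ.source → ∀ i : Fin n, (i : ℕ) < d → z.2 (frame φ z.1 i) = 0}

/-- The unit conormal bundle `SN*H = Ṅ*H ∩ p⁻¹(1)`. -/
def unitConormal (g : Metric n M) (d : ℕ) (H : Set M) : Set (Cot n M) :=
  {z ∈ conormal d H | symbol g z = 1}

/-- For `w = (x', ξ'') ∈ ℝ^d × ℝ^{n-d} = ℝⁿ`, the vector `(x', 0)`. -/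
def basePart (d : ℕ) (w : Rn n) : Rn n :=
  WithLp.toLp 2 fun i => if (i : ℕ) < d then w i else 0

/-- The parametrization `w = (x', ξ'') ↦ (x, ξ)`, with `x = (x', 0)` and `ξ = (0, ξ'')` in the
canonical coordinates of a slice chart `φ`, of the conormal bundle of `H`. -/
def conormalParam (d : ℕ) (φ : OpenPartialHomeomorph M (Rn n)) (w : Rn n) : Cot n M :=
  ⟨φ.symm (basePart d w), ∑ i : Fin n, if (i : ℕ) < d then 0 else
    w i • coframe φ (φ.symm (basePart d w)) i⟩

/-- The domain of the parametrization `conormalParam`. -/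
def paramDomain (d : ℕ) (φ : OpenPartialHomeomorph M (Rn n)) : Set (Rn n) :=
  {w | basePart d w ∈ φ.target}

/-- The coordinates `(x', ξ'')` of a point `(x, ξ)` of `T*M` in the canonical coordinates of the
chart `φ`. This is a left inverse of `conormalParam`. -/
def conormalCoord (d : ℕ) (φ : OpenPartialHomeomorph M (Rn n)) (z : Cot n M) : Rn n :=
  WithLp.toLp 2 fun i => if (i : ℕ) < d then φ z.1 i else z.2 (frame φ z.1 i)

open Classical in
/-- A slice chart of `H` around `x ∈ H`. Nothing below depends on the choice. -/
def sliceChartAt (d : ℕ) (H : Set M) (x : M) : OpenPartialHomeomorph M (Rn n) :=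
  if h : ∃ φ : OpenPartialHomeomorph M (Rn n), IsSliceChart d H φ ∧ x ∈ φ.source then h.choose
  else chartAt (Rn n) x

/-- The tangent space at `z` of the conormal bundle of `H`, inside the tangent space of `T*M`. -/
def conormalTangent (d : ℕ) (H : Set M) (z : Cot n M) :
    Submodule ℝ (TangentSpace (cotModel n) z) :=
  LinearMap.range (mfderiv 𝓘(ℝ, Rn n) (cotModel n) (conormalParam d (sliceChartAt d H z.1))
    (conormalCoord d (sliceChartAt d H z.1) z)).toLinearMap

/-! ### The natural volumes of `Ṅ*H` and `SN*H` -/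

/-- The coefficient `|g_H(x')| / |g(x)|^{1/2}` of the natural density of the conormal bundle with
respect to `|dx' dξ''|`, at the point of `H` whose coordinates are `(x', 0)`. -/
def conormalDensity (g : Metric n M) (d : ℕ) (φ : OpenPartialHomeomorph M (Rn n)) (w : Rn n) : ℝ :=
  let G := metricMatrix g φ (φ.symm (basePart d w))
  (G.submatrix (Subtype.val : {i : Fin n // (i : ℕ) < d} → Fin n) Subtype.val).det / √G.det

/-- The natural volume of the part of the conormal bundle that lies over the slice chart `φ`. -/
def chartVolume (g : Metric n M) (d : ℕ) (φ : OpenPartialHomeomorph M (Rn n)) :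
    Measure (Cot n M) :=
  ((volume.restrict (paramDomain d φ)).withDensity
    fun w => ENNReal.ofReal (conormalDensity g d φ w)).map (conormalParam d φ)

/-- The natural volume of the conormal bundle, as a measure on `T*M`. The measures `chartVolume` are
the restrictions of one measure to the parts over the various slice charts, and that measure is
their supremum. -/
def conormalVolume (g : Metric n M) (d : ℕ) (H : Set M) : Measure (Cot n M) :=
  ⨆ φ : {φ : OpenPartialHomeomorph M (Rn n) // IsSliceChart d H φ}, chartVolume g d φ.1

/-- The radial projection `(x, ξ) ↦ (x, ξ / p(x, ξ))`. -/
def radialProj (g : Metric n M) (z : Cot n M) : Cot n M :=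
  ⟨z.1, (symbol g z)⁻¹ • z.2⟩

/-- The Leray measure of `SN*H` induced by the volume of `Ṅ*H` and the condition `p = 1`, as a
measure on `T*M`. The volume is homogeneous of degree `n - d` under dilations of the fibres; with
`ξ = rω`, `p(x, ω) = 1`, it is `r^{n-d-1} dr` times the Leray measure. So the latter gives to
a subset `A` of `SN*H` the mass `n - d` times the volume of `{(x, rω) : (x, ω) ∈ A, 0 < r ≤ 1}`. -/
def lerayMeasure (g : Metric n M) (d : ℕ) (H : Set M) : Measure (Cot n M) :=
  ((n - d : ℕ) : ℝ≥0∞) •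
    ((conormalVolume g d H).restrict {z ∈ conormal d H | symbol g z ≤ 1}).map (radialProj g)

/-! ### Structured looping directions, the Jacobian and the Maslov factor -/

/-- `Σ_t`: the points `z` of `Ṅ*H` such that `G^t z ∈ Ṅ*H` and `dG^t` is an isomorphism from
`T_z Ṅ*H` to the tangent space of `Ṅ*H` at `G^t z`. -/
def loopSet (g : Metric n M) (d : ℕ) (H : Set M) (t : ℝ) : Set (Cot n M) :=
  {z | z ∈ conormal d H ∧ geodesicFlow g t z ∈ conormal d H ∧
    BijOn (flowDeriv g t z) (conormalTangent d H z) (conormalTangent d H (geodesicFlow g t z))}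

/-- `SΣ_t = Σ_t ∩ SN*H`. -/
def unitLoopSet (g : Metric n M) (d : ℕ) (H : Set M) (t : ℝ) : Set (Cot n M) :=
  loopSet g d H t ∩ unitConormal g d H

/-- `J_t(z)` for `z ∈ Σ_t`: the positive determinant of `dG^t`, from the tangent space of `Ṅ*H` at
`z` to that at `G^t z`, with respect to the natural densities at these points. It is computed in the
coordinates `(x', ξ'')` and `(y', η'')` of slice charts at the two base points. -/
def jacobian (g : Metric n M) (d : ℕ) (H : Set M) (t : ℝ) (z : Cot n M) : ℝ :=
  let φ := sliceChartAt d H z.1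
  let ψ := sliceChartAt d H (geodesicFlow g t z).1
  let A : Rn n →L[ℝ] Rn n :=
    fderiv ℝ (conormalCoord d ψ ∘ geodesicFlow g t ∘ conormalParam d φ) (conormalCoord d φ z)
  |A.det| * conormalDensity g d ψ (conormalCoord d ψ (geodesicFlow g t z)) /
    conormalDensity g d φ (conormalCoord d φ z)

/-- The multiplicity of `G^s z` as a focal point of `H` along the geodesic of `z ∈ Ṅ*H`: the
dimension of the intersection of `dG^s(T_z Ṅ*H)` with the vertical space, not counting the radial
direction, which always lies in it. -/
def focalMultiplicity (g : Metric n M) (d : ℕ) (H : Set M) (s : ℝ) (z : Cot n M) : ℤ :=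
  (finrank ℝ ↥((conormalTangent d H z).map (flowDeriv g s z).toLinearMap ⊓
    verticalSpace (geodesicFlow g s z)) : ℤ) - 1

/-- The Maslov index `σ_t(z)` for `z ∈ Σ_t`: the Maslov index, relative to the vertical
polarization, of the path of Lagrangian subspaces `dG^s(T_z Ṅ*H)`, where `s` goes from `0` to `t`.
By fibrewise convexity of `p` all crossings with the vertical have the same sign, so that the index
is a count of crossings with multiplicity; the end points, at both of which the
multiplicity is `n - d - 1`, count one half each, and the sign is that of `t`. -/
def maslovIndex (g : Metric n M) (d : ℕ) (H : Set M) (t : ℝ) (z : Cot n M) : ℤ :=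
  (SignType.sign t : ℤ) *
    (((n : ℤ) - d - 1) + ∑ᶠ s ∈ Ioo (min 0 t) (max 0 t), focalMultiplicity g d H s z)

/-- `q(t) = (2π)^{-n+d} ∫_{SΣ_t} i^{σ_t} √J_t`. -/
def q (g : Metric n M) (d : ℕ) (H : Set M) (t : ℝ) : ℂ :=
  ((2 * Real.pi : ℂ) ^ (n - d))⁻¹ *
    ∫ z in unitLoopSet g d H t, Complex.I ^ maslovIndex g d H t z *
      (√(jacobian g d H t z) : ℂ) ∂(lerayMeasure g d H)

/-- The set `𝒯` of the non-zero times `t` for which `SΣ_t` has positive measure. -/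
def loopTimes (g : Metric n M) (d : ℕ) (H : Set M) : Set ℝ :=
  {t | t ≠ 0 ∧ 0 < lerayMeasure g d H (unitLoopSet g d H t)}

/-! ### The first return map and the averaging condition -/

/-- The positive times `t` with `z ∈ SΣ_t`. -/
def returnTimes (g : Metric n M) (d : ℕ) (H : Set M) (z : Cot n M) : Set ℝ :=
  {t | 0 < t ∧ z ∈ unitLoopSet g d H t}

/-- The first return time: the smallest positive time `t` with `z ∈ SΣ_t`. It is meaningful if there
is such a time; the first return time is `∞` if `returnTimes` is empty. -/
def firstReturnTime (g : Metric n M) (d : ℕ) (H : Set M) (z : Cot n M) : ℝ :=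
  sInf (returnTimes g d H z)

/-- `f` is the density, with respect to the natural measure of `SN*H`, of an `L¹` measure on `SN*H`
which is invariant under the first return map. -/
structure IsInvariantDensity (g : Metric n M) (d : ℕ) (H : Set M) (f : Cot n M → ℝ) : Prop where
  integrable : Integrable f (lerayMeasure g d H)
  nonneg : ∀ᵐ z ∂(lerayMeasure g d H), 0 ≤ f z
  of_returning : ∀ᵐ z ∂(lerayMeasure g d H), (returnTimes g d H z).Nonempty →
    f z = f (geodesicFlow g (firstReturnTime g d H z) z) *
      jacobian g d H (firstReturnTime g d H z) z
  of_not_returning : ∀ᵐ z ∂(lerayMeasure g d H), returnTimes g d H z = ∅ → f z = 0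

/-- The averaging condition: `T⁻¹ ∑_{t ∈ 𝒯 ∩ [-T, T]} |q(t)| → 0` as `T → ∞`, the sums being
finite. -/
def AveragingCondition (g : Metric n M) (d : ℕ) (H : Set M) : Prop :=
  (∀ T : ℝ, Summable fun t : ↥(loopTimes g d H ∩ Icc (-T) T) => ‖q g d H t‖) ∧
    Tendsto (fun T : ℝ => 1 / T * ∑' t : ↥(loopTimes g d H ∩ Icc (-T) T), ‖q g d H t‖)
      atTop (𝓝 0)

end

end ConormalFlow

end

/-! Let μ be the Leray measure of SN*H, R the first return map, w = √J_𝐓 where R is defined and w =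
0 elsewhere, and U f = w · (f ∘ R). The change of variables ∫ w² (F ∘ R) dμ ≤ ∫ F dμ
(`IsSeparation.lintegral_returnWeight_le`) makes U a contraction of L²(μ). If U x = x, then x² is an
integrable invariant density, so x = 0 by hypothesis. Von Neumann's mean ergodic theorem therefore
sends the averages of Uᵏ1 to 0 in L², and since μ is finite, pairing with the function 1 gives N⁻¹
∑_{k<N} ∫ Uᵏ1 dμ → 0 (`WeightedTransfer.tendsto_average_integral_iterates`).

These integrals control q. The factor i^σ has modulus one, so |q(t)| is at most a constant times
∫_{SΣ_t} √J_t, whatever the Maslov index is. The Jacobians form a cocycle (`jacobian_add`), and a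
loop longer than the first return splits into the first return and a loop of the returned point
(`mem_loopSet_of_add`); hence Uᵏ1 is √J_t at the k-th return. Conormal geodesics leave H
transversally, and by compactness their visits to H are at least some ε apart (`exists_separation`).
So the loops with 0 < t < (m+1)ε are among the first m returns, and the sum of their √J_t is
pointwise at most ∑_{1≤k≤m} Uᵏ1 (`sum_loopWeight_le`). Negative times reduce to positive ones by
reversing loops (`loopIntegral_neg_le`). Taking m = ⌊T/ε⌋ gives both assertions.

The delicate point is the change of variables, because the return time varies with the point over a
set that is merely measurable. On strips of values shorter than ε the return time is continuous,
since the set of pairs (t, z) with z ∈ SΣ_t is closed and returns are separated. On such a set its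
derivative even vanishes (`hasFDerivWithinAt_returnTime`): dG^t carries tangent vectors of Ṅ*H to
tangent vectors of Ṅ*H, whereas H_p is transversal to Ṅ*H by Euler's identity, so a first-order
change of the time would lead out of Ṅ*H. Thus R has, within the set, the derivative of G^t at
frozen t, whose determinant is J_t, and the area formula for injective maps differentiable within a
measurable set applies. Injectivity holds because two points with the same image and different
return times would give a loop shorter than a first return.

The remaining work is the geometry behind this: a C¹ complete geodesic flow, obtained from
compactness of the level sets of p and conservation of p, and the independence of tangent spaces,
densities and Jacobians from the slice charts. -/

set_option linter.unusedSectionVars false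

/-! ### Local flows of vector fields and their C¹ dependence on the initial value. -/

section LocalFlow

variable {E : Type*} [NormedAddCommGroup E] [NormedSpace ℝ E]

/-- Quadratic estimate for the linearization of a flow, for positive times. -/
theorem norm_flow_sub_linearization_le {f : E → E} {f' : E → E →L[ℝ] E} {B : Set E}
    (hB : Convex ℝ B) {K M : NNReal} {b : ℝ} (hb : 0 ≤ b)
    (hf : ∀ x ∈ B, HasFDerivAt f (f' x) x) (hK : ∀ x ∈ B, ‖f' x‖ ≤ K)
    (hM : ∀ x ∈ B, ∀ y ∈ B, ‖f' x - f' y‖ ≤ M * ‖x - y‖)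
    {u v : ℝ → E} {L : ℝ → E →L[ℝ] E}
    (hu : ∀ t ∈ Icc 0 b, HasDerivAt u (f (u t)) t ∧ u t ∈ B)
    (hv : ∀ t ∈ Icc 0 b, HasDerivAt v (f (v t)) t ∧ v t ∈ B)
    (hL : ∀ t ∈ Icc 0 b, HasDerivAt L ((f' (u t)).comp (L t)) t)
    (hL0 : L 0 = ContinuousLinearMap.id ℝ E) :
    ‖v b - u b - L b (v 0 - u 0)‖ ≤
      gronwallBound 0 K (M * (Real.exp (K * b)) ^ 2 * ‖v 0 - u 0‖ ^ 2) b := by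
  have hlip : LipschitzOnWith K f B :=
    hB.lipschitzOnWith_of_nnnorm_hasFDerivWithin_le (fun x hx => (hf x hx).hasFDerivWithinAt)
      (fun x hx => by exact_mod_cast hK x hx)
  have hdist : ∀ t ∈ Icc 0 b, ‖v t - u t‖ ≤ ‖v 0 - u 0‖ * Real.exp (K * b) := by
    intro t ht
    have h := dist_le_of_trajectories_ODE_of_mem (v := fun _ => f) (s := fun _ => B) (a := 0)
      (b := b) (K := K) (f := v) (g := u) (fun t _ => hlip)
      (HasDerivAt.continuousOn fun t ht => (hv t ht).1)
      (fun t ht => (hv t (Ico_subset_Icc_self ht)).1.hasDerivWithinAt)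
      (fun t ht => (hv t (Ico_subset_Icc_self ht)).2)
      (HasDerivAt.continuousOn fun t ht => (hu t ht).1)
      (fun t ht => (hu t (Ico_subset_Icc_self ht)).1.hasDerivWithinAt)
      (fun t ht => (hu t (Ico_subset_Icc_self ht)).2) le_rfl t ht
    rw [dist_eq_norm, dist_eq_norm] at h
    refine h.trans ?_
    gcongr
    linarith [ht.2]
  set h₀ := v 0 - u 0
  have hder : ∀ t ∈ Icc 0 b, HasDerivAt (fun t => v t - u t - L t h₀)
      (f (v t) - f (u t) - (f' (u t)) (L t h₀)) t := by
    intro t ht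
    have h1 : HasDerivAt (fun t => L t h₀) (((f' (u t)).comp (L t)) h₀) t :=
      (hL t ht).clm_apply (hasDerivAt_const t h₀) |>.congr_deriv (by simp)
    exact ((hv t ht).1.sub (hu t ht).1).sub h1
  -- The error e = v - u - L h₀ solves e' = f'(u) e + (second-order Taylor remainder of f at u). The
  -- remainder is at most M ‖v - u‖², and `hdist` bounds ‖v - u‖ by its initial value; Grönwall's
  -- inequality then applies to e, which starts at 0.
  have hbound : ∀ t ∈ Ico 0 b, ‖f (v t) - f (u t) - (f' (u t)) (L t h₀)‖ ≤
      K * ‖v t - u t - L t h₀‖ + M * (Real.exp (K * b)) ^ 2 * ‖h₀‖ ^ 2 := by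
    intro t ht
    have ht' := Ico_subset_Icc_self ht
    have hseg : segment ℝ (u t) (v t) ⊆ B := hB.segment_subset (hu t ht').2 (hv t ht').2
    have h1 : ‖f (v t) - f (u t) - f' (u t) (v t - u t)‖ ≤ (M * ‖v t - u t‖) * ‖v t - u t‖ := by
      refine (convex_segment (u t) (v t)).norm_image_sub_le_of_norm_hasFDerivWithin_le'
        (fun x hx => (hf x (hseg hx)).hasFDerivWithinAt) (fun x hx => ?_)
        (left_mem_segment ℝ _ _) (right_mem_segment ℝ _ _)
      refine (hM x (hseg hx) _ (hu t ht').2).trans ?_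
      gcongr
      exact norm_sub_le_of_mem_segment hx
    have h2 : f (v t) - f (u t) - (f' (u t)) (L t h₀) =
        (f (v t) - f (u t) - f' (u t) (v t - u t)) + f' (u t) (v t - u t - L t h₀) := by
      simp only [map_sub]; abel
    rw [h2]
    have h3 : ‖f' (u t) (v t - u t - L t h₀)‖ ≤ K * ‖v t - u t - L t h₀‖ :=
      (ContinuousLinearMap.le_opNorm _ _).trans (by gcongr; exact hK _ (hu t ht').2)
    have h4 : (M * ‖v t - u t‖) * ‖v t - u t‖ ≤ M * (Real.exp (K * b)) ^ 2 * ‖h₀‖ ^ 2 := by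
      have := hdist t ht'
      calc (M * ‖v t - u t‖) * ‖v t - u t‖ = M * ‖v t - u t‖ ^ 2 := by ring
        _ ≤ M * (‖h₀‖ * Real.exp (K * b)) ^ 2 := by gcongr
        _ = _ := by ring
    refine (norm_add_le _ _).trans ?_
    linarith
  have := norm_le_gronwallBound_of_norm_deriv_right_le (a := 0) (b := b) (δ := 0)
    (HasDerivAt.continuousOn fun t ht => hder t ht)
    (fun t ht => (hder t (Ico_subset_Icc_self ht)).hasDerivWithinAt)
    (by simp [h₀, hL0]) hbound b ⟨hb, le_rfl⟩
  simpa using this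

/-- With zero initial error the Grönwall bound is linear in the inhomogeneity, so the squared
initial distance can be pulled out and the constant left over depends on the time only. -/
theorem gronwallBound_zero_mul (K c x b : ℝ) :
    gronwallBound 0 K (c * x) b = gronwallBound 0 K c b * x := by
  unfold gronwallBound
  split_ifs <;> ring

/-- A `C²` vector field has a local flow which is `C¹` in time and initial value. -/
theorem ContDiffAt.exists_contDiffOn_local_flow [CompleteSpace E] {f : E → E} {x₀ : E}
    (hf : ContDiffAt ℝ 2 f x₀) {S : Set E} (hS : S ∈ 𝓝 x₀) :
    ∃ ε > (0 : ℝ), ∃ r > (0 : ℝ), ∃ Ψ : ℝ → E → E,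
      (∀ x ∈ Metric.ball x₀ r, Ψ 0 x = x ∧ ∀ t ∈ Ioo (-ε) ε,
        HasDerivAt (fun s => Ψ s x) (f (Ψ t x)) t ∧ Ψ t x ∈ S) ∧
      ContDiffOn ℝ 1 (Function.uncurry Ψ) (Ioo (-ε) ε ×ˢ Metric.ball x₀ r) := by
  -- a convex neighbourhood with bounds
  have hf1 : ContDiffAt ℝ 1 (fderiv ℝ f) x₀ := hf.fderiv_right (m := 1) (by norm_num)
  obtain ⟨M, s, hs, hM⟩ := hf1.exists_lipschitzOnWith
  have hdiff : ∀ᶠ x in 𝓝 x₀, DifferentiableAt ℝ f x := by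
    filter_upwards [(hf.eventually (by simp))] with x hx
    exact hx.differentiableAt (by norm_num)
  have hKev : ∀ᶠ x in 𝓝 x₀, ‖fderiv ℝ f x‖ < ‖fderiv ℝ f x₀‖ + 1 :=
    hf1.continuousAt.norm.eventually_lt continuousAt_const (by simp)
  obtain ⟨ρ, hρ, hball⟩ := Metric.mem_nhds_iff.mp
    (inter_mem (inter_mem hs hS) (hdiff.and hKev))
  set B := Metric.ball x₀ ρ
  set K : NNReal := ⟨‖fderiv ℝ f x₀‖ + 1, by positivity⟩
  have hBconv : Convex ℝ B := convex_ball _ _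
  have hBf : ∀ x ∈ B, HasFDerivAt f (fderiv ℝ f x) x := fun x hx => (hball hx).2.1.hasFDerivAt
  have hBK : ∀ x ∈ B, ‖fderiv ℝ f x‖ ≤ K := fun x hx => (hball hx).2.2.le
  have hBM : ∀ x ∈ B, ∀ y ∈ B, ‖fderiv ℝ f x - fderiv ℝ f y‖ ≤ M * ‖x - y‖ := fun x hx y hy =>
    hM.norm_sub_le (hball hx).1.1 (hball hy).1.1
  -- the extended system
  set F : E × (E →L[ℝ] E) → E × (E →L[ℝ] E) := fun p => (f p.1, (fderiv ℝ f p.1).comp p.2)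
  set p₀ : E × (E →L[ℝ] E) := (x₀, ContinuousLinearMap.id ℝ E)
  have hF : ContDiffAt ℝ 1 F p₀ := by
    refine ContDiffAt.prodMk ?_ ?_
    · exact (hf.of_le (by norm_num)).comp p₀ contDiffAt_fst
    · exact (hf1.comp p₀ contDiffAt_fst).clm_comp contDiffAt_snd
  -- Solving the field together with its variational equation, from initial values (x, id), produces
  -- at once the flow Ψ and the candidate A for its space derivative, both jointly continuous.
  obtain ⟨ε₀, hε₀, a, r₀, _, _, hr₀, hpl⟩ := IsPicardLindelof.of_contDiffAt_one hF
  obtain ⟨α, hα, hαc⟩ := (hpl 0).exists_forall_mem_closedBall_eq_hasDerivWithinAt_continuousOn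
  simp only [zero_sub, zero_add] at hα hαc
  have hcα : ∀ p ∈ Metric.ball p₀ (r₀ : ℝ), ∀ t ∈ Ioo (-ε₀) ε₀, ContinuousAt α (p, t) := by
    intro p hp t ht
    refine hαc.continuousAt (prod_mem_nhds ?_ (Icc_mem_nhds ht.1 ht.2))
    exact mem_of_superset (Metric.isOpen_ball.mem_nhds hp) Metric.ball_subset_closedBall
  have hr₀' : (0 : ℝ) < r₀ := hr₀
  have hα0 : ContinuousAt α (p₀, 0) :=
    hcα p₀ (Metric.mem_ball_self hr₀') 0 ⟨by linarith, hε₀⟩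
  have hev : ∀ᶠ q in 𝓝 (p₀, (0 : ℝ)), (α q).1 ∈ B := by
    have h0 : (α (p₀, 0)).1 = x₀ := by
      rw [(hα p₀ (Metric.mem_closedBall_self r₀.2)).1]
    exact (continuousAt_fst.comp hα0).eventually_mem
      (Metric.isOpen_ball.mem_nhds (by simp [h0, hρ]))
  obtain ⟨δ, hδ, hδB⟩ := Metric.eventually_nhds_iff_ball.mp hev
  set ε := min δ ε₀
  set r := min δ (r₀ : ℝ)
  have hε : 0 < ε := lt_min hδ hε₀
  have hr : 0 < r := lt_min hδ hr₀
  have hmem : ∀ x ∈ Metric.ball x₀ r, ((x, ContinuousLinearMap.id ℝ E) : E × (E →L[ℝ] E)) ∈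
      Metric.ball p₀ (r₀ : ℝ) := by
    intro x hx
    simp only [Metric.mem_ball, p₀, Prod.dist_eq, dist_self] at hx ⊢
    exact max_lt (hx.trans_le (min_le_right _ _)) hr₀
  set Ψ : ℝ → E → E := fun t x => (α ((x, ContinuousLinearMap.id ℝ E), t)).1
  set A : ℝ → E → (E →L[ℝ] E) := fun t x => (α ((x, ContinuousLinearMap.id ℝ E), t)).2
  have hεI : ∀ t ∈ Ioo (-ε) ε, t ∈ Ioo (-ε₀) ε₀ := fun t ht =>
    ⟨by linarith [ht.1, min_le_right δ ε₀], by linarith [ht.2, min_le_right δ ε₀]⟩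
  have hinB : ∀ x ∈ Metric.ball x₀ r, ∀ t ∈ Ioo (-ε) ε, Ψ t x ∈ B := by
    intro x hx t ht
    refine hδB _ ?_
    simp only [Metric.mem_ball, p₀, Prod.dist_eq, dist_self, dist_zero_right, Real.norm_eq_abs]
      at hx ⊢
    refine max_lt (max_lt (hx.trans_le (min_le_left _ _)) hδ) ?_
    exact (abs_lt.mpr ht).trans_le (min_le_left _ _)
  have hderiv : ∀ x ∈ Metric.ball x₀ r, ∀ t ∈ Ioo (-ε) ε,
      HasDerivAt (fun s => α ((x, ContinuousLinearMap.id ℝ E), s))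
        (F (α ((x, ContinuousLinearMap.id ℝ E), t))) t := by
    intro x hx t ht
    have ht' := hεI t ht
    exact ((hα _ (Metric.ball_subset_closedBall (hmem x hx))).2 t
      (Ioo_subset_Icc_self ht')).hasDerivAt (Icc_mem_nhds ht'.1 ht'.2)
  have hΨ0 : ∀ x ∈ Metric.ball x₀ r, Ψ 0 x = x ∧ A 0 x = ContinuousLinearMap.id ℝ E := by
    intro x hx
    simp only [Ψ, A, (hα _ (Metric.ball_subset_closedBall (hmem x hx))).1, and_self]
  have hΨ' : ∀ x ∈ Metric.ball x₀ r, ∀ t ∈ Ioo (-ε) ε,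
      HasDerivAt (fun s => Ψ s x) (f (Ψ t x)) t := fun x hx t ht =>
    (hasFDerivAt_fst.comp_hasDerivAt t (hderiv x hx t ht)).congr_deriv (by simp [F, Ψ])
  have hA' : ∀ x ∈ Metric.ball x₀ r, ∀ t ∈ Ioo (-ε) ε,
      HasDerivAt (fun s => A s x) ((fderiv ℝ f (Ψ t x)).comp (A t x)) t := fun x hx t ht =>
    (hasFDerivAt_snd.comp_hasDerivAt t (hderiv x hx t ht)).congr_deriv (by simp [F, Ψ, A])
  have hcont : ∀ q ∈ Ioo (-ε) ε ×ˢ Metric.ball x₀ r, ContinuousAt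
      (fun q : ℝ × E => α ((q.2, ContinuousLinearMap.id ℝ E), q.1)) q := by
    intro q hq
    refine ContinuousAt.comp (f := fun q : ℝ × E => ((q.2, ContinuousLinearMap.id ℝ E), q.1))
      (hcα _ (hmem _ hq.2) _ (hεI _ hq.1)) (by fun_prop)
  -- differentiability in the initial value
  have hbd : ∀ t ∈ Ioo (-ε) ε, ∃ C : ℝ, ∀ x ∈ Metric.ball x₀ r, ∀ y ∈ Metric.ball x₀ r,
      ‖Ψ t y - Ψ t x - A t x (y - x)‖ ≤ C * ‖y - x‖ ^ 2 := by
    intro t ht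
    rcases le_total 0 t with h0 | h0
    · have hsub : ∀ s ∈ Icc 0 t, s ∈ Ioo (-ε) ε := fun s hs =>
        ⟨by linarith [hs.1], by linarith [hs.2, ht.2]⟩
      refine ⟨gronwallBound 0 K (M * (Real.exp (K * t)) ^ 2) t, fun x hx y hy => ?_⟩
      have := norm_flow_sub_linearization_le hBconv h0 hBf hBK hBM
        (u := fun s => Ψ s x) (v := fun s => Ψ s y) (L := fun s => A s x)
        (fun s hs => ⟨hΨ' x hx s (hsub s hs), hinB x hx s (hsub s hs)⟩)
        (fun s hs => ⟨hΨ' y hy s (hsub s hs), hinB y hy s (hsub s hs)⟩)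
        (fun s hs => hA' x hx s (hsub s hs)) (hΨ0 x hx).2
      rw [gronwallBound_zero_mul, (hΨ0 x hx).1, (hΨ0 y hy).1] at this
      exact this
    -- Negative times are positive times for the reversed field -f.
    · have hsub : ∀ s ∈ Icc 0 (-t), -s ∈ Ioo (-ε) ε := fun s hs =>
        ⟨by linarith [hs.2, ht.1], by linarith [hs.1]⟩
      refine ⟨gronwallBound 0 K (M * (Real.exp (K * -t)) ^ 2) (-t), fun x hx y hy => ?_⟩
      have hneg : ∀ {G : Type _} [NormedAddCommGroup G] [NormedSpace ℝ G] {c : ℝ → G} {c' : G}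
          {s : ℝ}, HasDerivAt c c' (-s) → HasDerivAt (fun s => c (-s)) (-c') s := by
        intro G _ _ c c' s h
        simpa [Function.comp_def] using h.scomp s (hasDerivAt_neg s)
      have := norm_flow_sub_linearization_le hBconv (neg_nonneg.mpr h0)
        (f := fun x => -f x) (f' := fun x => -fderiv ℝ f x) (K := K) (M := M)
        (fun x hx => (hBf x hx).neg) (fun x hx => by rw [norm_neg]; exact hBK x hx)
        (fun x hx y hy => by rw [neg_sub_neg, norm_sub_rev]; exact hBM x hx y hy)
        (u := fun s => Ψ (-s) x) (v := fun s => Ψ (-s) y) (L := fun s => A (-s) x)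
        (fun s hs => ⟨hneg (hΨ' x hx _ (hsub s hs)), hinB x hx _ (hsub s hs)⟩)
        (fun s hs => ⟨hneg (hΨ' y hy _ (hsub s hs)), hinB y hy _ (hsub s hs)⟩)
        (fun s hs => (hneg (hA' x hx _ (hsub s hs))).congr_deriv (by simp))
        (by simpa using (hΨ0 x hx).2)
      simp only [neg_neg, neg_zero] at this
      rw [gronwallBound_zero_mul, (hΨ0 x hx).1, (hΨ0 y hy).1] at this
      exact this
  have hΨx : ∀ t ∈ Ioo (-ε) ε, ∀ x ∈ Metric.ball x₀ r, HasFDerivAt (Ψ t) (A t x) x := by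
    intro t ht x hx
    obtain ⟨C, hC⟩ := hbd t ht
    refine HasFDerivAt.of_isLittleO (Asymptotics.IsBigO.trans_isLittleO
      (g := fun y => ‖y - x‖ ^ 2) ?_ ?_)
    · refine Asymptotics.IsBigO.of_bound C ?_
      filter_upwards [Metric.isOpen_ball.mem_nhds hx] with y hy
      rw [Real.norm_of_nonneg (by positivity)]
      exact hC x hx y hy
    · refine Asymptotics.IsLittleO.of_norm_right ?_
      have : Tendsto (fun y : E => ‖y - x‖) (𝓝 x) (𝓝 0) := by
        have h : Continuous fun y : E => ‖y - x‖ := by fun_prop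
        simpa using h.tendsto x
      exact (Asymptotics.isLittleO_pow_id one_lt_two).comp_tendsto this
  refine ⟨ε, hε, r, hr, Ψ, fun x hx => ⟨(hΨ0 x hx).1, fun t ht =>
    ⟨hΨ' x hx t ht, (hball (hinB x hx t ht)).1.2⟩⟩, ?_⟩
  have hopen : IsOpen (Ioo (-ε) ε ×ˢ Metric.ball x₀ r) := isOpen_Ioo.prod Metric.isOpen_ball
  set D₁ : ℝ → E → (ℝ →L[ℝ] E) := fun t x => ContinuousLinearMap.toSpanSingleton ℝ (f (Ψ t x))
  have hD₁ : ∀ q ∈ Ioo (-ε) ε ×ˢ Metric.ball x₀ r, ContinuousAt (Function.uncurry D₁) q := by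
    intro q hq
    have h1 : ContinuousAt (fun q : ℝ × E => f (Ψ q.1 q.2)) q :=
      ContinuousAt.comp (g := f) (f := fun q : ℝ × E => Ψ q.1 q.2)
        ((hBf _ (hinB _ hq.2 _ hq.1)).continuousAt) (continuousAt_fst.comp (hcont q hq))
    exact ((ContinuousLinearMap.toSpanSingletonCLE (𝕜 := ℝ) (E := E)).continuous.continuousAt).comp h1
  have hA : ∀ q ∈ Ioo (-ε) ε ×ˢ Metric.ball x₀ r, ContinuousAt (Function.uncurry A) q :=
    fun q hq => continuousAt_snd.comp (hcont q hq)
  -- Both partial derivatives exist nearby and are continuous at the point, hence the map of the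
  -- pair is strictly differentiable there.
  have hstrict : ∀ q ∈ Ioo (-ε) ε ×ˢ Metric.ball x₀ r, HasStrictFDerivAt (Function.uncurry Ψ)
      ((D₁ q.1 q.2).coprod (A q.1 q.2)) q := by
    intro q hq
    refine hasStrictFDerivAt_uncurry_coprod (f := Ψ) (f₁ := D₁) (f₂ := A) ?_ ?_ (hD₁ q hq) (hA q hq)
    · filter_upwards [hopen.mem_nhds hq] with v hv
      exact (hΨ' _ hv.2 _ hv.1).hasFDerivAt
    · filter_upwards [hopen.mem_nhds hq] with v hv
      exact hΨx _ hv.1 _ hv.2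
  have h01 : (1 : WithTop ℕ∞) = 0 + 1 := by norm_num
  rw [h01, contDiffOn_succ_iff_fderiv_of_isOpen hopen]
  refine ⟨fun q hq => (hstrict q hq).hasFDerivAt.differentiableAt.differentiableWithinAt,
    by simp, ?_⟩
  rw [contDiffOn_zero]
  have : ContinuousOn (fun q : ℝ × E => (D₁ q.1 q.2).coprod (A q.1 q.2))
      (Ioo (-ε) ε ×ˢ Metric.ball x₀ r) := by
    intro q hq
    have h : ContinuousAt (fun q : ℝ × E => (D₁ q.1 q.2).comp (ContinuousLinearMap.fst ℝ ℝ E) +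
        (A q.1 q.2).comp (ContinuousLinearMap.snd ℝ ℝ E)) q :=
      ((hD₁ q hq).clm_comp continuousAt_const).add ((hA q hq).clm_comp continuousAt_const)
    refine ContinuousAt.continuousWithinAt (h.congr (Eventually.of_forall fun q => ?_))
    ext <;> simp
  exact this.congr fun q hq => (hstrict q hq).hasFDerivAt.fderiv

end LocalFlow

/-! ### Canonical coordinates on T*M for arbitrary charts of the maximal atlas. -/

noncomputable section

namespace ConormalFlow

section

variable {n : ℕ} {M : Type*} [TopologicalSpace M] [ChartedSpace (Rn n) M]

/-- The canonical coordinates `(x, ξ)` on `T*M` induced by the chart `φ`. -/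
def canCoord (φ : OpenPartialHomeomorph M (Rn n)) (z : Cot n M) : Rn n × (Rn n →L[ℝ] ℝ) :=
  (φ z.1, z.2.comp (chartDeriv φ z.1).inverse)

/-- The point of `T*M` with given canonical coordinates. -/
def canPoint (φ : OpenPartialHomeomorph M (Rn n)) (w : Rn n × (Rn n →L[ℝ] ℝ)) : Cot n M :=
  ⟨φ.symm w.1, w.2.comp (chartDeriv φ (φ.symm w.1))⟩

/-- The transition map between the canonical coordinates of two charts. -/
def canTransition (φ ψ : OpenPartialHomeomorph M (Rn n)) (w : Rn n × (Rn n →L[ℝ] ℝ)) :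
    Rn n × (Rn n →L[ℝ] ℝ) :=
  (ψ (φ.symm w.1), w.2.comp (fderiv ℝ (φ ∘ ψ.symm) (ψ (φ.symm w.1))))

variable [IsManifold 𝓘(ℝ, Rn n) ∞ M]

variable {φ ψ : OpenPartialHomeomorph M (Rn n)}

theorem mdifferentiable_of_maximalAtlas (hφ : φ ∈ IsManifold.maximalAtlas 𝓘(ℝ, Rn n) ∞ M) :
    φ.MDifferentiable 𝓘(ℝ, Rn n) 𝓘(ℝ, Rn n) :=
  ⟨(contMDiffOn_of_mem_maximalAtlas hφ).mdifferentiableOn (by simp),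
    (contMDiffOn_symm_of_mem_maximalAtlas hφ).mdifferentiableOn (by simp)⟩

theorem chartDeriv_comp_symm (hφ : φ ∈ IsManifold.maximalAtlas 𝓘(ℝ, Rn n) ∞ M) {x : M}
    (hx : x ∈ φ.source) :
    (chartDeriv φ x).comp (mfderiv 𝓘(ℝ, Rn n) 𝓘(ℝ, Rn n) φ.symm (φ x)) =
      ContinuousLinearMap.id ℝ (Rn n) := by
  have h := (mdifferentiable_of_maximalAtlas hφ).comp_symm_deriv (φ.map_source hx)
  rw [φ.left_inv hx] at h
  exact h

theorem symm_comp_chartDeriv (hφ : φ ∈ IsManifold.maximalAtlas 𝓘(ℝ, Rn n) ∞ M) {x : M}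
    (hx : x ∈ φ.source) :
    (mfderiv 𝓘(ℝ, Rn n) 𝓘(ℝ, Rn n) φ.symm (φ x)).comp (chartDeriv φ x) =
      ContinuousLinearMap.id ℝ (TangentSpace 𝓘(ℝ, Rn n) x) :=
  (mdifferentiable_of_maximalAtlas hφ).symm_comp_deriv hx

theorem chartDeriv_inverse (hφ : φ ∈ IsManifold.maximalAtlas 𝓘(ℝ, Rn n) ∞ M) {x : M}
    (hx : x ∈ φ.source) :
    (chartDeriv φ x).inverse = (mfderiv 𝓘(ℝ, Rn n) 𝓘(ℝ, Rn n) φ.symm (φ x) :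
      Rn n →L[ℝ] Rn n) :=
  ContinuousLinearMap.inverse_eq (chartDeriv_comp_symm hφ hx) (symm_comp_chartDeriv hφ hx)

theorem chartDeriv_comp_inverse (hφ : φ ∈ IsManifold.maximalAtlas 𝓘(ℝ, Rn n) ∞ M) {x : M}
    (hx : x ∈ φ.source) :
    (chartDeriv φ x).comp (chartDeriv φ x).inverse = ContinuousLinearMap.id ℝ (Rn n) := by
  rw [chartDeriv_inverse hφ hx]
  exact chartDeriv_comp_symm hφ hx

theorem inverse_comp_chartDeriv (hφ : φ ∈ IsManifold.maximalAtlas 𝓘(ℝ, Rn n) ∞ M) {x : M}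
    (hx : x ∈ φ.source) :
    (chartDeriv φ x).inverse.comp (chartDeriv φ x) =
      ContinuousLinearMap.id ℝ (TangentSpace 𝓘(ℝ, Rn n) x) := by
  rw [chartDeriv_inverse hφ hx]
  exact symm_comp_chartDeriv hφ hx

theorem transition_contDiffOn (hφ : φ ∈ IsManifold.maximalAtlas 𝓘(ℝ, Rn n) ∞ M)
    (hψ : ψ ∈ IsManifold.maximalAtlas 𝓘(ℝ, Rn n) ∞ M) :
    ContDiffOn ℝ ∞ (ψ ∘ φ.symm) (φ.target ∩ φ.symm ⁻¹' ψ.source) := by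
  rw [← contMDiffOn_iff_contDiffOn]
  refine (contMDiffOn_of_mem_maximalAtlas hψ).comp
    ((contMDiffOn_symm_of_mem_maximalAtlas hφ).mono inter_subset_left) fun y hy => hy.2

theorem transition_contDiffAt (hφ : φ ∈ IsManifold.maximalAtlas 𝓘(ℝ, Rn n) ∞ M)
    (hψ : ψ ∈ IsManifold.maximalAtlas 𝓘(ℝ, Rn n) ∞ M) {y : Rn n} (hy : y ∈ φ.target)
    (hy' : φ.symm y ∈ ψ.source) : ContDiffAt ℝ ∞ (ψ ∘ φ.symm) y :=
  (transition_contDiffOn hφ hψ).contDiffAt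
    ((φ.isOpen_inter_preimage_symm ψ.open_source).mem_nhds ⟨hy, hy'⟩)

/-- Chain rule at x. It is the bridge from derivatives on the manifold to Euclidean derivatives of
transition maps. -/
theorem chartDeriv_comp_inverse_eq_fderiv (hφ : φ ∈ IsManifold.maximalAtlas 𝓘(ℝ, Rn n) ∞ M)
    (hψ : ψ ∈ IsManifold.maximalAtlas 𝓘(ℝ, Rn n) ∞ M) {x : M} (hx : x ∈ φ.source)
    (hx' : x ∈ ψ.source) :
    (chartDeriv φ x).comp (chartDeriv ψ x).inverse = fderiv ℝ (φ ∘ ψ.symm) (ψ x) := by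
  rw [chartDeriv_inverse hψ hx', ← mfderiv_eq_fderiv, mfderiv_comp (I' := 𝓘(ℝ, Rn n)) (ψ x)
    (by rw [ψ.left_inv hx']; exact (mdifferentiable_of_maximalAtlas hφ).mdifferentiableAt hx)
    ((mdifferentiable_of_maximalAtlas hψ).mdifferentiableAt_symm (ψ.map_source hx')),
    ψ.left_inv hx']
  rfl

theorem canPoint_canCoord (hφ : φ ∈ IsManifold.maximalAtlas 𝓘(ℝ, Rn n) ∞ M) {z : Cot n M}
    (hz : z.1 ∈ φ.source) : canPoint φ (canCoord φ z) = z := by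
  obtain ⟨x, ξ⟩ := z
  simp only [canPoint, canCoord] at hz ⊢
  have h : ξ.comp ((chartDeriv φ x).inverse.comp (chartDeriv φ x)) = ξ := by
    rw [inverse_comp_chartDeriv hφ hz]; rfl
  rw [φ.left_inv hz]
  exact congrArg _ h

theorem canCoord_canPoint (hφ : φ ∈ IsManifold.maximalAtlas 𝓘(ℝ, Rn n) ∞ M)
    {w : Rn n × (Rn n →L[ℝ] ℝ)} (hw : w.1 ∈ φ.target) : canCoord φ (canPoint φ w) = w := by
  simp only [canPoint, canCoord]
  ext1
  · exact φ.right_inv hw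
  · have h := chartDeriv_comp_inverse hφ (φ.map_target hw)
    exact ContinuousLinearMap.ext fun v => congrArg w.2 (DFunLike.congr_fun h v)

theorem canCoord_canPoint_eq (hφ : φ ∈ IsManifold.maximalAtlas 𝓘(ℝ, Rn n) ∞ M)
    (hψ : ψ ∈ IsManifold.maximalAtlas 𝓘(ℝ, Rn n) ∞ M) {w : Rn n × (Rn n →L[ℝ] ℝ)}
    (hw : w.1 ∈ φ.target) (hw' : φ.symm w.1 ∈ ψ.source) :
    canCoord ψ (canPoint φ w) = canTransition φ ψ w := by
  simp only [canPoint, canCoord, canTransition]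
  rw [← chartDeriv_comp_inverse_eq_fderiv hφ hψ (φ.map_target hw) hw']
  rfl

theorem canTransition_canCoord (hφ : φ ∈ IsManifold.maximalAtlas 𝓘(ℝ, Rn n) ∞ M)
    (hψ : ψ ∈ IsManifold.maximalAtlas 𝓘(ℝ, Rn n) ∞ M) {z : Cot n M} (hz : z.1 ∈ φ.source)
    (hz' : z.1 ∈ ψ.source) : canTransition φ ψ (canCoord φ z) = canCoord ψ z := by
  rw [← canCoord_canPoint_eq hφ hψ (φ.map_source hz), canPoint_canCoord hφ hz]
  simpa [canCoord, φ.left_inv hz]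

theorem canTransition_contDiffAt (hφ : φ ∈ IsManifold.maximalAtlas 𝓘(ℝ, Rn n) ∞ M)
    (hψ : ψ ∈ IsManifold.maximalAtlas 𝓘(ℝ, Rn n) ∞ M) {w : Rn n × (Rn n →L[ℝ] ℝ)}
    (hw : w.1 ∈ φ.target) (hw' : φ.symm w.1 ∈ ψ.source) :
    ContDiffAt ℝ ∞ (canTransition φ ψ) w := by
  have h1 : ContDiffAt ℝ ∞ (fun w : Rn n × (Rn n →L[ℝ] ℝ) => ψ (φ.symm w.1)) w :=
    (transition_contDiffAt hφ hψ hw hw').comp w contDiffAt_fst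
  have h2 : ContDiffAt ℝ ∞ (fderiv ℝ (φ ∘ ψ.symm)) (ψ (φ.symm w.1)) := by
    refine ContDiffAt.fderiv_right (m := ∞) (n := ∞) ?_ (by simp)
    refine transition_contDiffAt hψ hφ (ψ.map_source hw') ?_
    rw [ψ.left_inv hw']
    exact φ.map_target hw
  exact h1.prodMk (contDiffAt_snd.clm_comp (h2.comp w h1))

/-- The preferred chart of `T*M` is given by canonical coordinates. -/
theorem extChartAt_cot {z₀ z : Cot n M} (hz : z.1 ∈ (chartAt (Rn n) z₀.1).source) :
    extChartAt (cotModel n) z₀ z = canCoord (chartAt (Rn n) z₀.1) z := by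
  have h : extChartAt (cotModel n) z₀ z =
      chartAt (ModelProd (Rn n) (Rn n →L[ℝ] ℝ)) z₀ z := rfl
  rw [h, hom_chart]
  have h2 : (chartDeriv (chartAt (Rn n) z₀.1) z.1).inverse =
      (trivializationAt (Rn n) (TangentSpace 𝓘(ℝ, Rn n)) z₀.1).symmL ℝ z.1 := by
    rw [TangentBundle.symmL_trivializationAt hz,
      chartDeriv_inverse (IsManifold.chart_mem_maximalAtlas z₀.1) hz]
    simp only [mfld_simps, mfderivWithin_univ]
    rfl
  simp only [canCoord]
  ext1
  · rfl
  · rw [h2]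
    simp only [ContinuousLinearMap.inCoordinates]
    ext v
    simp

theorem chart_source_cot (z₀ : Cot n M) :
    (chartAt (ModelProd (Rn n) (Rn n →L[ℝ] ℝ)) z₀).source =
      {z : Cot n M | z.1 ∈ (chartAt (Rn n) z₀.1).source} := by
  rw [FiberBundle.chartedSpace_chartAt]
  ext z
  simp [mfld_simps, hom_trivializationAt_apply]

/-- In the preferred chart the coordinates are those defining the smooth structure of T*M; any other
chart differs from it by `canTransition`, which is smooth. -/
theorem contMDiffAt_canCoord (hφ : φ ∈ IsManifold.maximalAtlas 𝓘(ℝ, Rn n) ∞ M) {z : Cot n M}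
    (hz : z.1 ∈ φ.source) :
    ContMDiffAt (cotModel n) 𝓘(ℝ, Rn n × (Rn n →L[ℝ] ℝ)) ∞ (canCoord φ) z := by
  set φ₀ := chartAt (Rn n) z.1
  have hφ₀ : φ₀ ∈ IsManifold.maximalAtlas 𝓘(ℝ, Rn n) ∞ M := IsManifold.chart_mem_maximalAtlas z.1
  have hz0 : z.1 ∈ φ₀.source := mem_chart_source _ _
  have hcont : ContinuousAt (fun w : Cot n M => w.1) z :=
    (FiberBundle.continuous_proj _ _).continuousAt
  have h1 : ContMDiffAt (cotModel n) 𝓘(ℝ, Rn n × (Rn n →L[ℝ] ℝ)) ∞ (canCoord φ₀) z := by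
    refine (contMDiffAt_extChartAt (I := cotModel n) (x := z)).congr_of_eventuallyEq ?_
    filter_upwards [hcont.preimage_mem_nhds (φ₀.open_source.mem_nhds hz0)] with w hw
    exact (extChartAt_cot hw).symm
  have h2 : ContDiffAt ℝ ∞ (canTransition φ₀ φ) (canCoord φ₀ z) :=
    canTransition_contDiffAt hφ₀ hφ (φ₀.map_source hz0) (by simpa [canCoord, φ₀.left_inv hz0])
  refine (h2.contMDiffAt.comp z h1).congr_of_eventuallyEq ?_
  filter_upwards [hcont.preimage_mem_nhds (φ₀.open_source.mem_nhds hz0),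
    hcont.preimage_mem_nhds (φ.open_source.mem_nhds hz)] with w hw hw'
  exact (canTransition_canCoord hφ₀ hφ hw hw').symm

theorem contMDiffAt_canPoint (hφ : φ ∈ IsManifold.maximalAtlas 𝓘(ℝ, Rn n) ∞ M)
    {w : Rn n × (Rn n →L[ℝ] ℝ)} (hw : w.1 ∈ φ.target) :
    ContMDiffAt 𝓘(ℝ, Rn n × (Rn n →L[ℝ] ℝ)) (cotModel n) ∞ (canPoint φ) w := by
  set z := canPoint φ w
  set φ₀ := chartAt (Rn n) z.1
  have hφ₀ : φ₀ ∈ IsManifold.maximalAtlas 𝓘(ℝ, Rn n) ∞ M := IsManifold.chart_mem_maximalAtlas z.1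
  have hz0 : z.1 ∈ φ₀.source := mem_chart_source _ _
  have hsymm : ∀ v : Rn n × (Rn n →L[ℝ] ℝ), v.1 ∈ φ₀.target →
      (extChartAt (cotModel n) z).symm v = canPoint φ₀ v := by
    intro v hv
    have hs : (canPoint φ₀ v).1 ∈ φ₀.source := φ₀.map_target hv
    have hs' : canPoint φ₀ v ∈ (extChartAt (cotModel n) z).source := by
      rw [extChartAt_source, chart_source_cot]
      exact hs
    rw [← (extChartAt (cotModel n) z).left_inv hs', extChartAt_cot hs, canCoord_canPoint hφ₀ hv]
  have htr : ContDiffAt ℝ ∞ (canTransition φ φ₀) w := canTransition_contDiffAt hφ hφ₀ hw hz0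
  have hc : canTransition φ φ₀ w = extChartAt (cotModel n) z z := by
    rw [extChartAt_cot hz0, ← canCoord_canPoint_eq hφ hφ₀ hw hz0]
  have h1 : ContMDiffAt 𝓘(ℝ, Rn n × (Rn n →L[ℝ] ℝ)) (cotModel n) ∞
      (extChartAt (cotModel n) z).symm (canTransition φ φ₀ w) := by
    rw [hc]
    exact (contMDiffOn_extChartAt_symm z).contMDiffAt (extChartAt_target_mem_nhds z)
  refine (h1.comp w htr.contMDiffAt).congr_of_eventuallyEq ?_
  have hopen := (φ.isOpen_inter_preimage_symm φ₀.open_source).preimage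
    (continuous_fst (X := Rn n) (Y := Rn n →L[ℝ] ℝ))
  filter_upwards [hopen.mem_nhds ⟨hw, hz0⟩] with v hv
  have hv1 : (canTransition φ φ₀ v).1 ∈ φ₀.target := φ₀.map_source hv.2
  rw [Function.comp_apply, hsymm _ hv1, ← canCoord_canPoint_eq hφ hφ₀ hv.1 hv.2]
  exact (canPoint_canCoord hφ₀ (z := canPoint φ v) hv.2).symm

/-- The metric is smooth as a section of a bundle; smooth frames turn this into smoothness of the
matrix entries. -/
theorem contMDiffAt_frame (hφ : φ ∈ IsManifold.maximalAtlas 𝓘(ℝ, Rn n) ∞ M) {x₀ : M}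
    (hx₀ : x₀ ∈ φ.source) (i : Fin n) :
    ContMDiffAt 𝓘(ℝ, Rn n) (𝓘(ℝ, Rn n).prod 𝓘(ℝ, Rn n)) ∞
      (fun x => TotalSpace.mk' (Rn n) (E := TangentSpace 𝓘(ℝ, Rn n)) x (frame φ x i)) x₀ := by
  rw [contMDiffAt_section]
  set φ₀ := chartAt (Rn n) x₀
  have hφ₀ : φ₀ ∈ IsManifold.maximalAtlas 𝓘(ℝ, Rn n) ∞ M := IsManifold.chart_mem_maximalAtlas x₀
  have hx0 : x₀ ∈ φ₀.source := mem_chart_source _ _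
  have h1 : ContDiffAt ℝ ∞ (fun y => fderiv ℝ (φ₀ ∘ φ.symm) y (EuclideanSpace.single i (1 : ℝ)))
      (φ x₀) := by
    refine ContDiffAt.clm_apply (ContDiffAt.fderiv_right (m := ∞) (n := ∞) ?_ (by simp))
      contDiffAt_const
    exact transition_contDiffAt hφ hφ₀ (φ.map_source hx₀) (by rwa [φ.left_inv hx₀])
  refine (h1.contMDiffAt.comp x₀ (contMDiffAt_of_mem_maximalAtlas hφ hx₀)).congr_of_eventuallyEq ?_
  filter_upwards [φ₀.open_source.mem_nhds hx0, φ.open_source.mem_nhds hx₀] with x hx hx'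
  rw [Function.comp_apply, ← chartDeriv_comp_inverse_eq_fderiv hφ₀ hφ hx hx']
  have h := TangentBundle.continuousLinearMapAt_trivializationAt (I := 𝓘(ℝ, Rn n)) (x₀ := x₀) hx
  have h2 := Trivialization.continuousLinearMapAt_apply_of_mem (R := ℝ)
    (trivializationAt (Rn n) (TangentSpace 𝓘(ℝ, Rn n)) x₀) (b := x) hx (frame φ x i)
  rw [← h2, h]
  rfl

theorem contMDiffAt_metricMatrix (g : Metric n M)
    (hφ : φ ∈ IsManifold.maximalAtlas 𝓘(ℝ, Rn n) ∞ M) {x₀ : M} (hx₀ : x₀ ∈ φ.source)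
    (i j : Fin n) :
    ContMDiffAt 𝓘(ℝ, Rn n) 𝓘(ℝ, ℝ) ∞ (fun x => metricMatrix g φ x i j) x₀ := by
  have h : ContMDiffAt 𝓘(ℝ, Rn n) (𝓘(ℝ, Rn n).prod 𝓘(ℝ, ℝ)) ∞
      (fun x => TotalSpace.mk' ℝ (E := Bundle.Trivial M ℝ) x (metricMatrix g φ x i j)) x₀ :=
    ContMDiffAt.clm_bundle_apply₂ (b := fun x : M => x) (g.contMDiff x₀) (contMDiffAt_frame hφ hx₀ i)
      (contMDiffAt_frame hφ hx₀ j)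
  exact (contMDiffAt_section x₀).1 h

end

end ConormalFlow

end

/-! ### The metric and the symbol p in coordinates. -/

noncomputable section

theorem Matrix.contDiffAt_det {E ι : Type*} [NormedAddCommGroup E] [NormedSpace ℝ E] [Fintype ι]
    [DecidableEq ι] {A : E → Matrix ι ι ℝ} {x : E} {k : WithTop ℕ∞}
    (hA : ∀ i j, ContDiffAt ℝ k (fun y => A y i j) x) : ContDiffAt ℝ k (fun y => (A y).det) x := by
  simp only [Matrix.det_apply]
  refine ContDiffAt.sum fun σ _ => ContDiffAt.const_smul _ ?_
  exact contDiffAt_prod fun i _ => hA _ _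

theorem Matrix.contDiffAt_inv {E ι : Type*} [NormedAddCommGroup E] [NormedSpace ℝ E] [Fintype ι]
    [DecidableEq ι] {A : E → Matrix ι ι ℝ} {x : E} {k : WithTop ℕ∞}
    (hA : ∀ i j, ContDiffAt ℝ k (fun y => A y i j) x) (hdet : (A x).det ≠ 0) (i j : ι) :
    ContDiffAt ℝ k (fun y => (A y)⁻¹ i j) x := by
  simp only [Matrix.inv_def, Ring.inverse_eq_inv', Matrix.smul_apply, smul_eq_mul,
    Matrix.adjugate_apply]
  refine ((Matrix.contDiffAt_det hA).inv hdet).mul (Matrix.contDiffAt_det fun a b => ?_)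
  by_cases h : a = j
  · subst h
    simp only [Matrix.updateRow_self]
    exact contDiffAt_const
  · simp only [Matrix.updateRow_ne h]
    exact hA a b

namespace ConormalFlow
section
variable {n : ℕ} {M : Type*} [TopologicalSpace M] [ChartedSpace (Rn n) M]
variable [IsManifold 𝓘(ℝ, Rn n) ∞ M]
variable {φ ψ : OpenPartialHomeomorph M (Rn n)}

/-- The matrix of the change of coordinate frames from the chart `ψ` to the chart `φ`. -/
def frameMatrix (φ ψ : OpenPartialHomeomorph M (Rn n)) (x : M) : Matrix (Fin n) (Fin n) ℝ :=
  Matrix.of fun i j => (chartDeriv φ x (frame ψ x j)) i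

theorem inverse_chartDeriv_apply (φ : OpenPartialHomeomorph M (Rn n)) (x : M) (v : Rn n) :
    (chartDeriv φ x).inverse v = ∑ i, v i • frame φ x i := by
  conv_lhs => rw [← (EuclideanSpace.basisFun (Fin n) ℝ).sum_repr v]
  simp [frame, map_sum]

theorem frame_eq_sum (hφ : φ ∈ IsManifold.maximalAtlas 𝓘(ℝ, Rn n) ∞ M) {x : M}
    (hx : x ∈ φ.source) (ψ : OpenPartialHomeomorph M (Rn n)) (j : Fin n) :
    frame ψ x j = ∑ i, frameMatrix φ ψ x i j • frame φ x i := by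
  have h := DFunLike.congr_fun (inverse_comp_chartDeriv hφ hx) (frame ψ x j)
  rw [ContinuousLinearMap.comp_apply, inverse_chartDeriv_apply] at h
  exact h.symm

theorem chartDeriv_frame (hφ : φ ∈ IsManifold.maximalAtlas 𝓘(ℝ, Rn n) ∞ M) {x : M}
    (hx : x ∈ φ.source) (j : Fin n) :
    chartDeriv φ x (frame φ x j) = EuclideanSpace.single j (1 : ℝ) :=
  DFunLike.congr_fun (chartDeriv_comp_inverse hφ hx) (EuclideanSpace.single j (1 : ℝ))

theorem frameMatrix_mul_self (hφ : φ ∈ IsManifold.maximalAtlas 𝓘(ℝ, Rn n) ∞ M)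
    (hψ : ψ ∈ IsManifold.maximalAtlas 𝓘(ℝ, Rn n) ∞ M) {x : M} (hx : x ∈ φ.source)
    (hx' : x ∈ ψ.source) : frameMatrix φ ψ x * frameMatrix ψ φ x = 1 := by
  ext i j
  have h := congrArg (fun v => (chartDeriv φ x v) i) (frame_eq_sum hψ hx' φ j)
  simp only [chartDeriv_frame hφ hx, map_sum, map_smul] at h
  simp only [Matrix.mul_apply, Matrix.one_apply]
  simp only [PiLp.single_apply] at h
  rw [h, WithLp.ofLp_sum, Finset.sum_apply]
  exact Finset.sum_congr rfl fun k _ => mul_comm _ _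

theorem isUnit_det_frameMatrix (hφ : φ ∈ IsManifold.maximalAtlas 𝓘(ℝ, Rn n) ∞ M)
    (hψ : ψ ∈ IsManifold.maximalAtlas 𝓘(ℝ, Rn n) ∞ M) {x : M} (hx : x ∈ φ.source)
    (hx' : x ∈ ψ.source) : IsUnit (frameMatrix φ ψ x).det := by
  have := congrArg Matrix.det (frameMatrix_mul_self hφ hψ hx hx')
  rw [Matrix.det_mul, Matrix.det_one] at this
  exact IsUnit.of_mul_eq_one _ this

theorem metricMatrix_transform (g : Metric n M) (hφ : φ ∈ IsManifold.maximalAtlas 𝓘(ℝ, Rn n) ∞ M)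
    {x : M} (hx : x ∈ φ.source) (ψ : OpenPartialHomeomorph M (Rn n)) :
    metricMatrix g ψ x =
      (frameMatrix φ ψ x).transpose * metricMatrix g φ x * frameMatrix φ ψ x := by
  ext i j
  simp only [metricMatrix, Matrix.of_apply, Matrix.mul_apply, Matrix.transpose_apply]
  rw [frame_eq_sum hφ hx ψ i, frame_eq_sum hφ hx ψ j]
  simp only [map_sum, map_smul, sum_apply, smul_apply,
    smul_eq_mul, Finset.mul_sum, Finset.sum_mul]
  refine Finset.sum_congr rfl fun k _ => Finset.sum_congr rfl fun l _ => by ring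

theorem metricMatrix_posDef (g : Metric n M) (hφ : φ ∈ IsManifold.maximalAtlas 𝓘(ℝ, Rn n) ∞ M)
    {x : M} (hx : x ∈ φ.source) : (metricMatrix g φ x).PosDef := by
  refine Matrix.PosDef.of_dotProduct_mulVec_pos ?_ fun v hv => ?_
  · ext i j
    simp [metricMatrix, g.symm x]
  · have h0 : (chartDeriv φ x).inverse (WithLp.toLp 2 v) ≠ 0 := by
      intro h
      have := DFunLike.congr_fun (chartDeriv_comp_inverse hφ hx) (WithLp.toLp 2 v)
      rw [ContinuousLinearMap.comp_apply, h, map_zero] at this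
      exact hv (by simpa using congrArg WithLp.ofLp this.symm)
    have h1 := g.pos x _ h0
    rw [inverse_chartDeriv_apply] at h1
    simp only [map_sum, map_smul, sum_apply, smul_apply, smul_eq_mul, Finset.mul_sum] at h1
    simp only [dotProduct, Matrix.mulVec, star_trivial, metricMatrix, Matrix.of_apply,
      Finset.mul_sum]
    rw [Finset.sum_comm] at h1
    refine h1.trans_eq (Finset.sum_congr rfl fun i _ => Finset.sum_congr rfl fun j _ => ?_)
    ring

/-- The components of a covector in the coordinates of the chart `φ`. -/
def covComp (φ : OpenPartialHomeomorph M (Rn n)) (z : Cot n M) (i : Fin n) : ℝ :=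
  z.2 (frame φ z.1 i)

theorem covComp_transform (hφ : φ ∈ IsManifold.maximalAtlas 𝓘(ℝ, Rn n) ∞ M) {z : Cot n M}
    (hz : z.1 ∈ φ.source) (ψ : OpenPartialHomeomorph M (Rn n)) :
    covComp ψ z = (frameMatrix φ ψ z.1).transpose.mulVec (covComp φ z) := by
  ext j
  simp only [covComp, Matrix.mulVec, dotProduct, Matrix.transpose_apply]
  rw [frame_eq_sum hφ hz ψ j]
  simp [map_sum]

/-- The square of the symbol, as a function on the canonical coordinates of the chart `φ`. -/
def energyCoord (g : Metric n M) (φ : OpenPartialHomeomorph M (Rn n))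
    (w : Rn n × (Rn n →L[ℝ] ℝ)) : ℝ :=
  ∑ i, ∑ j, (metricMatrix g φ (φ.symm w.1))⁻¹ i j * w.2 (EuclideanSpace.single i (1 : ℝ)) *
    w.2 (EuclideanSpace.single j (1 : ℝ))

/-- The symbol as a function on the canonical coordinates of the chart `φ`. -/
def symbolCoord (g : Metric n M) (φ : OpenPartialHomeomorph M (Rn n))
    (w : Rn n × (Rn n →L[ℝ] ℝ)) : ℝ := √(energyCoord g φ w)

theorem energyCoord_canCoord (g : Metric n M) {z : Cot n M} (hz : z.1 ∈ φ.source) :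
    energyCoord g φ (canCoord φ z) =
      dotProduct (covComp φ z) ((metricMatrix g φ z.1)⁻¹.mulVec (covComp φ z)) := by
  simp only [energyCoord, canCoord, φ.left_inv hz, dotProduct, Matrix.mulVec, Finset.mul_sum]
  refine Finset.sum_congr rfl fun i _ => Finset.sum_congr rfl fun j _ => ?_
  change _ * z.2 (frame φ z.1 i) * z.2 (frame φ z.1 j) =
    z.2 (frame φ z.1 i) * (_ * z.2 (frame φ z.1 j))
  ring

/-- If B is the change of frames, the metric matrix becomes BᵀGB and the components of the covector
are multiplied by Bᵀ, so B cancels. Consequently `symbol`, which uses a different preferred chart at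
each point, is given near every point by one smooth formula. -/
theorem energyCoord_eq (g : Metric n M) (hφ : φ ∈ IsManifold.maximalAtlas 𝓘(ℝ, Rn n) ∞ M)
    (hψ : ψ ∈ IsManifold.maximalAtlas 𝓘(ℝ, Rn n) ∞ M) {z : Cot n M} (hz : z.1 ∈ φ.source)
    (hz' : z.1 ∈ ψ.source) : energyCoord g ψ (canCoord ψ z) = energyCoord g φ (canCoord φ z) := by
  rw [energyCoord_canCoord g hz, energyCoord_canCoord g hz', metricMatrix_transform g hφ hz ψ,
    covComp_transform hφ hz ψ]
  have hB := isUnit_det_frameMatrix hφ hψ hz hz'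
  set B := frameMatrix φ ψ z.1
  have hB' : IsUnit B.transpose.det := by rwa [Matrix.det_transpose]
  rw [Matrix.mul_inv_rev, Matrix.mul_inv_rev, Matrix.mulVec_mulVec, Matrix.mulVec_transpose B,
    ← Matrix.dotProduct_mulVec, Matrix.mulVec_mulVec]
  congr 2
  rw [← Matrix.mul_assoc, ← Matrix.mul_assoc, Matrix.mul_nonsing_inv _ hB, Matrix.one_mul,
    Matrix.mul_assoc, Matrix.nonsing_inv_mul _ hB', Matrix.mul_one]

theorem symbol_eq_symbolCoord (g : Metric n M) (hφ : φ ∈ IsManifold.maximalAtlas 𝓘(ℝ, Rn n) ∞ M)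
    {z : Cot n M} (hz : z.1 ∈ φ.source) : symbol g z = symbolCoord g φ (canCoord φ z) := by
  have h0 : z.1 ∈ (chartAt (Rn n) z.1).source := mem_chart_source _ _
  rw [symbolCoord, energyCoord_eq g (IsManifold.chart_mem_maximalAtlas z.1) hφ h0 hz]
  simp only [symbol, energyCoord, canCoord, (chartAt (Rn n) z.1).left_inv h0]
  rfl

theorem energyCoord_pos (g : Metric n M) (hφ : φ ∈ IsManifold.maximalAtlas 𝓘(ℝ, Rn n) ∞ M)
    {w : Rn n × (Rn n →L[ℝ] ℝ)} (hw : w.1 ∈ φ.target) (hw2 : w.2 ≠ 0) :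
    0 < energyCoord g φ w := by
  have hpd := (metricMatrix_posDef g hφ (φ.map_target hw)).inv
  have hv : (fun i => w.2 (EuclideanSpace.single i (1 : ℝ))) ≠ 0 := by
    intro h
    apply hw2
    ext v
    conv_lhs => rw [← (EuclideanSpace.basisFun (Fin n) ℝ).sum_repr v]
    simp only [map_sum, map_smul, EuclideanSpace.basisFun_apply, zero_apply]
    exact Finset.sum_eq_zero fun i _ => by rw [congrFun h i]; simp
  have := hpd.dotProduct_mulVec_pos hv
  simp only [dotProduct, Matrix.mulVec, star_trivial, Finset.mul_sum] at this
  refine this.trans_eq (Finset.sum_congr rfl fun i _ => Finset.sum_congr rfl fun j _ => ?_)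
  ring

theorem energyCoord_contDiffAt (g : Metric n M)
    (hφ : φ ∈ IsManifold.maximalAtlas 𝓘(ℝ, Rn n) ∞ M) {w : Rn n × (Rn n →L[ℝ] ℝ)}
    (hw : w.1 ∈ φ.target) : ContDiffAt ℝ ∞ (energyCoord g φ) w := by
  have hG : ∀ i j, ContDiffAt ℝ ∞
      (fun w : Rn n × (Rn n →L[ℝ] ℝ) => metricMatrix g φ (φ.symm w.1) i j) w := by
    intro i j
    have h1 : ContMDiffAt 𝓘(ℝ, Rn n) 𝓘(ℝ, ℝ) ∞ (fun y => metricMatrix g φ (φ.symm y) i j) w.1 :=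
      (contMDiffAt_metricMatrix g hφ (φ.map_target hw) i j).comp w.1
        (contMDiffAt_symm_of_mem_maximalAtlas hφ hw)
    exact h1.contDiffAt.comp w contDiffAt_fst
  have hdet := (metricMatrix_posDef g hφ (φ.map_target hw)).det_pos.ne'
  unfold energyCoord
  refine ContDiffAt.sum fun i _ => ContDiffAt.sum fun j _ => ?_
  refine ((Matrix.contDiffAt_inv hG hdet i j).mul ?_).mul ?_
  · exact contDiffAt_snd.clm_apply contDiffAt_const
  · exact contDiffAt_snd.clm_apply contDiffAt_const

theorem symbolCoord_contDiffAt (g : Metric n M)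
    (hφ : φ ∈ IsManifold.maximalAtlas 𝓘(ℝ, Rn n) ∞ M) {w : Rn n × (Rn n →L[ℝ] ℝ)}
    (hw : w.1 ∈ φ.target) (hw2 : w.2 ≠ 0) : ContDiffAt ℝ ∞ (symbolCoord g φ) w :=
  (energyCoord_contDiffAt g hφ hw).sqrt (energyCoord_pos g hφ hw hw2).ne'

theorem symbolCoord_pos (g : Metric n M)
    (hφ : φ ∈ IsManifold.maximalAtlas 𝓘(ℝ, Rn n) ∞ M) {w : Rn n × (Rn n →L[ℝ] ℝ)}
    (hw : w.1 ∈ φ.target) (hw2 : w.2 ≠ 0) : 0 < symbolCoord g φ w :=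
  Real.sqrt_pos.2 (energyCoord_pos g hφ hw hw2)

theorem canCoord_snd_ne_zero (hφ : φ ∈ IsManifold.maximalAtlas 𝓘(ℝ, Rn n) ∞ M) {z : Cot n M}
    (hz : z.1 ∈ φ.source) : (canCoord φ z).2 ≠ 0 ↔ z.2 ≠ 0 := by
  refine not_congr ⟨fun h => ?_, fun h => by simp [canCoord, h]⟩
  have h1 : z.2.comp ((chartDeriv φ z.1).inverse.comp (chartDeriv φ z.1)) = 0 := by
    rw [← ContinuousLinearMap.comp_assoc]
    change (canCoord φ z).2.comp _ = 0
    rw [h]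
    exact ContinuousLinearMap.zero_comp _
  rwa [inverse_comp_chartDeriv hφ hz, ContinuousLinearMap.comp_id] at h1

theorem symbol_pos (g : Metric n M) {z : Cot n M} (hz : z.2 ≠ 0) : 0 < symbol g z := by
  have hφ : chartAt (Rn n) z.1 ∈ IsManifold.maximalAtlas 𝓘(ℝ, Rn n) ∞ M :=
    IsManifold.chart_mem_maximalAtlas z.1
  have h0 : z.1 ∈ (chartAt (Rn n) z.1).source := mem_chart_source _ _
  rw [symbol_eq_symbolCoord g hφ h0]
  exact symbolCoord_pos g hφ ((chartAt (Rn n) z.1).map_source h0)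
    ((canCoord_snd_ne_zero hφ h0).2 hz)

end
end ConormalFlow
end

/-! ### The Hamilton vector field and its invariance under changes of canonical coordinates. -/

noncomputable section
namespace ConormalFlow
section
variable {n : ℕ} {M : Type*} [TopologicalSpace M] [ChartedSpace (Rn n) M]
variable [IsManifold 𝓘(ℝ, Rn n) ∞ M]
variable {φ ψ : OpenPartialHomeomorph M (Rn n)}

instance phaseNormedAddCommGroup : NormedAddCommGroup (Rn n × (Rn n →L[ℝ] ℝ)) :=
  Prod.normedAddCommGroup

instance phaseNormedSpace : NormedSpace ℝ (Rn n × (Rn n →L[ℝ] ℝ)) := Prod.normedSpace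

instance phaseContinuousSMul : ContinuousSMul ℝ (Rn n × (Rn n →L[ℝ] ℝ)) := Prod.continuousSMul

instance phaseDualNormedAddCommGroup : NormedAddCommGroup ((Rn n × (Rn n →L[ℝ] ℝ)) →L[ℝ] ℝ) :=
  ContinuousLinearMap.toNormedAddCommGroup

instance phaseDualNormedSpace : NormedSpace ℝ ((Rn n × (Rn n →L[ℝ] ℝ)) →L[ℝ] ℝ) :=
  ContinuousLinearMap.toNormedSpace

instance phaseDualFiniteDimensional :
    FiniteDimensional ℝ ((Rn n × (Rn n →L[ℝ] ℝ)) →L[ℝ] ℝ) := inferInstance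

/-- The identification of covectors with vectors on `ℝⁿ × (ℝⁿ)*` by the symplectic form. -/
def symplecticDual (n : ℕ) : ((Rn n × (Rn n →L[ℝ] ℝ)) →L[ℝ] ℝ) →L[ℝ] Rn n × (Rn n →L[ℝ] ℝ) :=
  LinearMap.toContinuousLinearMap
    { toFun := fun D => (WithLp.toLp 2 fun j => D (0, (EuclideanSpace.proj j : Rn n →L[ℝ] ℝ)),
        -(D.comp (ContinuousLinearMap.inl ℝ (Rn n) (Rn n →L[ℝ] ℝ))))
      map_add' := fun D D' => by
        ext1
        · ext j; simp
        · ext v; simp; ring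
      map_smul' := fun c D => by
        ext1
        · ext j; simp
        · ext v; simp }

theorem covector_eq_sum_proj (β : Rn n →L[ℝ] ℝ) :
    β = ∑ j, β (EuclideanSpace.single j (1 : ℝ)) • (EuclideanSpace.proj j : Rn n →L[ℝ] ℝ) := by
  ext v
  conv_lhs => rw [← (EuclideanSpace.basisFun (Fin n) ℝ).sum_repr v]
  simp [map_sum, mul_comm]

theorem covector_apply_eq_sum (β : Rn n →L[ℝ] ℝ) (v : Rn n) :
    β v = ∑ j, β (EuclideanSpace.single j (1 : ℝ)) * v j := by
  conv_lhs => rw [covector_eq_sum_proj β]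
  simp

/-- This is ω(X, b) = D b, the defining property of the Hamilton vector. With the nondegeneracy in
`symplectic_ext` it lets Hamilton vectors be compared by pairing them with all b. -/
theorem symplecticDual_pairing (D : (Rn n × (Rn n →L[ℝ] ℝ)) →L[ℝ] ℝ)
    (b : Rn n × (Rn n →L[ℝ] ℝ)) :
    b.2 (symplecticDual n D).1 - (symplecticDual n D).2 b.1 = D b := by
  have h1 : b.2 (symplecticDual n D).1 = D (0, b.2) := by
    rw [covector_apply_eq_sum]
    conv_rhs => rw [covector_eq_sum_proj b.2]
    have : ((0 : Rn n), ∑ j, b.2 (EuclideanSpace.single j (1 : ℝ)) •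
        (EuclideanSpace.proj j : Rn n →L[ℝ] ℝ)) = ∑ j, b.2 (EuclideanSpace.single j (1 : ℝ)) •
          ((0 : Rn n), (EuclideanSpace.proj j : Rn n →L[ℝ] ℝ)) := by
      ext1
      · simp [Prod.fst_sum]
      · simp [Prod.snd_sum]
    rw [this, map_sum]
    refine Finset.sum_congr rfl fun j _ => ?_
    rw [map_smul]
    rfl
  have h2 : (symplecticDual n D).2 b.1 = -D (b.1, 0) := by simp [symplecticDual]
  rw [h1, h2, sub_neg_eq_add, ← map_add]
  simp

theorem symplectic_ext {a a' : Rn n × (Rn n →L[ℝ] ℝ)}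
    (h : ∀ b : Rn n × (Rn n →L[ℝ] ℝ), b.2 a.1 - a.2 b.1 = b.2 a'.1 - a'.2 b.1) : a = a' := by
  ext1
  · ext j
    simpa using h (0, EuclideanSpace.proj j)
  · ext v
    simpa using h (v, 0)

/-- The covector is transported by a linear map that depends on the base point; the product rule
produces the term with a second derivative of the chart transition. -/
theorem hasFDerivAt_canTransition (hφ : φ ∈ IsManifold.maximalAtlas 𝓘(ℝ, Rn n) ∞ M)
    (hψ : ψ ∈ IsManifold.maximalAtlas 𝓘(ℝ, Rn n) ∞ M) {w : Rn n × (Rn n →L[ℝ] ℝ)}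
    (hw : w.1 ∈ φ.target) (hw' : φ.symm w.1 ∈ ψ.source) (a : Rn n × (Rn n →L[ℝ] ℝ)) :
    fderiv ℝ (canTransition φ ψ) w a = (fderiv ℝ (ψ ∘ φ.symm) w.1 a.1,
      a.2.comp (fderiv ℝ (φ ∘ ψ.symm) (ψ (φ.symm w.1))) +
      w.2.comp (fderiv ℝ (fderiv ℝ (φ ∘ ψ.symm)) (ψ (φ.symm w.1))
        (fderiv ℝ (ψ ∘ φ.symm) w.1 a.1))) := by
  have h1 : HasFDerivAt (fun w : Rn n × (Rn n →L[ℝ] ℝ) => ψ (φ.symm w.1))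
      ((fderiv ℝ (ψ ∘ φ.symm) w.1).comp (ContinuousLinearMap.fst ℝ _ _)) w :=
    HasFDerivAt.comp w ((transition_contDiffAt hφ hψ hw hw').differentiableAt (by simp)).hasFDerivAt
      hasFDerivAt_fst
  have h2 : ContDiffAt ℝ ∞ (fderiv ℝ (φ ∘ ψ.symm)) (ψ (φ.symm w.1)) := by
    refine ContDiffAt.fderiv_right (m := ∞) (n := ∞) ?_ (by simp)
    refine transition_contDiffAt hψ hφ (ψ.map_source hw') ?_
    rw [ψ.left_inv hw']
    exact φ.map_target hw
  have h3 := HasFDerivAt.comp w (h2.differentiableAt (by simp)).hasFDerivAt h1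
  have h4 := h1.prodMk (HasFDerivAt.clm_comp
    (hasFDerivAt_snd (𝕜 := ℝ) (p := w)) h3)
  have h5 : fderiv ℝ (canTransition φ ψ) w = _ := h4.fderiv
  rw [h5]
  ext1
  · simp
  · ext v
    simp
    ring

theorem fderiv_transition_comp (hφ : φ ∈ IsManifold.maximalAtlas 𝓘(ℝ, Rn n) ∞ M)
    (hψ : ψ ∈ IsManifold.maximalAtlas 𝓘(ℝ, Rn n) ∞ M) {y : Rn n}
    (hy : y ∈ φ.target) (hy' : φ.symm y ∈ ψ.source) (v : Rn n) :
    fderiv ℝ (φ ∘ ψ.symm) (ψ (φ.symm y)) (fderiv ℝ (ψ ∘ φ.symm) y v) = v := by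
  have hx := φ.map_target hy
  have h1 := chartDeriv_comp_inverse_eq_fderiv hφ hψ hx hy'
  have h2 := chartDeriv_comp_inverse_eq_fderiv hψ hφ hy' hx
  rw [φ.right_inv hy] at h2
  rw [← h1, ← h2]
  have h3 := DFunLike.congr_fun (inverse_comp_chartDeriv hψ hy') ((chartDeriv φ (φ.symm y)).inverse v)
  have h4 := DFunLike.congr_fun (chartDeriv_comp_inverse hφ hx) v
  simp only [ContinuousLinearMap.comp_apply] at h3 h4 ⊢
  rw [h3]
  exact h4

/-- Transition maps between canonical coordinates are symplectic. -/
theorem canTransition_symplectic (hφ : φ ∈ IsManifold.maximalAtlas 𝓘(ℝ, Rn n) ∞ M)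
    (hψ : ψ ∈ IsManifold.maximalAtlas 𝓘(ℝ, Rn n) ∞ M) {w : Rn n × (Rn n →L[ℝ] ℝ)}
    (hw : w.1 ∈ φ.target) (hw' : φ.symm w.1 ∈ ψ.source)
    (D : (Rn n × (Rn n →L[ℝ] ℝ)) →L[ℝ] ℝ) :
    fderiv ℝ (canTransition φ ψ) w
      (symplecticDual n (D.comp (fderiv ℝ (canTransition φ ψ) w))) = symplecticDual n D := by
  have hw1 : ψ (φ.symm w.1) ∈ ψ.target := ψ.map_source hw'
  have hw2 : ψ.symm (ψ (φ.symm w.1)) ∈ φ.source := by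
    rw [ψ.left_inv hw']; exact φ.map_target hw
  have hsymm : IsSymmSndFDerivAt ℝ (φ ∘ ψ.symm) (ψ (φ.symm w.1)) :=
    (transition_contDiffAt hψ hφ hw1 hw2).isSymmSndFDerivAt (by simp; exact WithTop.coe_le_coe.2 le_top)
  have hinv := fderiv_transition_comp hφ hψ hw hw'
  have hinv' : ∀ v, fderiv ℝ (ψ ∘ φ.symm) w.1 (fderiv ℝ (φ ∘ ψ.symm) (ψ (φ.symm w.1)) v) = v := by
    intro v
    have := fderiv_transition_comp hψ hφ hw1 hw2 v
    rwa [ψ.left_inv hw', φ.right_inv hw] at this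
  set L := fderiv ℝ (ψ ∘ φ.symm) w.1
  set L' := fderiv ℝ (φ ∘ ψ.symm) (ψ (φ.symm w.1))
  set S := fderiv ℝ (fderiv ℝ (φ ∘ ψ.symm)) (ψ (φ.symm w.1))
  have hT := hasFDerivAt_canTransition hφ hψ hw hw'
  set T := fderiv ℝ (canTransition φ ψ) w
  refine symplectic_ext fun b => ?_
  -- The derivative T is onto: the base component is inverted by L', and the covector component by L
  -- after removing the second-derivative term.
  obtain ⟨c, rfl⟩ : ∃ c, T c = b := by
    refine ⟨(L' b.1, (b.2 - w.2.comp (S b.1)).comp L), ?_⟩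
    rw [hT]
    ext1
    · exact hinv' _
    · ext v
      simp [L, L', S, hinv']
  have hDT : D (T c) = (D.comp T) c := rfl
  rw [symplecticDual_pairing D (T c), hDT, ← symplecticDual_pairing (D.comp T) c]
  set a := symplecticDual n (D.comp T)
  rw [hT, hT]
  simp only [add_apply, ContinuousLinearMap.comp_apply]
  have h1 : L' (L a.1) = a.1 := hinv _
  have h2 : L' (L c.1) = c.1 := hinv _
  -- The second-derivative terms enter the symplectic form antisymmetrically, so the symmetry of
  -- second derivatives makes them cancel.
  have h3 : S (L c.1) (L a.1) = S (L a.1) (L c.1) := hsymm _ _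
  change c.2 (L' (L a.1)) + w.2 (S (L c.1) (L a.1)) -
    (a.2 (L' (L c.1)) + w.2 (S (L a.1) (L c.1))) = _
  rw [h1, h2, h3]
  ring

/-- The Hamilton vector field of the symbol in the canonical coordinates of the chart `φ`. -/
def hamCoord (g : Metric n M) (φ : OpenPartialHomeomorph M (Rn n))
    (w : Rn n × (Rn n →L[ℝ] ℝ)) : Rn n × (Rn n →L[ℝ] ℝ) :=
  symplecticDual n (fderiv ℝ (symbolCoord g φ) w)

theorem hamCoord_contDiffAt (g : Metric n M) (hφ : φ ∈ IsManifold.maximalAtlas 𝓘(ℝ, Rn n) ∞ M)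
    {w : Rn n × (Rn n →L[ℝ] ℝ)} (hw : w.1 ∈ φ.target) (hw2 : w.2 ≠ 0) :
    ContDiffAt ℝ ∞ (hamCoord g φ) w :=
  (symplecticDual n).contDiff.contDiffAt.comp w
    (ContDiffAt.fderiv_right (m := ∞) (n := ∞) (symbolCoord_contDiffAt g hφ hw hw2) (by simp))

/-- Tangent vectors at z are represented by convention in the preferred chart at z, so that chart
has the identity as its derivative there. -/
theorem hasMFDerivAt_canCoord_self (z : Cot n M) :
    HasMFDerivAt (cotModel n) 𝓘(ℝ, Rn n × (Rn n →L[ℝ] ℝ)) (canCoord (chartAt (Rn n) z.1)) z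
      (ContinuousLinearMap.id ℝ (Rn n × (Rn n →L[ℝ] ℝ))) := by
  have h0 : z.1 ∈ (chartAt (Rn n) z.1).source := mem_chart_source _ _
  have h1 : MDifferentiableAt (cotModel n) 𝓘(ℝ, Rn n × (Rn n →L[ℝ] ℝ))
      (extChartAt (cotModel n) z) z := mdifferentiableAt_extChartAt (mem_chart_source _ _)
  have h2 := h1.hasMFDerivAt
  rw [mfderiv_extChartAt_self] at h2
  refine h2.congr_of_eventuallyEq ?_
  filter_upwards [(FiberBundle.continuous_proj _ _).continuousAt.preimage_mem_nhds
    ((chartAt (Rn n) z.1).open_source.mem_nhds h0)] with w hw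
  exact (extChartAt_cot hw).symm

theorem hasMFDerivAt_canPoint_self (z : Cot n M) :
    HasMFDerivAt 𝓘(ℝ, Rn n × (Rn n →L[ℝ] ℝ)) (cotModel n) (canPoint (chartAt (Rn n) z.1))
      (canCoord (chartAt (Rn n) z.1) z)
      (ContinuousLinearMap.id ℝ (Rn n × (Rn n →L[ℝ] ℝ))) := by
  set φ := chartAt (Rn n) z.1
  have hφ : φ ∈ IsManifold.maximalAtlas 𝓘(ℝ, Rn n) ∞ M := IsManifold.chart_mem_maximalAtlas z.1
  have h0 : z.1 ∈ φ.source := mem_chart_source _ _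
  have hw : (canCoord φ z).1 ∈ φ.target := φ.map_source h0
  have h1 := ((contMDiffAt_canPoint hφ hw).mdifferentiableAt (by simp)).hasMFDerivAt
  have h2 : HasMFDerivAt (cotModel n) 𝓘(ℝ, Rn n × (Rn n →L[ℝ] ℝ)) (canCoord φ)
      (canPoint φ (canCoord φ z)) (ContinuousLinearMap.id ℝ (Rn n × (Rn n →L[ℝ] ℝ))) := by
    rw [canPoint_canCoord hφ h0]; exact hasMFDerivAt_canCoord_self z
  have h3 := h2.comp _ h1
  have h4 : HasMFDerivAt 𝓘(ℝ, Rn n × (Rn n →L[ℝ] ℝ)) 𝓘(ℝ, Rn n × (Rn n →L[ℝ] ℝ))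
      (canCoord φ ∘ canPoint φ) (canCoord φ z)
      (ContinuousLinearMap.id ℝ (Rn n × (Rn n →L[ℝ] ℝ))) := by
    refine (hasMFDerivAt_id _).congr_of_eventuallyEq ?_
    filter_upwards [(φ.open_target.preimage continuous_fst).mem_nhds hw] with v hv
    exact canCoord_canPoint hφ hv
  have h5 := hasMFDerivAt_unique h3 h4
  exact h1.congr_mfderiv ((ContinuousLinearMap.id_comp _).symm.trans h5)

theorem hamiltonField_eq_symplecticDual (g : Metric n M) (z : Cot n M) :
    hamiltonField g z = symplecticDual n (mfderiv (cotModel n) 𝓘(ℝ, ℝ) (symbol g) z) := rfl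

theorem hasMFDerivAt_symbol (g : Metric n M) {z : Cot n M} (hz : z.2 ≠ 0) :
    HasMFDerivAt (cotModel n) 𝓘(ℝ, ℝ) (symbol g) z
      (fderiv ℝ (symbolCoord g (chartAt (Rn n) z.1)) (canCoord (chartAt (Rn n) z.1) z)) := by
  set φ := chartAt (Rn n) z.1
  have hφ : φ ∈ IsManifold.maximalAtlas 𝓘(ℝ, Rn n) ∞ M := IsManifold.chart_mem_maximalAtlas z.1
  have h0 : z.1 ∈ φ.source := mem_chart_source _ _
  have hw : (canCoord φ z).1 ∈ φ.target := φ.map_source h0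
  have h2 := ((symbolCoord_contDiffAt g hφ hw
      ((canCoord_snd_ne_zero hφ h0).2 hz)).differentiableAt (by simp)).hasFDerivAt.hasMFDerivAt
  have h3 : HasMFDerivAt (cotModel n) 𝓘(ℝ, ℝ) (symbolCoord g φ ∘ canCoord φ) z
      ((fderiv ℝ (symbolCoord g φ) (canCoord φ z)).comp
        (ContinuousLinearMap.id ℝ (Rn n × (Rn n →L[ℝ] ℝ)))) :=
    h2.comp z (hasMFDerivAt_canCoord_self z)
  refine (h3.congr_of_eventuallyEq ?_).congr_mfderiv (ContinuousLinearMap.ext fun _ => rfl)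
  filter_upwards [(FiberBundle.continuous_proj _ _).continuousAt.preimage_mem_nhds
      (φ.open_source.mem_nhds h0)] with w hw
  exact symbol_eq_symbolCoord g hφ hw

theorem hamiltonField_eq (g : Metric n M) {z : Cot n M} (hz : z.2 ≠ 0) :
    hamiltonField g z =
      hamCoord g (chartAt (Rn n) z.1) (canCoord (chartAt (Rn n) z.1) z) :=
  (hamiltonField_eq_symplecticDual g z).trans
    (congrArg (symplecticDual n) (hasMFDerivAt_symbol g hz).mfderiv)

/-- The derivative of a curve in `T*M` in the canonical coordinates of the chart `φ`. -/
theorem hasMFDerivAt_hamiltonField_iff (g : Metric n M)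
    (hφ : φ ∈ IsManifold.maximalAtlas 𝓘(ℝ, Rn n) ∞ M) {γ : ℝ → Cot n M} {t : ℝ}
    (hγ : ContinuousAt γ t) (ht : (γ t).1 ∈ φ.source) (ht2 : (γ t).2 ≠ 0) :
    HasMFDerivAt 𝓘(ℝ, ℝ) (cotModel n) γ t
        ((1 : ℝ →L[ℝ] ℝ).smulRight (hamiltonField g (γ t))) ↔
      HasDerivAt (fun s => canCoord φ (γ s)) (hamCoord g φ (canCoord φ (γ t))) t := by
  set φ₀ := chartAt (Rn n) (γ t).1
  have hφ₀ : φ₀ ∈ IsManifold.maximalAtlas 𝓘(ℝ, Rn n) ∞ M := IsManifold.chart_mem_maximalAtlas _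
  have h0 : (γ t).1 ∈ φ₀.source := mem_chart_source _ _
  have hproj : ContinuousAt (fun s => (γ s).1) t :=
    (FiberBundle.continuous_proj _ _).continuousAt.comp hγ
  have hev₀ : ∀ᶠ s in 𝓝 t, (γ s).1 ∈ φ₀.source := hproj (φ₀.open_source.mem_nhds h0)
  have hev : ∀ᶠ s in 𝓝 t, (γ s).1 ∈ φ.source := hproj (φ.open_source.mem_nhds ht)
  -- first in the preferred chart
  have key₀ : HasMFDerivAt 𝓘(ℝ, ℝ) (cotModel n) γ t
        ((1 : ℝ →L[ℝ] ℝ).smulRight (hamiltonField g (γ t))) ↔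
      HasDerivAt (fun s => canCoord φ₀ (γ s)) (hamCoord g φ₀ (canCoord φ₀ (γ t))) t := by
    rw [hamiltonField_eq g ht2]
    constructor
    · intro h
      have h1 : HasFDerivAt (fun s => canCoord φ₀ (γ s))
          ((1 : ℝ →L[ℝ] ℝ).smulRight (hamCoord g φ₀ (canCoord φ₀ (γ t)))) t :=
        ((hasMFDerivAt_canCoord_self (γ t)).comp t h).hasFDerivAt
      exact h1.hasDerivAt.congr_deriv (by simp)
    · intro h
      have h1 := (hasMFDerivAt_canPoint_self (γ t)).comp t h.hasFDerivAt.hasMFDerivAt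
      refine (h1.congr_of_eventuallyEq ?_).congr_mfderiv ?_
      · filter_upwards [hev₀] with s hs
        exact (canPoint_canCoord hφ₀ hs).symm
      · refine ContinuousLinearMap.ext fun r => ?_
        rfl
  -- covariance under the transition map
  have cov : ∀ φ₁ φ₂ : OpenPartialHomeomorph M (Rn n),
      φ₁ ∈ IsManifold.maximalAtlas 𝓘(ℝ, Rn n) ∞ M → φ₂ ∈ IsManifold.maximalAtlas 𝓘(ℝ, Rn n) ∞ M →
      (γ t).1 ∈ φ₁.source → (γ t).1 ∈ φ₂.source → (∀ᶠ s in 𝓝 t, (γ s).1 ∈ φ₁.source) →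
      (∀ᶠ s in 𝓝 t, (γ s).1 ∈ φ₂.source) →
      HasDerivAt (fun s => canCoord φ₁ (γ s)) (hamCoord g φ₁ (canCoord φ₁ (γ t))) t →
      HasDerivAt (fun s => canCoord φ₂ (γ s)) (hamCoord g φ₂ (canCoord φ₂ (γ t))) t := by
    intro φ₁ φ₂ hφ₁ hφ₂ h1 h2 he1 he2 hd
    have hw : (canCoord φ₁ (γ t)).1 ∈ φ₁.target := φ₁.map_source h1
    have hw' : φ₁.symm (canCoord φ₁ (γ t)).1 ∈ φ₂.source := by simpa [canCoord, φ₁.left_inv h1]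
    have hT := ((canTransition_contDiffAt hφ₁ hφ₂ hw hw').differentiableAt (by simp)).hasFDerivAt
    have hd2 := hT.comp_hasDerivAt t hd
    have heq := canTransition_canCoord hφ₁ hφ₂ h1 h2
    have hw2 : (canCoord φ₂ (γ t)).1 ∈ φ₂.target := φ₂.map_source h2
    -- Both coordinate expressions represent the same function p, so their differentials correspond
    -- under the transition map; its symplecticity makes the Hamilton vectors correspond too.
    have hD : fderiv ℝ (symbolCoord g φ₁) (canCoord φ₁ (γ t)) =
        (fderiv ℝ (symbolCoord g φ₂) (canCoord φ₂ (γ t))).comp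
          (fderiv ℝ (canTransition φ₁ φ₂) (canCoord φ₁ (γ t))) := by
      have hs := ((symbolCoord_contDiffAt g hφ₂ hw2
        ((canCoord_snd_ne_zero hφ₂ h2).2 ht2)).differentiableAt (by simp)).hasFDerivAt
      rw [← heq] at hs
      have hs2 := hs.comp _ hT
      rw [heq] at hs2
      refine (hs2.congr_of_eventuallyEq ?_).fderiv
      have hopen := (φ₁.isOpen_inter_preimage_symm φ₂.open_source).preimage
        (continuous_fst (X := Rn n) (Y := Rn n →L[ℝ] ℝ))
      filter_upwards [hopen.mem_nhds ⟨hw, hw'⟩] with v hv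
      have ha : (canPoint φ₁ v).1 ∈ φ₁.source := φ₁.map_target hv.1
      have e1 := symbol_eq_symbolCoord g hφ₁ ha
      have e2 := symbol_eq_symbolCoord g hφ₂ (z := canPoint φ₁ v) hv.2
      rw [canCoord_canPoint hφ₁ hv.1] at e1
      rw [canCoord_canPoint_eq hφ₁ hφ₂ hv.1 hv.2] at e2
      rw [Function.comp_apply, ← e1, ← e2]
    have hd3 : HasDerivAt (canTransition φ₁ φ₂ ∘ fun s => canCoord φ₁ (γ s))
        (hamCoord g φ₂ (canCoord φ₂ (γ t))) t := by
      refine hd2.congr_deriv ?_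
      rw [hamCoord, hD, canTransition_symplectic hφ₁ hφ₂ hw hw']
      rfl
    refine hd3.congr_of_eventuallyEq ?_
    filter_upwards [he1, he2] with s hs1 hs2
    exact (canTransition_canCoord hφ₁ hφ₂ hs1 hs2).symm
  rw [key₀]
  exact ⟨cov φ₀ φ hφ₀ hφ h0 ht hev₀ hev, cov φ φ₀ hφ hφ₀ ht h0 hev hev₀⟩

end
end ConormalFlow
end

/-! ### Integral curves of the Hamilton field: conservation of p and uniqueness. -/

noncomputable section
namespace ConormalFlow
section
variable {n : ℕ} {M : Type*} [TopologicalSpace M] [ChartedSpace (Rn n) M]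
variable [IsManifold 𝓘(ℝ, Rn n) ∞ M]
variable {φ ψ : OpenPartialHomeomorph M (Rn n)}

/-- The projection `T*M → M` is continuous. -/
theorem continuous_proj_cot : Continuous (fun z : Cot n M => z.1) :=
  FiberBundle.continuous_proj _ _

theorem isOpen_over (φ : OpenPartialHomeomorph M (Rn n)) :
    IsOpen {z : Cot n M | z.1 ∈ φ.source} := φ.open_source.preimage continuous_proj_cot

theorem continuousAt_canCoord (hφ : φ ∈ IsManifold.maximalAtlas 𝓘(ℝ, Rn n) ∞ M) {z : Cot n M}
    (hz : z.1 ∈ φ.source) : ContinuousAt (canCoord φ) z := (contMDiffAt_canCoord hφ hz).continuousAt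

/-- Distinct base points are separated in M, and distinct covectors in one fibre by canonical
coordinates. The Hausdorff property is what makes integral curves globally unique. -/
instance t2Space_cot [T2Space M] : T2Space (Cot n M) := by
  rw [t2Space_iff_nhds]
  intro z z' hne
  by_cases h : z.1 = z'.1
  · set φ := chartAt (Rn n) z.1
    have hφ : φ ∈ IsManifold.maximalAtlas 𝓘(ℝ, Rn n) ∞ M := IsManifold.chart_mem_maximalAtlas z.1
    have h0 : z.1 ∈ φ.source := mem_chart_source _ _
    have h0' : z'.1 ∈ φ.source := h ▸ h0
    have hne' : canCoord φ z ≠ canCoord φ z' := fun he => hne (by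
      rw [← canPoint_canCoord hφ h0, ← canPoint_canCoord hφ h0', he])
    obtain ⟨u, hu, v, hv, huv⟩ := t2Space_iff_nhds.1 inferInstance hne'
    refine ⟨canCoord φ ⁻¹' u, continuousAt_canCoord hφ h0 hu, canCoord φ ⁻¹' v,
      continuousAt_canCoord hφ h0' hv, huv.preimage _⟩
  · obtain ⟨u, hu, v, hv, huv⟩ := t2Space_iff_nhds.1 (inferInstanceAs (T2Space M)) h
    exact ⟨_, continuous_proj_cot.continuousAt hu, _, continuous_proj_cot.continuousAt hv,
      huv.preimage _⟩

theorem isOpen_nonzero : IsOpen {z : Cot n M | z.2 ≠ 0} := by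
  rw [isOpen_iff_mem_nhds]
  intro z hz
  set φ := chartAt (Rn n) z.1
  have hφ : φ ∈ IsManifold.maximalAtlas 𝓘(ℝ, Rn n) ∞ M := IsManifold.chart_mem_maximalAtlas z.1
  have h0 : z.1 ∈ φ.source := mem_chart_source _ _
  have h1 : ContinuousAt (fun w => (canCoord φ w).2) z := (continuousAt_canCoord hφ h0).snd
  filter_upwards [(isOpen_over φ).mem_nhds h0,
    h1.eventually_ne ((canCoord_snd_ne_zero hφ h0).2 hz)] with w hw hw'
  exact (canCoord_snd_ne_zero hφ hw).1 hw'

/-- `γ` is an integral curve of the Hamilton vector field at time `t`. -/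
def IsFlowAt (g : Metric n M) (γ : ℝ → Cot n M) (t : ℝ) : Prop :=
  (γ t).2 ≠ 0 ∧ HasMFDerivAt 𝓘(ℝ, ℝ) (cotModel n) γ t
    ((1 : ℝ →L[ℝ] ℝ).smulRight (hamiltonField g (γ t)))

variable {g : Metric n M}

theorem isBicharacteristic_iff {γ : ℝ → Cot n M} :
    IsBicharacteristic g γ ↔ ∀ t, IsFlowAt g γ t :=
  ⟨fun h t => ⟨h.1 t, h.2 t⟩, fun h => ⟨fun t => (h t).1, fun t => (h t).2⟩⟩

theorem IsFlowAt.continuousAt {γ : ℝ → Cot n M} {t : ℝ} (h : IsFlowAt g γ t) :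
    ContinuousAt γ t := h.2.continuousAt

theorem IsFlowAt.hasDerivAt {γ : ℝ → Cot n M} {t : ℝ} (h : IsFlowAt g γ t)
    (hφ : φ ∈ IsManifold.maximalAtlas 𝓘(ℝ, Rn n) ∞ M) (ht : (γ t).1 ∈ φ.source) :
    HasDerivAt (fun s => canCoord φ (γ s)) (hamCoord g φ (canCoord φ (γ t))) t :=
  (hasMFDerivAt_hamiltonField_iff g hφ h.continuousAt ht h.1).1 h.2

theorem isFlowAt_of_hasDerivAt {γ : ℝ → Cot n M} {t : ℝ} (hγ : ContinuousAt γ t)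
    (h0 : (γ t).2 ≠ 0) (hφ : φ ∈ IsManifold.maximalAtlas 𝓘(ℝ, Rn n) ∞ M)
    (ht : (γ t).1 ∈ φ.source)
    (h : HasDerivAt (fun s => canCoord φ (γ s)) (hamCoord g φ (canCoord φ (γ t))) t) :
    IsFlowAt g γ t := ⟨h0, (hasMFDerivAt_hamiltonField_iff g hφ hγ ht h0).2 h⟩

theorem IsFlowAt.congr {γ γ' : ℝ → Cot n M} {t : ℝ} (h : IsFlowAt g γ t) (he : γ' =ᶠ[𝓝 t] γ) :
    IsFlowAt g γ' t := by
  have h2 : γ' t = γ t := he.eq_of_nhds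
  refine ⟨by rw [h2]; exact h.1, ?_⟩
  have := h.2.congr_of_eventuallyEq he
  rw [h2]
  exact this

theorem IsFlowAt.comp_add {γ : ℝ → Cot n M} {t a : ℝ} (h : IsFlowAt g γ (t + a)) :
    IsFlowAt g (fun s => γ (s + a)) t := by
  have hφ : chartAt (Rn n) (γ (t + a)).1 ∈ IsManifold.maximalAtlas 𝓘(ℝ, Rn n) ∞ M :=
    IsManifold.chart_mem_maximalAtlas _
  have h0 := mem_chart_source (Rn n) (γ (t + a)).1
  refine isFlowAt_of_hasDerivAt (φ := chartAt (Rn n) (γ (t + a)).1) ?_ h.1 hφ h0 ?_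
  · exact ContinuousAt.comp (f := fun s : ℝ => s + a) h.continuousAt (by fun_prop)
  · exact HasDerivAt.comp_add_const t a (h.hasDerivAt hφ h0)

/-- The symbol is constant along integral curves of its Hamilton vector field. -/
theorem IsFlowAt.hasDerivAt_symbol {γ : ℝ → Cot n M} {t : ℝ} (h : IsFlowAt g γ t) :
    HasDerivAt (fun s => symbol g (γ s)) 0 t := by
  set φ := chartAt (Rn n) (γ t).1
  have hφ : φ ∈ IsManifold.maximalAtlas 𝓘(ℝ, Rn n) ∞ M := IsManifold.chart_mem_maximalAtlas _
  have h0 : (γ t).1 ∈ φ.source := mem_chart_source (Rn n) (γ t).1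
  have hs := ((symbolCoord_contDiffAt g hφ (w := canCoord φ (γ t)) (φ.map_source h0)
    ((canCoord_snd_ne_zero hφ h0).2 h.1)).differentiableAt (by simp)).hasFDerivAt
  have h1 := hs.comp_hasDerivAt t (h.hasDerivAt hφ h0)
  have h2 : fderiv ℝ (symbolCoord g φ) (canCoord φ (γ t)) (hamCoord g φ (canCoord φ (γ t))) = 0 := by
    rw [hamCoord, ← symplecticDual_pairing]
    ring
  rw [h2] at h1
  refine h1.congr_of_eventuallyEq ?_
  filter_upwards [h.continuousAt ((isOpen_over φ).mem_nhds h0)] with s hs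
  exact symbol_eq_symbolCoord g hφ hs

theorem symbol_eq_of_isFlowAt {γ : ℝ → Cot n M} {a b : ℝ} (h : ∀ t ∈ Ioo a b, IsFlowAt g γ t)
    {s t : ℝ} (hs : s ∈ Ioo a b) (ht : t ∈ Ioo a b) : symbol g (γ s) = symbol g (γ t) :=
  isOpen_Ioo.is_const_of_deriv_eq_zero isPreconnected_Ioo
    (fun r hr => (h r hr).hasDerivAt_symbol.differentiableAt.differentiableWithinAt)
    (fun r hr => (h r hr).hasDerivAt_symbol.deriv) hs ht

/-- Local uniqueness of integral curves. -/
theorem IsFlowAt.eventuallyEq {γ γ' : ℝ → Cot n M} {t : ℝ} (h : ∀ᶠ s in 𝓝 t, IsFlowAt g γ s)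
    (h' : ∀ᶠ s in 𝓝 t, IsFlowAt g γ' s) (heq : γ t = γ' t) : γ =ᶠ[𝓝 t] γ' := by
  set φ := chartAt (Rn n) (γ t).1
  have hφ : φ ∈ IsManifold.maximalAtlas 𝓘(ℝ, Rn n) ∞ M := IsManifold.chart_mem_maximalAtlas _
  have h0 : (γ t).1 ∈ φ.source := mem_chart_source (Rn n) (γ t).1
  have hC := (hamCoord_contDiffAt g hφ (w := canCoord φ (γ t)) (φ.map_source h0)
    ((canCoord_snd_ne_zero hφ h0).2 h.self_of_nhds.1)).of_le (m := 1) (by simp)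
  obtain ⟨K, s, hs, hK⟩ := hC.exists_lipschitzOnWith
  have aux : ∀ β : ℝ → Cot n M, (∀ᶠ s in 𝓝 t, IsFlowAt g β s) → β t = γ t →
      (∀ᶠ r in 𝓝 t, (β r).1 ∈ φ.source) ∧ ∀ᶠ r in 𝓝 t,
      HasDerivAt (fun r => canCoord φ (β r)) (hamCoord g φ (canCoord φ (β r))) r ∧
        canCoord φ (β r) ∈ s := by
    intro β hβ hβt
    have hc := hβ.self_of_nhds.continuousAt
    have h1 : ∀ᶠ r in 𝓝 t, (β r).1 ∈ φ.source :=
      hc ((isOpen_over φ).mem_nhds (by rw [hβt]; exact h0))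
    refine ⟨h1, ?_⟩
    have h2 : ContinuousAt (fun r => canCoord φ (β r)) t :=
      ContinuousAt.comp (g := canCoord φ) (f := β)
        (continuousAt_canCoord hφ (by rw [hβt]; exact h0)) hc
    filter_upwards [h1, hβ, h2.preimage_mem_nhds (t := s) (by rw [hβt]; exact hs)] with r hr1 hr2 hr3
    exact ⟨hr2.hasDerivAt hφ hr1, hr3⟩
  obtain ⟨a1, a2⟩ := aux γ h rfl
  obtain ⟨b1, b2⟩ := aux γ' h' heq.symm
  have key := ODE_solution_unique_of_eventually (v := fun _ => hamCoord g φ) (s := fun _ => s)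
    (K := K) (Eventually.of_forall fun _ => hK) a2 b2 (by rw [heq])
  filter_upwards [key, a1, b1] with r hr ha hb
  rw [← canPoint_canCoord hφ ha, ← canPoint_canCoord hφ hb, hr]

/-- The set of times near which the curves coincide is open, and it is relatively closed: in a
Hausdorff space the curves also agree at a limit time, and local uniqueness applies there. -/
theorem IsFlowAt.eqOn [T2Space M] {γ γ' : ℝ → Cot n M} {I : Set ℝ} (hI : IsOpen I)
    (hI' : IsPreconnected I) (h : ∀ s ∈ I, IsFlowAt g γ s) (h' : ∀ s ∈ I, IsFlowAt g γ' s)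
    {t : ℝ} (ht : t ∈ I) (heq : γ t = γ' t) : EqOn γ γ' I := by
  have hsub : I ⊆ {s | γ =ᶠ[𝓝 s] γ'} := by
    refine hI'.subset_of_closure_inter_subset ?_ ⟨t, ht, ?_⟩ ?_
    · exact isOpen_setOfPred_eventually_nhds
    · exact IsFlowAt.eventuallyEq (eventually_of_mem (hI.mem_nhds ht) h)
        (eventually_of_mem (hI.mem_nhds ht) h') heq
    · rintro s ⟨hs, hsI⟩
      refine IsFlowAt.eventuallyEq (eventually_of_mem (hI.mem_nhds hsI) h)
        (eventually_of_mem (hI.mem_nhds hsI) h') ?_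
      by_contra hne
      have hcl : ∀ᶠ r in 𝓝 s, γ r ≠ γ' r :=
        
        ((h s hsI).continuousAt.prodMk (h' s hsI).continuousAt).preimage_mem_nhds
          (isClosed_diagonal.isOpen_compl.mem_nhds hne)
      obtain ⟨r, hr, hr'⟩ := mem_closure_iff_frequently.1 hs |>.and_eventually hcl |>.exists
      exact hr' hr.eq_of_nhds
  exact fun s hs => (hsub hs).eq_of_nhds

end
end ConormalFlow
end

/-! ### Compact level sets of p and global existence of integral curves. -/

noncomputable section
namespace ConormalFlow
section
variable {n : ℕ} {M : Type*} [TopologicalSpace M] [ChartedSpace (Rn n) M]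
variable [IsManifold 𝓘(ℝ, Rn n) ∞ M]
variable {φ ψ : OpenPartialHomeomorph M (Rn n)} {g : Metric n M}

/-- The Hamilton vector field has a local `C¹` flow off the zero section. -/
theorem exists_local_flow (g : Metric n M) {z₀ : Cot n M} (hz₀ : z₀.2 ≠ 0) :
    ∃ ε > (0 : ℝ), ∃ U : Set (Cot n M), IsOpen U ∧ z₀ ∈ U ∧ ∃ Ψ : ℝ → Cot n M → Cot n M,
      (∀ z ∈ U, Ψ 0 z = z ∧ ∀ t ∈ Ioo (-ε) ε, IsFlowAt g (fun s => Ψ s z) t) ∧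
      ∀ t ∈ Ioo (-ε) ε, ∀ z ∈ U,
        ContMDiffAt (𝓘(ℝ, ℝ).prod (cotModel n)) (cotModel n) 1 (Function.uncurry Ψ) (t, z) := by
  set φ := chartAt (Rn n) z₀.1
  have hφ : φ ∈ IsManifold.maximalAtlas 𝓘(ℝ, Rn n) ∞ M := IsManifold.chart_mem_maximalAtlas _
  have h0 : z₀.1 ∈ φ.source := mem_chart_source _ _
  have hw : (canCoord φ z₀).1 ∈ φ.target := φ.map_source h0
  have hw2 : (canCoord φ z₀).2 ≠ 0 := (canCoord_snd_ne_zero hφ h0).2 hz₀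
  set S : Set (Rn n × (Rn n →L[ℝ] ℝ)) := {w | w.1 ∈ φ.target ∧ w.2 ≠ 0}
  have hSo : IsOpen S := (φ.open_target.preimage continuous_fst).inter
    (isOpen_compl_singleton.preimage continuous_snd)
  obtain ⟨ε, hε, r, hr, Ψ, hΨ, hΨc⟩ := ((hamCoord_contDiffAt g hφ hw hw2).of_le
    (m := 2) (by exact WithTop.coe_le_coe.2 le_top)).exists_contDiffOn_local_flow
    (hSo.mem_nhds ⟨hw, hw2⟩)
  have hcc : ContinuousOn (canCoord φ) {z : Cot n M | z.1 ∈ φ.source} := fun z hz =>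
    (continuousAt_canCoord hφ hz).continuousWithinAt
  refine ⟨ε, hε, {z : Cot n M | z.1 ∈ φ.source} ∩ canCoord φ ⁻¹' Metric.ball (canCoord φ z₀) r,
    hcc.isOpen_inter_preimage (isOpen_over φ) Metric.isOpen_ball,
    ⟨h0, Metric.mem_ball_self hr⟩, fun t z => canPoint φ (Ψ t (canCoord φ z)), ?_, ?_⟩
  · rintro z ⟨hz, hzr⟩
    refine ⟨?_, fun t ht => ?_⟩
    · simp only
      rw [(hΨ _ hzr).1, canPoint_canCoord hφ hz]
    · obtain ⟨hd, hS⟩ := (hΨ _ hzr).2 t ht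
      have hcc := canCoord_canPoint hφ hS.1
      have hs : (canPoint φ (Ψ t (canCoord φ z))).1 ∈ φ.source := φ.map_target hS.1
      refine isFlowAt_of_hasDerivAt ?_ ?_ hφ hs ?_
      · exact ContinuousAt.comp (g := canPoint φ) (f := fun s => Ψ s (canCoord φ z))
          (contMDiffAt_canPoint hφ hS.1).continuousAt hd.continuousAt
      · rw [← canCoord_snd_ne_zero hφ hs, hcc]
        exact hS.2
      · rw [hcc]
        refine hd.congr_of_eventuallyEq ?_
        filter_upwards [hd.continuousAt (hSo.mem_nhds hS)] with s hs
        exact canCoord_canPoint hφ hs.1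
  · rintro t ht z ⟨hz, hzr⟩
    obtain ⟨hd, hS⟩ := (hΨ _ hzr).2 t ht
    have h1 : ContDiffAt ℝ 1 (Function.uncurry Ψ) (t, canCoord φ z) :=
      hΨc.contDiffAt ((isOpen_Ioo.prod Metric.isOpen_ball).mem_nhds ⟨ht, hzr⟩)
    have h2 : ContMDiffAt (𝓘(ℝ, ℝ).prod (cotModel n)) (𝓘(ℝ, ℝ × (Rn n × (Rn n →L[ℝ] ℝ)))) 1
        (fun q : ℝ × Cot n M => (q.1, canCoord φ q.2)) (t, z) := by
      rw [modelWithCornersSelf_prod, ← chartedSpaceSelf_prod]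
      exact contMDiffAt_fst.prodMk
        (((contMDiffAt_canCoord hφ hz).of_le (by simp)).comp (t, z) contMDiffAt_snd)
    have h3 : ContMDiffAt (𝓘(ℝ, ℝ).prod (cotModel n)) 𝓘(ℝ, Rn n × (Rn n →L[ℝ] ℝ)) 1
        (fun q : ℝ × Cot n M => Ψ q.1 (canCoord φ q.2)) (t, z) :=
      ContMDiffAt.comp (t, z) (g := Function.uncurry Ψ)
        (f := fun q : ℝ × Cot n M => (q.1, canCoord φ q.2)) h1.contMDiffAt h2
    exact ContMDiffAt.comp (t, z) (g := canPoint φ)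
      (f := fun q : ℝ × Cot n M => Ψ q.1 (canCoord φ q.2))
      ((contMDiffAt_canPoint hφ hS.1).of_le (by simp)) h3

/-! ### Compactness of the cosphere bundle -/

theorem continuous_symbol (g : Metric n M) : Continuous (symbol g) := by
  rw [continuous_iff_continuousAt]
  intro z
  set φ := chartAt (Rn n) z.1
  have hφ : φ ∈ IsManifold.maximalAtlas 𝓘(ℝ, Rn n) ∞ M := IsManifold.chart_mem_maximalAtlas _
  have h0 : z.1 ∈ φ.source := mem_chart_source _ _
  have h1 : ContinuousAt (fun w => √(energyCoord g φ (canCoord φ w))) z :=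
    (ContinuousAt.comp (g := energyCoord g φ) (f := canCoord φ)
      (energyCoord_contDiffAt g hφ (w := canCoord φ z) (φ.map_source h0)).continuousAt
      (continuousAt_canCoord hφ h0)).sqrt
  refine h1.congr ?_
  filter_upwards [(isOpen_over φ).mem_nhds h0] with w hw
  exact (symbol_eq_symbolCoord g hφ hw).symm

theorem energyCoord_smul (g : Metric n M) (y : Rn n) (η : Rn n →L[ℝ] ℝ) (r : ℝ) :
    energyCoord g φ (y, r • η) = r ^ 2 * energyCoord g φ (y, η) := by
  simp only [energyCoord, smul_apply, smul_eq_mul, Finset.mul_sum]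
  refine Finset.sum_congr rfl fun i _ => Finset.sum_congr rfl fun j _ => by ring

/-- On covectors of Euclidean norm one over K the symbol has a positive minimum m; by homogeneity p
≤ c forces the norm of the covector to be at most c / m. -/
theorem isCompact_sublevel_over (g : Metric n M)
    (hφ : φ ∈ IsManifold.maximalAtlas 𝓘(ℝ, Rn n) ∞ M) {K : Set (Rn n)} (hK : IsCompact K)
    (hKt : K ⊆ φ.target) (c : ℝ) : ∃ Q : Set (Rn n × (Rn n →L[ℝ] ℝ)), IsCompact Q ∧
      Q ⊆ {w | w.1 ∈ φ.target} ∧ ∀ w : Rn n × (Rn n →L[ℝ] ℝ), w.1 ∈ K → symbolCoord g φ w ≤ c →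
        w ∈ Q := by
  have hsph : IsCompact (K ×ˢ Metric.sphere (0 : Rn n →L[ℝ] ℝ) 1) :=
    hK.prod (isCompact_sphere _ _)
  have hcont : ContinuousOn (symbolCoord g φ) (K ×ˢ Metric.sphere (0 : Rn n →L[ℝ] ℝ) 1) :=
    fun w hw => ((energyCoord_contDiffAt g hφ (hKt hw.1)).continuousAt.sqrt).continuousWithinAt
  obtain ⟨m, hm, hmin⟩ : ∃ m > 0, ∀ w ∈ K ×ˢ Metric.sphere (0 : Rn n →L[ℝ] ℝ) 1,
      m ≤ symbolCoord g φ w := by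
    rcases (K ×ˢ Metric.sphere (0 : Rn n →L[ℝ] ℝ) 1).eq_empty_or_nonempty with h | h
    · exact ⟨1, one_pos, fun w hw => by rw [h] at hw; exact hw.elim⟩
    · obtain ⟨w, hw, hmin⟩ := hsph.exists_isMinOn h hcont
      refine ⟨_, symbolCoord_pos g hφ (hKt hw.1) ?_, fun v hv => hmin hv⟩
      have : ‖w.2‖ = 1 := by simpa using hw.2
      intro h0
      simp [h0] at this
  refine ⟨K ×ˢ Metric.closedBall 0 (c / m), hK.prod (isCompact_closedBall _ _),
    fun w hw => hKt hw.1, fun w hw hwc => ⟨hw, ?_⟩⟩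
  rw [mem_closedBall_zero_iff, le_div_iff₀ hm]
  by_cases h0 : w.2 = 0
  · rw [h0, norm_zero, zero_mul]
    exact (Real.sqrt_nonneg _).trans hwc
  · have hpos : 0 < ‖w.2‖ := norm_pos_iff.2 h0
    have h1 := hmin (w.1, ‖w.2‖⁻¹ • w.2) ⟨hw, by simp [norm_smul, hpos.ne']⟩
    have h2 : symbolCoord g φ (w.1, ‖w.2‖⁻¹ • w.2) = ‖w.2‖⁻¹ * symbolCoord g φ w := by
      rw [symbolCoord, energyCoord_smul, Real.sqrt_mul (sq_nonneg _), Real.sqrt_sq (by positivity)]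
      rfl
    rw [h2] at h1
    calc ‖w.2‖ * m ≤ ‖w.2‖ * (‖w.2‖⁻¹ * symbolCoord g φ w) := by gcongr
      _ = symbolCoord g φ w := by field_simp
      _ ≤ c := hwc

theorem isCompact_symbol_le [CompactSpace M] (g : Metric n M) (c : ℝ) :
    IsCompact {z : Cot n M | symbol g z ≤ c} := by
  have hloc : ∀ x : M, ∃ U ∈ 𝓝 x, ∃ Q : Set (Cot n M), IsCompact Q ∧
      ∀ z : Cot n M, z.1 ∈ U → symbol g z ≤ c → z ∈ Q := by
    intro x
    set φ := chartAt (Rn n) x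
    have hφ : φ ∈ IsManifold.maximalAtlas 𝓘(ℝ, Rn n) ∞ M := IsManifold.chart_mem_maximalAtlas _
    have h0 : x ∈ φ.source := mem_chart_source _ _
    obtain ⟨K, hKn, hKt, hK⟩ := local_compact_nhds (φ.open_target.mem_nhds (φ.map_source h0))
    obtain ⟨Q, hQ, hQt, hQs⟩ := isCompact_sublevel_over g hφ hK hKt c
    refine ⟨φ.source ∩ φ ⁻¹' K, inter_mem (φ.open_source.mem_nhds h0)
      ((φ.continuousAt h0).preimage_mem_nhds hKn), canPoint φ '' Q, ?_, ?_⟩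
    · exact hQ.image_of_continuousOn fun w hw =>
        (contMDiffAt_canPoint hφ (hQt hw)).continuousAt.continuousWithinAt
    · intro z hz hzc
      refine ⟨canCoord φ z, hQs _ hz.2 ?_, canPoint_canCoord hφ hz.1⟩
      rwa [← symbol_eq_symbolCoord g hφ hz.1]
  choose U hU Q hQ hQs using hloc
  obtain ⟨t, -, ht⟩ := isCompact_univ.elim_nhds_subcover U fun x _ => hU x
  refine (t.isCompact_biUnion fun x _ => hQ x).of_isClosed_subset
    (isClosed_le (continuous_symbol g) continuous_const) fun z hz => ?_
  obtain ⟨x, hx, hzx⟩ := mem_iUnion₂.1 (ht (mem_univ z.1))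
  exact mem_iUnion₂.2 ⟨x, hx, hQs x z hzx hz⟩

theorem symbol_zero (g : Metric n M) {z : Cot n M} (hz : z.2 = 0) : symbol g z = 0 := by
  simp [symbol, hz]

theorem ne_zero_of_symbol_pos {z : Cot n M} (hz : 0 < symbol g z) : z.2 ≠ 0 := fun h => by
  rw [symbol_zero g h] at hz
  exact lt_irrefl _ hz

theorem isCompact_symbol_eq [CompactSpace M] (g : Metric n M) (c : ℝ) :
    IsCompact {z : Cot n M | symbol g z = c} :=
  (isCompact_symbol_le g c).of_isClosed_subset
    (isClosed_eq (continuous_symbol g) continuous_const) fun _ hz => le_of_eq hz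

/-- Integral curves exist for a uniform time on a level set of the symbol. -/
theorem exists_uniform_time [CompactSpace M] (g : Metric n M) {c : ℝ} (hc : 0 < c) :
    ∃ ε > (0 : ℝ), ∀ z : Cot n M, symbol g z = c → ∃ U : Set (Cot n M), IsOpen U ∧ z ∈ U ∧
      ∃ Ψ : ℝ → Cot n M → Cot n M,
      (∀ z ∈ U, Ψ 0 z = z ∧ ∀ t ∈ Ioo (-ε) ε, IsFlowAt g (fun s => Ψ s z) t) ∧
      ∀ t ∈ Ioo (-ε) ε, ∀ z ∈ U,
        ContMDiffAt (𝓘(ℝ, ℝ).prod (cotModel n)) (cotModel n) 1 (Function.uncurry Ψ) (t, z) := by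
  have hloc := fun (z : Cot n M) (hz : symbol g z = c) =>
    exists_local_flow g (z₀ := z) (ne_zero_of_symbol_pos (hz ▸ hc))
  choose! ε hε U hU hzU Ψ hΨ hΨc using hloc
  obtain ⟨t, ht, htc⟩ := (isCompact_symbol_eq g c).elim_nhds_subcover U
    fun z hz => (hU z hz).mem_nhds (hzU z hz)
  obtain ⟨δ, hδ, hδt⟩ : ∃ δ > 0, ∀ z ∈ t, δ ≤ ε z := by
    rcases t.eq_empty_or_nonempty with h | h
    · exact ⟨1, one_pos, by simp [h]⟩
    · obtain ⟨z, hz, hmin⟩ := t.exists_min_image ε h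
      exact ⟨ε z, hε z (ht z hz), hmin⟩
  refine ⟨δ, hδ, fun z hz => ?_⟩
  obtain ⟨z', hz', hzz'⟩ := mem_iUnion₂.1 (htc hz)
  have hsub : Ioo (-δ) δ ⊆ Ioo (-ε z') (ε z') :=
    Ioo_subset_Ioo (neg_le_neg (hδt z' hz')) (hδt z' hz')
  refine ⟨U z', hU z' (ht z' hz'), hzz', Ψ z', fun w hw => ⟨(hΨ z' (ht z' hz') w hw).1,
    fun s hs => (hΨ z' (ht z' hz') w hw).2 s (hsub hs)⟩, fun s hs w hw =>
    hΨc z' (ht z' hz') s (hsub hs) w hw⟩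

/-- Extension of the time of existence. -/
theorem exists_flow_Ioo [T2Space M] [CompactSpace M] (g : Metric n M) {c : ℝ} (hc : 0 < c)
    (a : ℝ) (z : Cot n M) (hz : symbol g z = c) :
    ∃ γ : ℝ → Cot n M, γ 0 = z ∧ ∀ t ∈ Ioo (-a) a, IsFlowAt g γ t := by
  obtain ⟨ε, hε, hU⟩ := exists_uniform_time g hc
  -- Each round enlarges the interval of existence by the factor 3/2. The curve is restarted at
  -- times ±b/2, at points still on the level p = c so that the same time b is available, and
  -- uniqueness glues the pieces.
  have step : ∀ k : ℕ, ∀ z : Cot n M, symbol g z = c →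
      ∃ γ : ℝ → Cot n M, γ 0 = z ∧ ∀ t ∈ Ioo (-((3 / 2) ^ k * ε)) ((3 / 2) ^ k * ε),
        IsFlowAt g γ t := by
    intro k
    induction k with
    | zero =>
      intro z hz
      obtain ⟨U, -, hzU, Ψ, hΨ, -⟩ := hU z hz
      exact ⟨fun s => Ψ s z, (hΨ z hzU).1, by simpa using (hΨ z hzU).2⟩
    | succ k ih =>
      intro z hz
      set b := (3 / 2 : ℝ) ^ k * ε
      have hb : 0 < b := by positivity
      have hb' : (3 / 2 : ℝ) ^ (k + 1) * ε = 3 / 2 * b := by rw [pow_succ]; ring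
      obtain ⟨γ, hγ0, hγ⟩ := ih z hz
      have hz' : ∀ t ∈ Ioo (-b) b, symbol g (γ t) = c := fun t ht => by
        rw [symbol_eq_of_isFlowAt hγ ht (t := 0) ⟨by linarith, hb⟩, hγ0, hz]
      obtain ⟨γ₁, h10, h1⟩ := ih (γ (b / 2)) (hz' _ ⟨by linarith, by linarith⟩)
      obtain ⟨γ₂, h20, h2⟩ := ih (γ (-(b / 2))) (hz' _ ⟨by linarith, by linarith⟩)
      have h1' : ∀ t ∈ Ioo (-(b / 2)) (3 / 2 * b), IsFlowAt g (fun s => γ₁ (s + -(b / 2))) t :=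
        fun t ht => (h1 _ ⟨by linarith [ht.1], by linarith [ht.2]⟩).comp_add
      have h2' : ∀ t ∈ Ioo (-(3 / 2 * b)) (b / 2), IsFlowAt g (fun s => γ₂ (s + b / 2)) t :=
        fun t ht => (h2 _ ⟨by linarith [ht.1], by linarith [ht.2]⟩).comp_add
      have e1 : EqOn γ (fun s => γ₁ (s + -(b / 2))) (Ioo (-(b / 2)) b) :=
        IsFlowAt.eqOn isOpen_Ioo isPreconnected_Ioo
          (fun t ht => hγ t ⟨by linarith [ht.1], ht.2⟩)
          (fun t ht => h1' t ⟨ht.1, by linarith [ht.2]⟩) (t := b / 2)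
          ⟨by linarith, by linarith⟩ (by simp [h10])
      have e2 : EqOn γ (fun s => γ₂ (s + b / 2)) (Ioo (-b) (b / 2)) :=
        IsFlowAt.eqOn isOpen_Ioo isPreconnected_Ioo
          (fun t ht => hγ t ⟨ht.1, by linarith [ht.2]⟩)
          (fun t ht => h2' t ⟨by linarith [ht.1], ht.2⟩) (t := -(b / 2))
          ⟨by linarith, by linarith⟩ (by simp [h20])
      set β : ℝ → Cot n M := fun t => if t < 0 then γ₂ (t + b / 2) else γ₁ (t + -(b / 2)) with hβ
      have hβγ : EqOn β γ (Ioo (-(b / 2)) (b / 2)) := by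
        intro t ht
        by_cases h : t < 0
        · simp only [hβ, h, if_true]
          exact (e2 ⟨by linarith [ht.1], ht.2⟩).symm
        · simp only [hβ, h, if_false]
          exact (e1 ⟨ht.1, by linarith [ht.2]⟩).symm
      have h00 : (0 : ℝ) ∈ Ioo (-(b / 2)) (b / 2) := ⟨by linarith, by linarith⟩
      refine ⟨β, by rw [hβγ h00, hγ0], fun t ht => ?_⟩
      rw [hb'] at ht
      rcases lt_trichotomy t 0 with h | h | h
      · refine (h2' t ⟨ht.1, by linarith⟩).congr ?_
        filter_upwards [Iio_mem_nhds h] with s hs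
        simp only [hβ, mem_Iio.1 hs, if_true]
      · subst h
        exact (hγ 0 ⟨by linarith, by linarith⟩).congr
          (eventually_of_mem (isOpen_Ioo.mem_nhds h00) hβγ)
      · refine (h1' t ⟨by linarith, ht.2⟩).congr ?_
        filter_upwards [Ioi_mem_nhds h] with s hs
        simp only [hβ, not_lt.2 (mem_Ioi.1 hs).le, if_false]
  obtain ⟨k, hk⟩ := pow_unbounded_of_one_lt (a / ε) (by norm_num : (1 : ℝ) < 3 / 2)
  rw [div_lt_iff₀ hε] at hk
  obtain ⟨γ, h0, h⟩ := step k z hz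
  exact ⟨γ, h0, fun t ht => h t ⟨by linarith [ht.1], by linarith [ht.2]⟩⟩

theorem exists_isBicharacteristic [T2Space M] [CompactSpace M] (g : Metric n M) {z : Cot n M}
    (hz : z.2 ≠ 0) : ∃ γ : ℝ → Cot n M, IsBicharacteristic g γ ∧ γ 0 = z := by
  have h := fun a : ℝ => exists_flow_Ioo g (symbol_pos g hz) a z rfl
  choose γ h0 hγ using h
  have key : ∀ a b : ℝ, 0 < a → a ≤ b → EqOn (γ a) (γ b) (Ioo (-a) a) := fun a b ha hab =>
    IsFlowAt.eqOn isOpen_Ioo isPreconnected_Ioo (hγ a)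
      (fun t ht => hγ b t ⟨by linarith [ht.1], by linarith [ht.2]⟩) (t := 0)
      ⟨by linarith, ha⟩ (by rw [h0, h0])
  -- The value at t is taken from a curve that lives on an interval containing t; near t all these
  -- values come from the single curve with lifetime |t| + 2.
  refine ⟨fun t => γ (|t| + 1) t, isBicharacteristic_iff.2 fun t => ?_, h0 _⟩
  have hab : 0 < |t| + 1 := by positivity
  have hmem : t ∈ Ioo (-(|t| + 2)) (|t| + 2) :=
    ⟨by linarith [neg_abs_le t], by linarith [le_abs_self t]⟩
  refine (hγ (|t| + 2) t hmem).congr ?_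
  have hev : ∀ᶠ s in 𝓝 t, |s| < |t| + 1 :=
    (continuous_abs.continuousAt).eventually_lt continuousAt_const (by simp)
  filter_upwards [hev] with s hs
  exact key (|s| + 1) (|t| + 2) (by positivity) (by linarith)
    ⟨by linarith [neg_abs_le s], by linarith [le_abs_self s]⟩

end
end ConormalFlow
end

/-! ### The geodesic flow: group law, regularity and homogeneity. -/

noncomputable section
namespace ConormalFlow
section
variable {n : ℕ} {M : Type*} [TopologicalSpace M] [ChartedSpace (Rn n) M]
variable [IsManifold 𝓘(ℝ, Rn n) ∞ M]
variable {φ ψ : OpenPartialHomeomorph M (Rn n)} {g : Metric n M}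

theorem geodesicFlow_of_eq_zero {z : Cot n M} (hz : z.2 = 0) (t : ℝ) :
    geodesicFlow g t z = z := by
  refine dif_neg ?_
  rintro ⟨γ, hγ, h0⟩
  exact hγ.1 0 (h0 ▸ hz)

section
variable [T2Space M] [CompactSpace M]

theorem geodesicFlow_spec (g : Metric n M) {z : Cot n M} (hz : z.2 ≠ 0) :
    IsBicharacteristic g (fun t => geodesicFlow g t z) ∧ geodesicFlow g 0 z = z := by
  have h := exists_isBicharacteristic g hz
  have he : ∀ t, geodesicFlow g t z = h.choose t := fun t => dif_pos h
  simp only [he]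
  exact h.choose_spec

theorem geodesicFlow_zero (g : Metric n M) (z : Cot n M) : geodesicFlow g 0 z = z := by
  by_cases hz : z.2 = 0
  · exact geodesicFlow_of_eq_zero hz 0
  · exact (geodesicFlow_spec g hz).2

theorem isFlowAt_geodesicFlow (g : Metric n M) {z : Cot n M} (hz : z.2 ≠ 0) (t : ℝ) :
    IsFlowAt g (fun t => geodesicFlow g t z) t :=
  isBicharacteristic_iff.1 (geodesicFlow_spec g hz).1 t

theorem geodesicFlow_ne_zero (g : Metric n M) {z : Cot n M} (hz : z.2 ≠ 0) (t : ℝ) :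
    (geodesicFlow g t z).2 ≠ 0 := (isFlowAt_geodesicFlow g hz t).1

/-- Uniqueness makes the curve chosen in the definition irrelevant. The group law and the
commutation with dilations follow by exhibiting an integral curve with the right initial value. -/
theorem eq_geodesicFlow {γ : ℝ → Cot n M} (h : ∀ t, IsFlowAt g γ t) (t : ℝ) :
    γ t = geodesicFlow g t (γ 0) :=
  IsFlowAt.eqOn isOpen_univ isPreconnected_univ (fun s _ => h s)
    (fun s _ => isFlowAt_geodesicFlow g (h 0).1 s) (mem_univ 0)
    (geodesicFlow_zero g _).symm (mem_univ t)

theorem eq_geodesicFlow_of_Ioo {γ : ℝ → Cot n M} {a : ℝ} (h : ∀ t ∈ Ioo (-a) a, IsFlowAt g γ t)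
    {t : ℝ} (ht : t ∈ Ioo (-a) a) : γ t = geodesicFlow g t (γ 0) := by
  have h0 : (0 : ℝ) ∈ Ioo (-a) a := ⟨by linarith [ht.1, ht.2], by linarith [ht.1, ht.2]⟩
  exact IsFlowAt.eqOn isOpen_Ioo isPreconnected_Ioo h
    (fun s _ => isFlowAt_geodesicFlow g (h 0 h0).1 s) h0 (geodesicFlow_zero g _).symm ht

theorem geodesicFlow_add (g : Metric n M) (s t : ℝ) (z : Cot n M) :
    geodesicFlow g (s + t) z = geodesicFlow g s (geodesicFlow g t z) := by
  by_cases hz : z.2 = 0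
  · simp only [geodesicFlow_of_eq_zero hz]
  · have h := eq_geodesicFlow (γ := fun s => geodesicFlow g (s + t) z)
      (fun s => (isFlowAt_geodesicFlow g hz (s + t)).comp_add) s
    simpa only [zero_add] using h

theorem geodesicFlow_neg_apply (g : Metric n M) (t : ℝ) (z : Cot n M) :
    geodesicFlow g (-t) (geodesicFlow g t z) = z := by
  rw [← geodesicFlow_add, neg_add_cancel, geodesicFlow_zero]

theorem geodesicFlow_apply_neg (g : Metric n M) (t : ℝ) (z : Cot n M) :
    geodesicFlow g t (geodesicFlow g (-t) z) = z := by
  rw [← geodesicFlow_add, add_neg_cancel, geodesicFlow_zero]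

theorem symbol_geodesicFlow (g : Metric n M) (t : ℝ) (z : Cot n M) :
    symbol g (geodesicFlow g t z) = symbol g z := by
  by_cases hz : z.2 = 0
  · rw [geodesicFlow_of_eq_zero hz]
  · have h := symbol_eq_of_isFlowAt (g := g) (γ := fun s => geodesicFlow g s z)
      (a := -(|t| + 1)) (b := |t| + 1) (fun s _ => isFlowAt_geodesicFlow g hz s)
      (s := t) (t := 0) ⟨by linarith [neg_abs_le t], by linarith [le_abs_self t]⟩
      ⟨by linarith [abs_nonneg t], by linarith [abs_nonneg t]⟩
    simpa only [geodesicFlow_zero] using h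

/-- The geodesic flow is jointly of class `C¹`. -/
theorem contMDiffAt_geodesicFlow (g : Metric n M) (t : ℝ) {z : Cot n M} (hz : z.2 ≠ 0) :
    ContMDiffAt (𝓘(ℝ, ℝ).prod (cotModel n)) (cotModel n) 1
      (fun q : ℝ × Cot n M => geodesicFlow g q.1 q.2) (t, z) := by
  obtain ⟨ε, hε, hU⟩ := exists_uniform_time g (symbol_pos g hz)
  have hshort : ∀ s : ℝ, |s| < ε → ∀ w : Cot n M, symbol g w = symbol g z →
      ContMDiffAt (𝓘(ℝ, ℝ).prod (cotModel n)) (cotModel n) 1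
        (fun q : ℝ × Cot n M => geodesicFlow g q.1 q.2) (s, w) := by
    intro s hs w hw
    obtain ⟨U, hUo, hwU, Ψ, hΨ, hΨc⟩ := hU w hw
    have hs' := abs_lt.1 hs
    refine (hΨc s hs' w hwU).congr_of_eventuallyEq ?_
    filter_upwards [(isOpen_Ioo.prod hUo).mem_nhds (show (s, w) ∈ Ioo (-ε) ε ×ˢ U from ⟨hs', hwU⟩)]
      with q hq
    have := eq_geodesicFlow_of_Ioo (hΨ q.2 hq.2).2 hq.1
    rw [(hΨ q.2 hq.2).1] at this
    exact this.symm
  -- A time below (k + 2)ε is a step a = s / (k + 2), shorter than ε, after the time s - a, which is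
  -- below (k + 1)ε. The intermediate points stay on the level of p for which ε was chosen.
  have hlong : ∀ k : ℕ, ∀ s : ℝ, |s| < (k + 1) * ε → ∀ w : Cot n M, symbol g w = symbol g z →
      ContMDiffAt (𝓘(ℝ, ℝ).prod (cotModel n)) (cotModel n) 1
        (fun q : ℝ × Cot n M => geodesicFlow g q.1 q.2) (s, w) := by
    intro k
    induction k with
    | zero => simpa using hshort
    | succ k ih =>
      intro s hs w hw
      push_cast at hs
      have hk : (0 : ℝ) < (k : ℝ) + 1 + 1 := by positivity
      set a := s / ((k : ℝ) + 1 + 1) with ha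
      have hsa : s = ((k : ℝ) + 1 + 1) * a := by rw [ha]; field_simp
      have haε : |a| < ε := by
        rw [hsa, abs_mul, abs_of_pos hk] at hs
        exact lt_of_mul_lt_mul_left hs hk.le
      have hb : |s - a| < (k + 1) * ε := by
        rw [show s - a = ((k : ℝ) + 1) * a by rw [hsa]; ring, abs_mul,
          abs_of_pos (by positivity : (0 : ℝ) < (k : ℝ) + 1)]
        gcongr
      have h1 : ContMDiffAt (𝓘(ℝ, ℝ).prod (cotModel n)) (𝓘(ℝ, ℝ).prod (cotModel n)) 1
          (fun q : ℝ × Cot n M => (q.1 - a, q.2)) (s, w) :=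
        ((contMDiffAt_fst.sub contMDiffAt_const).prodMk contMDiffAt_snd)
      have h2 := ContMDiffAt.comp (s, w) (ih (s - a) hb w hw) h1
      have h3 : ContMDiffAt (𝓘(ℝ, ℝ).prod (cotModel n)) (𝓘(ℝ, ℝ).prod (cotModel n)) 1
          (fun q : ℝ × Cot n M => (a, geodesicFlow g (q.1 - a) q.2)) (s, w) :=
        contMDiffAt_const.prodMk h2
      have h4 := ContMDiffAt.comp (s, w) (hshort a haε (geodesicFlow g (s - a) w)
        (by rw [symbol_geodesicFlow, hw])) h3
      refine h4.congr_of_eventuallyEq (Eventually.of_forall fun q => ?_)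
      simp only [Function.comp]
      rw [← geodesicFlow_add]
      congr 1
      ring
  obtain ⟨k, hk⟩ := exists_nat_gt (|t| / ε)
  refine hlong k t ?_ z rfl
  rw [div_lt_iff₀ hε] at hk
  nlinarith

theorem continuousAt_geodesicFlow (g : Metric n M) (t : ℝ) {z : Cot n M} (hz : z.2 ≠ 0) :
    ContinuousAt (fun q : ℝ × Cot n M => geodesicFlow g q.1 q.2) (t, z) :=
  (contMDiffAt_geodesicFlow g t hz).continuousAt

theorem contMDiffAt_geodesicFlow_right (g : Metric n M) (t : ℝ) {z : Cot n M} (hz : z.2 ≠ 0) :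
    ContMDiffAt (cotModel n) (cotModel n) 1 (geodesicFlow g t) z :=
  ContMDiffAt.comp z (contMDiffAt_geodesicFlow g t hz)
    (contMDiffAt_const.prodMk contMDiffAt_id : ContMDiffAt (cotModel n) (𝓘(ℝ, ℝ).prod (cotModel n))
      1 (fun w : Cot n M => (t, w)) z)

/-- `geodesicFlow g (-t)` is a differentiable left inverse. -/
theorem flowDeriv_injective (g : Metric n M) (t : ℝ) {z : Cot n M} (hz : z.2 ≠ 0) :
    Function.Injective (flowDeriv g t z) := by
  have h1 := (contMDiffAt_geodesicFlow_right g t hz).mdifferentiableAt (by simp)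
  have h2 := (contMDiffAt_geodesicFlow_right g (-t) (geodesicFlow_ne_zero g hz t)).mdifferentiableAt
    (by simp)
  have h3 := h2.hasMFDerivAt.comp z h1.hasMFDerivAt
  have h4 : HasMFDerivAt (cotModel n) (cotModel n) (id : Cot n M → Cot n M) z _ :=
    h3.congr_of_eventuallyEq (Eventually.of_forall fun w => (geodesicFlow_neg_apply g t w).symm)
  have h5 := hasMFDerivAt_unique h4 (hasMFDerivAt_id z)
  intro v w hvw
  have h6 := fun u => DFunLike.congr_fun h5 u
  exact (h6 v).symm.trans ((congrArg (mfderiv (cotModel n) (cotModel n) (geodesicFlow g (-t))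
    (geodesicFlow g t z)) hvw).trans (h6 w))

end

/-- The dilation of the fibres of `T*M`. -/
def dilation (r : ℝ) (z : Cot n M) : Cot n M := ⟨z.1, r • z.2⟩

/-- The dilation of the fibres in canonical coordinates. -/
def dilationCoord (n : ℕ) (r : ℝ) : (Rn n × (Rn n →L[ℝ] ℝ)) →L[ℝ] Rn n × (Rn n →L[ℝ] ℝ) :=
  (ContinuousLinearMap.fst ℝ _ _).prod (r • ContinuousLinearMap.snd ℝ _ _)

@[simp] theorem dilationCoord_apply (r : ℝ) (w : Rn n × (Rn n →L[ℝ] ℝ)) :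
    dilationCoord n r w = (w.1, r • w.2) := rfl

theorem canCoord_dilation (φ : OpenPartialHomeomorph M (Rn n)) (r : ℝ) (z : Cot n M) :
    canCoord φ (dilation r z) = dilationCoord n r (canCoord φ z) := rfl

theorem symbolCoord_dilationCoord (g : Metric n M) {r : ℝ} (hr : 0 < r)
    (w : Rn n × (Rn n →L[ℝ] ℝ)) :
    symbolCoord g φ (dilationCoord n r w) = r * symbolCoord g φ w := by
  rw [symbolCoord, dilationCoord_apply, energyCoord_smul, Real.sqrt_mul (sq_nonneg r),
    Real.sqrt_sq hr.le]
  rfl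

theorem symbol_dilation (g : Metric n M) {r : ℝ} (hr : 0 < r) (z : Cot n M) :
    symbol g (dilation r z) = r * symbol g z := by
  have hφ : chartAt (Rn n) z.1 ∈ IsManifold.maximalAtlas 𝓘(ℝ, Rn n) ∞ M :=
    IsManifold.chart_mem_maximalAtlas z.1
  have h0 : z.1 ∈ (chartAt (Rn n) z.1).source := mem_chart_source _ _
  rw [symbol_eq_symbolCoord g hφ h0, symbol_eq_symbolCoord g hφ (z := dilation r z) h0,
    canCoord_dilation, symbolCoord_dilationCoord g hr]

/-- The identity p(x, rξ) = r p(x, ξ) is differentiated and paired with (b.1, r⁻¹ • b.2), the vector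
that the dilation carries to b. -/
theorem hamCoord_dilationCoord (g : Metric n M) (hφ : φ ∈ IsManifold.maximalAtlas 𝓘(ℝ, Rn n) ∞ M)
    {r : ℝ} (hr : 0 < r) {w : Rn n × (Rn n →L[ℝ] ℝ)} (hw : w.1 ∈ φ.target) (hw2 : w.2 ≠ 0) :
    hamCoord g φ (dilationCoord n r w) = dilationCoord n r (hamCoord g φ w) := by
  have hd1 := ((symbolCoord_contDiffAt g hφ hw hw2).differentiableAt (by simp)).hasFDerivAt
  have hd2 := ((symbolCoord_contDiffAt g hφ (w := dilationCoord n r w) hw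
    (smul_ne_zero hr.ne' hw2)).differentiableAt (by simp)).hasFDerivAt
  have hd3 := hd2.comp w (dilationCoord n r).hasFDerivAt
  have hd4 : HasFDerivAt (symbolCoord g φ ∘ dilationCoord n r)
      (r • fderiv ℝ (symbolCoord g φ) w) w := by
    refine (hd1.const_mul r).congr_of_eventuallyEq (Eventually.of_forall fun v => ?_)
    exact symbolCoord_dilationCoord g hr v
  have hd5 := hd3.unique hd4
  refine symplectic_ext fun b => ?_
  rw [hamCoord, symplecticDual_pairing, hamCoord]
  have h1 := DFunLike.congr_fun hd5 (b.1, r⁻¹ • b.2)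
  simp only [ContinuousLinearMap.comp_apply, dilationCoord_apply, smul_smul, smul_apply,
    mul_inv_cancel₀ hr.ne', one_smul] at h1
  rw [Prod.mk.eta] at h1
  rw [dilationCoord_apply]
  erw [h1]
  rw [← symplecticDual_pairing]
  simp only [smul_apply, smul_eq_mul]
  change _ = b.2 ((symplecticDual n) (fderiv ℝ (symbolCoord g φ) w)).1 -
    r * ((symplecticDual n) (fderiv ℝ (symbolCoord g φ) w)).2 b.1
  field_simp

theorem continuousAt_dilation (r : ℝ) (z : Cot n M) : ContinuousAt (dilation r) z := by
  have hφ : chartAt (Rn n) z.1 ∈ IsManifold.maximalAtlas 𝓘(ℝ, Rn n) ∞ M :=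
    IsManifold.chart_mem_maximalAtlas z.1
  have h0 : z.1 ∈ (chartAt (Rn n) z.1).source := mem_chart_source _ _
  set φ := chartAt (Rn n) z.1
  have h1 : ContinuousAt (fun w => canPoint φ (dilationCoord n r (canCoord φ w))) z := by
    refine ContinuousAt.comp (g := canPoint φ) (f := fun w => dilationCoord n r (canCoord φ w)) ?_
      ((dilationCoord n r).continuous.continuousAt.comp (continuousAt_canCoord hφ h0))
    exact (contMDiffAt_canPoint hφ (w := dilationCoord n r (canCoord φ z))
      (φ.map_source h0)).continuousAt
  refine h1.congr ?_
  filter_upwards [(isOpen_over φ).mem_nhds h0] with w hw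
  rw [← canCoord_dilation, canPoint_canCoord hφ (z := dilation r w) hw]

theorem dilation_dilation (r s : ℝ) (z : Cot n M) :
    dilation r (dilation s z) = dilation (r * s) z :=
  congrArg (fun ξ => (⟨z.1, ξ⟩ : Cot n M)) (smul_smul r s z.2)

theorem dilation_one (z : Cot n M) : dilation 1 z = z := by
  simp [dilation]

theorem IsFlowAt.dilation {γ : ℝ → Cot n M} {t : ℝ} (h : IsFlowAt g γ t) {r : ℝ} (hr : 0 < r) :
    IsFlowAt g (fun s => dilation r (γ s)) t := by
  have hφ : chartAt (Rn n) (γ t).1 ∈ IsManifold.maximalAtlas 𝓘(ℝ, Rn n) ∞ M :=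
    IsManifold.chart_mem_maximalAtlas (γ t).1
  have h0 : (γ t).1 ∈ (chartAt (Rn n) (γ t).1).source := mem_chart_source _ _
  refine isFlowAt_of_hasDerivAt (φ := chartAt (Rn n) (γ t).1)
    (ContinuousAt.comp (g := ConormalFlow.dilation r) (continuousAt_dilation r _) h.continuousAt)
    (smul_ne_zero hr.ne' h.1) hφ h0 ?_
  simp only [canCoord_dilation]
  rw [hamCoord_dilationCoord g hφ hr (w := canCoord _ (γ t)) (OpenPartialHomeomorph.map_source _ h0)
    ((canCoord_snd_ne_zero hφ h0).2 h.1)]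
  exact (ConormalFlow.dilationCoord n r).hasFDerivAt.comp_hasDerivAt t (h.hasDerivAt hφ h0)

theorem geodesicFlow_dilation [T2Space M] [CompactSpace M] (g : Metric n M) {r : ℝ} (hr : 0 < r)
    (t : ℝ) (z : Cot n M) :
    geodesicFlow g t (dilation r z) = dilation r (geodesicFlow g t z) := by
  by_cases hz : z.2 = 0
  · rw [geodesicFlow_of_eq_zero hz, geodesicFlow_of_eq_zero (show r • z.2 = 0 by rw [hz]; exact smul_zero r)]
  · have h := eq_geodesicFlow (fun t => (isFlowAt_geodesicFlow g hz t).dilation hr) t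
    rw [geodesicFlow_zero] at h
    exact h.symm

theorem radialProj_eq_dilation (g : Metric n M) (z : Cot n M) :
    radialProj g z = dilation (symbol g z)⁻¹ z := rfl

end
end ConormalFlow
end

/-! ### The conormal bundle in slice charts. -/

noncomputable section
namespace ConormalFlow
section
variable {n : ℕ} {M : Type*} [TopologicalSpace M] [ChartedSpace (Rn n) M]

/-- The part `(x', ξ'')` of the canonical coordinates. -/
def coordPart (n d : ℕ) : (Rn n × (Rn n →L[ℝ] ℝ)) →L[ℝ] Rn n :=
  LinearMap.toContinuousLinearMap
    { toFun := fun w => WithLp.toLp 2 fun i =>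
        if (i : ℕ) < d then w.1 i else w.2 (EuclideanSpace.single i (1 : ℝ))
      map_add' := fun v w => by
        ext i
        by_cases h : (i : ℕ) < d <;> simp [h]
      map_smul' := fun c w => by
        ext i
        by_cases h : (i : ℕ) < d <;> simp [h] }

/-- The part `(x'', ξ')` of the canonical coordinates, which vanishes on the conormal bundle. -/
def coordDefect (n d : ℕ) : (Rn n × (Rn n →L[ℝ] ℝ)) →L[ℝ] Rn n :=
  LinearMap.toContinuousLinearMap
    { toFun := fun w => WithLp.toLp 2 fun i =>
        if (i : ℕ) < d then w.2 (EuclideanSpace.single i (1 : ℝ)) else w.1 i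
      map_add' := fun v w => by
        ext i
        by_cases h : (i : ℕ) < d <;> simp [h]
      map_smul' := fun c w => by
        ext i
        by_cases h : (i : ℕ) < d <;> simp [h] }

/-- The embedding `(x', ξ'') ↦ ((x', 0), (0, ξ''))`. -/
def coordEmb (n d : ℕ) : Rn n →L[ℝ] Rn n × (Rn n →L[ℝ] ℝ) :=
  LinearMap.toContinuousLinearMap
    { toFun := fun v => (basePart d v, ∑ i : Fin n, if (i : ℕ) < d then 0 else
        v i • (EuclideanSpace.proj i : Rn n →L[ℝ] ℝ))
      map_add' := fun v w => by
        ext1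
        · ext i
          by_cases h : (i : ℕ) < d <;> simp [h, basePart]
        · simp only [Prod.snd_add, ← Finset.sum_add_distrib]
          refine Finset.sum_congr rfl fun i _ => ?_
          by_cases h : (i : ℕ) < d <;> simp [h, add_smul]
      map_smul' := fun c w => by
        ext1
        · ext i
          by_cases h : (i : ℕ) < d <;> simp [h, basePart]
        · simp only [Prod.smul_snd, Finset.smul_sum]
          refine Finset.sum_congr rfl fun i _ => ?_
          by_cases h : (i : ℕ) < d <;> simp [h, mul_smul] }

variable {d : ℕ}

theorem coordPart_apply (w : Rn n × (Rn n →L[ℝ] ℝ)) (i : Fin n) : coordPart n d w i =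
    if (i : ℕ) < d then w.1 i else w.2 (EuclideanSpace.single i (1 : ℝ)) := rfl

theorem coordDefect_apply (w : Rn n × (Rn n →L[ℝ] ℝ)) (i : Fin n) : coordDefect n d w i =
    if (i : ℕ) < d then w.2 (EuclideanSpace.single i (1 : ℝ)) else w.1 i := rfl

theorem coordEmb_fst (v : Rn n) : (coordEmb n d v).1 = basePart d v := rfl

theorem coordEmb_snd (v : Rn n) : (coordEmb n d v).2 = ∑ i : Fin n, if (i : ℕ) < d then 0 else
    v i • (EuclideanSpace.proj i : Rn n →L[ℝ] ℝ) := rfl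

theorem coordEmb_snd_single (v : Rn n) (j : Fin n) :
    (coordEmb n d v).2 (EuclideanSpace.single j (1 : ℝ)) = if (j : ℕ) < d then 0 else v j := by
  rw [coordEmb_snd, sum_apply, Finset.sum_eq_single j]
  · by_cases h : (j : ℕ) < d <;> simp [h]
  · intro i _ hij
    by_cases h : (i : ℕ) < d <;> simp [h, hij]
  · simp

theorem coordPart_coordEmb (v : Rn n) : coordPart n d (coordEmb n d v) = v := by
  ext i
  rw [coordPart_apply, coordEmb_snd_single, coordEmb_fst]
  by_cases h : (i : ℕ) < d <;> simp [h, basePart]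

theorem coordDefect_coordEmb (v : Rn n) : coordDefect n d (coordEmb n d v) = 0 := by
  ext i
  rw [coordDefect_apply, coordEmb_snd_single, coordEmb_fst]
  by_cases h : (i : ℕ) < d <;> simp [h, basePart]

theorem coordEmb_coordPart {w : Rn n × (Rn n →L[ℝ] ℝ)} (h : coordDefect n d w = 0) :
    coordEmb n d (coordPart n d w) = w := by
  have hi := fun i => congrArg (fun v : Rn n => v i) h
  simp only [coordDefect_apply, PiLp.zero_apply] at hi
  ext1
  · ext i
    specialize hi i
    by_cases h : (i : ℕ) < d <;> simp_all [coordEmb_fst, basePart, coordPart_apply]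
  · rw [covector_eq_sum_proj w.2, coordEmb_snd]
    refine Finset.sum_congr rfl fun i _ => ?_
    specialize hi i
    by_cases h : (i : ℕ) < d <;> simp_all [coordPart_apply]

variable {φ ψ : OpenPartialHomeomorph M (Rn n)}

theorem conormalCoord_eq (z : Cot n M) : conormalCoord d φ z = coordPart n d (canCoord φ z) := rfl

theorem conormalParam_eq (w : Rn n) : conormalParam d φ w = canPoint φ (coordEmb n d w) := by
  refine congrArg (fun ξ => (⟨φ.symm (basePart d w), ξ⟩ : Cot n M))
    (ContinuousLinearMap.ext fun v => ?_)
  change _ = (∑ i : Fin n, if (i : ℕ) < d then 0 else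
    w i • (EuclideanSpace.proj i : Rn n →L[ℝ] ℝ)) (chartDeriv φ (φ.symm (basePart d w)) v)
  rw [sum_apply, sum_apply]
  refine Finset.sum_congr rfl fun i _ => ?_
  by_cases h : (i : ℕ) < d <;> simp [h, coframe]

theorem mem_paramDomain {w : Rn n} : w ∈ paramDomain d φ ↔ (coordEmb n d w).1 ∈ φ.target := Iff.rfl

theorem continuous_basePart : Continuous (basePart d : Rn n → Rn n) :=
  continuous_fst.comp (coordEmb n d).continuous

theorem isOpen_paramDomain : IsOpen (paramDomain d φ) :=
  φ.open_target.preimage continuous_basePart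

variable [IsManifold 𝓘(ℝ, Rn n) ∞ M] {g : Metric n M} {H : Set M}

/-- The j-th coordinate line of ψ through x stays in H, where the i-th coordinate of φ vanishes.
This block triangular shape underlies all independence of slice charts. -/
theorem IsSliceChart.frameMatrix_eq_zero (hφ : IsSliceChart d H φ) (hψ : IsSliceChart d H ψ) {x : M}
    (hx : x ∈ φ.source) (hx' : x ∈ ψ.source) (hxH : x ∈ H) {i j : Fin n} (hi : d ≤ (i : ℕ))
    (hj : (j : ℕ) < d) : frameMatrix φ ψ x i j = 0 := by
  have h1 : frameMatrix φ ψ x i j =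
      (fderiv ℝ (φ ∘ ψ.symm) (ψ x) (EuclideanSpace.single j (1 : ℝ))) i := by
    rw [← chartDeriv_comp_inverse_eq_fderiv hφ.1 hψ.1 hx hx']
    rfl
  have hd : HasFDerivAt (φ ∘ ψ.symm) (fderiv ℝ (φ ∘ ψ.symm) (ψ x)) (ψ x) :=
    ((transition_contDiffAt hψ.1 hφ.1 (ψ.map_source hx')
      (by rwa [ψ.left_inv hx'])).differentiableAt (by simp)).hasFDerivAt
  have hline : HasDerivAt (fun s : ℝ => ψ x + s • EuclideanSpace.single j (1 : ℝ))
      (EuclideanSpace.single j (1 : ℝ)) 0 := by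
    simpa using ((hasDerivAt_id (0 : ℝ)).smul_const (EuclideanSpace.single j (1 : ℝ))).const_add
      (ψ x)
  have hd2 : HasDerivAt (fun s : ℝ => (φ (ψ.symm (ψ x + s • EuclideanSpace.single j (1 : ℝ)))) i)
      ((fderiv ℝ (φ ∘ ψ.symm) (ψ x) (EuclideanSpace.single j (1 : ℝ))) i) 0 := by
    have h0 : HasFDerivAt (φ ∘ ψ.symm) (fderiv ℝ (φ ∘ ψ.symm) (ψ x))
        (ψ x + (0 : ℝ) • EuclideanSpace.single j (1 : ℝ)) := by simpa using hd
    have h2 := h0.comp_hasDerivAt (0 : ℝ) hline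
    exact (EuclideanSpace.proj i : Rn n →L[ℝ] ℝ).hasFDerivAt.comp_hasDerivAt (0 : ℝ) h2
  rw [h1]
  refine hd2.unique ((hasDerivAt_const (0 : ℝ) (0 : ℝ)).congr_of_eventuallyEq ?_)
  have hev : ∀ᶠ s : ℝ in 𝓝 0, ψ x + s • EuclideanSpace.single j (1 : ℝ) ∈
      ψ.target ∩ ψ.symm ⁻¹' φ.source := by
    refine hline.continuousAt.preimage_mem_nhds
      ((ψ.isOpen_inter_preimage_symm φ.open_source).mem_nhds ?_)
    simpa [ψ.left_inv hx', ψ.map_source hx'] using hx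
  filter_upwards [hev] with s hs
  refine (hφ.2 _ hs.2).1 ?_ i hi
  rw [hψ.2 _ (ψ.map_target hs.1), ψ.right_inv hs.1]
  intro k hk
  have hkj : k ≠ j := fun h => by subst h; omega
  simpa [hkj] using (hψ.2 x hx').1 hxH k hk

theorem canCoord_snd_single (φ : OpenPartialHomeomorph M (Rn n)) (z : Cot n M) (i : Fin n) :
    (canCoord φ z).2 (EuclideanSpace.single i (1 : ℝ)) = z.2 (frame φ z.1 i) := rfl

/-- The conormal condition has to be tested in one slice chart only: in another one the first d
coordinate vectors are combinations of the first d of φ, the other coefficients being zero. -/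
theorem mem_conormal_iff (hφ : IsSliceChart d H φ) {z : Cot n M} (hz : z.1 ∈ φ.source) :
    z ∈ conormal d H ↔ z.2 ≠ 0 ∧ coordDefect n d (canCoord φ z) = 0 := by
  constructor
  · rintro ⟨h1, h2, h3⟩
    refine ⟨h2, ?_⟩
    ext i
    rw [coordDefect_apply]
    split_ifs with hi
    · exact h3 φ hφ hz i hi
    · exact (hφ.2 _ hz).1 h1 i (not_lt.1 hi)
  · rintro ⟨h2, h3⟩
    have hi := fun i => congrArg (fun v : Rn n => v i) h3
    simp only [coordDefect_apply, PiLp.zero_apply] at hi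
    have hH : z.1 ∈ H := (hφ.2 _ hz).2 fun i hid => by
      have := hi i
      rwa [if_neg (not_lt.2 hid)] at this
    refine ⟨hH, h2, fun ψ hψ hzψ j hj => ?_⟩
    rw [frame_eq_sum hφ.1 hz ψ j, map_sum]
    refine Finset.sum_eq_zero fun i _ => ?_
    by_cases hid : (i : ℕ) < d
    · have : z.2 (frame φ z.1 i) = 0 := by simpa [hid, canCoord_snd_single] using hi i
      rw [map_smul, this, smul_zero]
    · rw [hφ.frameMatrix_eq_zero hψ hz hzψ hH (not_lt.1 hid) hj, zero_smul, map_zero]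

theorem sliceChartAt_spec (hH : IsEmbeddedSubmanifold (n := n) d H) {x : M} (hx : x ∈ H) :
    IsSliceChart d H (sliceChartAt (n := n) d H x) ∧ x ∈ (sliceChartAt (n := n) d H x).source := by
  have h := hH.2 x hx
  rw [sliceChartAt, dif_pos h]
  exact h.choose_spec

theorem conormalParam_conormalCoord (hφ : IsSliceChart d H φ) {z : Cot n M} (hz : z.1 ∈ φ.source)
    (h : coordDefect n d (canCoord φ z) = 0) : conormalParam d φ (conormalCoord d φ z) = z := by
  rw [conormalParam_eq, conormalCoord_eq, coordEmb_coordPart h, canPoint_canCoord hφ.1 hz]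

theorem conormalCoord_mem_paramDomain {z : Cot n M} (hz : z.1 ∈ φ.source)
    (h : coordDefect n d (canCoord φ z) = 0) : conormalCoord d φ z ∈ paramDomain d φ := by
  rw [mem_paramDomain, conormalCoord_eq, coordEmb_coordPart h]
  exact φ.map_source hz

theorem conormalParam_mem_source {w : Rn n} (hw : w ∈ paramDomain d φ) :
    (conormalParam d φ w).1 ∈ φ.source := φ.map_target hw

theorem canCoord_conormalParam (hφ : IsSliceChart d H φ) {w : Rn n} (hw : w ∈ paramDomain d φ) :
    canCoord φ (conormalParam d φ w) = coordEmb n d w := by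
  rw [conormalParam_eq, canCoord_canPoint hφ.1 (w := coordEmb n d w) hw]

theorem conormalCoord_conormalParam (hφ : IsSliceChart d H φ) {w : Rn n}
    (hw : w ∈ paramDomain d φ) : conormalCoord d φ (conormalParam d φ w) = w := by
  rw [conormalCoord_eq, canCoord_conormalParam hφ hw, coordPart_coordEmb]

theorem conormalParam_fst_mem (hφ : IsSliceChart d H φ) {w : Rn n} (hw : w ∈ paramDomain d φ) :
    (conormalParam d φ w).1 ∈ H := by
  rw [hφ.2 _ (conormalParam_mem_source hw)]
  intro i hi
  have := congrArg (fun v => v.1 i) (canCoord_conormalParam hφ hw)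
  simpa [canCoord, coordEmb_fst, basePart, not_lt.2 hi] using this

theorem conormalParam_mem_conormal (hφ : IsSliceChart d H φ) {w : Rn n} (hw : w ∈ paramDomain d φ)
    (h : (conormalParam d φ w).2 ≠ 0) : conormalParam d φ w ∈ conormal d H :=
  (mem_conormal_iff hφ (conormalParam_mem_source hw)).2
    ⟨h, by rw [canCoord_conormalParam hφ hw, coordDefect_coordEmb]⟩

theorem contMDiffAt_conormalParam (hφ : IsSliceChart d H φ) {w : Rn n} (hw : w ∈ paramDomain d φ) :
    ContMDiffAt 𝓘(ℝ, Rn n) (cotModel n) ∞ (conormalParam d φ : Rn n → Cot n M) w := by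
  have h : (conormalParam d φ : Rn n → Cot n M) = canPoint φ ∘ coordEmb n d :=
    funext fun _ => conormalParam_eq _
  rw [h]
  exact ContMDiffAt.comp w (contMDiffAt_canPoint hφ.1 (w := coordEmb n d w) hw)
    (coordEmb n d).contDiff.contMDiff.contMDiffAt

theorem mem_conormalParam_iff (hφ : IsSliceChart d H φ) {z : Cot n M} (hz : z ∈ conormal d H)
    (hz' : z.1 ∈ φ.source) : conormalCoord d φ z ∈ paramDomain d φ ∧
      conormalParam d φ (conormalCoord d φ z) = z :=
  have h := ((mem_conormal_iff hφ hz').1 hz).2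
  ⟨conormalCoord_mem_paramDomain hz' h, conormalParam_conormalCoord hφ hz' h⟩

end
end ConormalFlow
end

/-! ### Tangent spaces of the conormal bundle and the flow in slice coordinates. -/

noncomputable section
namespace ConormalFlow
section
variable {n : ℕ} {M : Type*} [TopologicalSpace M] [ChartedSpace (Rn n) M]
variable [IsManifold 𝓘(ℝ, Rn n) ∞ M]
variable {φ ψ χ : OpenPartialHomeomorph M (Rn n)} {g : Metric n M} {H : Set M} {d : ℕ}

theorem mfderiv_canCoord_injective (hφ : φ ∈ IsManifold.maximalAtlas 𝓘(ℝ, Rn n) ∞ M) {z : Cot n M}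
    (hz : z.1 ∈ φ.source) : Function.Injective
      (mfderiv (cotModel n) 𝓘(ℝ, Rn n × (Rn n →L[ℝ] ℝ)) (canCoord φ) z) := by
  have h1 := ((contMDiffAt_canCoord hφ hz).mdifferentiableAt (by simp)).hasMFDerivAt
  have h2 := ((contMDiffAt_canPoint hφ (w := canCoord φ z)
    (φ.map_source hz)).mdifferentiableAt (by simp)).hasMFDerivAt
  have h3 : HasMFDerivAt (cotModel n) (cotModel n) (id : Cot n M → Cot n M) z _ :=
    (h2.comp z h1).congr_of_eventuallyEq (by
      filter_upwards [(isOpen_over φ).mem_nhds hz] with w hw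
      exact (canPoint_canCoord hφ hw).symm)
  have h5 := hasMFDerivAt_unique h3 (hasMFDerivAt_id z)
  intro v w hvw
  have h6 := fun u => DFunLike.congr_fun h5 u
  exact (h6 v).symm.trans ((congrArg (mfderiv 𝓘(ℝ, Rn n × (Rn n →L[ℝ] ℝ)) (cotModel n) (canPoint φ)
    (canCoord φ z)) hvw).trans (h6 w))

theorem mfderiv_canCoord_conormalParam (hφ : IsSliceChart d H φ) {w : Rn n}
    (hw : w ∈ paramDomain d φ) {z : Cot n M} (hz : conormalParam d φ w = z) (u : Rn n) :
    (mfderiv (cotModel n) 𝓘(ℝ, Rn n × (Rn n →L[ℝ] ℝ)) (canCoord φ) z :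
      (Rn n × (Rn n →L[ℝ] ℝ)) →L[ℝ] Rn n × (Rn n →L[ℝ] ℝ))
      (mfderiv 𝓘(ℝ, Rn n) (cotModel n) (conormalParam d φ) w u) = coordEmb n d u := by
  subst hz
  have h1 := ((contMDiffAt_canCoord hφ.1 (conormalParam_mem_source hw)).mdifferentiableAt
    (by simp)).hasMFDerivAt
  have h2 := ((contMDiffAt_conormalParam hφ hw).mdifferentiableAt (by simp)).hasMFDerivAt
  have h3 : HasMFDerivAt 𝓘(ℝ, Rn n) 𝓘(ℝ, Rn n × (Rn n →L[ℝ] ℝ)) (coordEmb n d) w _ :=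
    (h1.comp w h2).congr_of_eventuallyEq (by
      filter_upwards [isOpen_paramDomain.mem_nhds hw] with w hw
      exact (canCoord_conormalParam hφ hw).symm)
  exact DFunLike.congr_fun (hasMFDerivAt_unique h3 (coordEmb n d).hasMFDerivAt) u

/-- In the canonical coordinates of a slice chart the conormal bundle is an open part of a linear
subspace, so its tangent space is the kernel of `coordDefect`. -/
theorem mem_range_mfderiv_conormalParam (hφ : IsSliceChart d H φ) {w : Rn n}
    (hw : w ∈ paramDomain d φ) {z : Cot n M} (hz : conormalParam d φ w = z)
    (v : Rn n × (Rn n →L[ℝ] ℝ)) :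
    (∃ u : Rn n, (mfderiv 𝓘(ℝ, Rn n) (cotModel n) (conormalParam d φ : Rn n → Cot n M) w :
      Rn n →L[ℝ] Rn n × (Rn n →L[ℝ] ℝ)) u = v) ↔
    coordDefect n d ((mfderiv (cotModel n) 𝓘(ℝ, Rn n × (Rn n →L[ℝ] ℝ)) (canCoord φ) z :
      (Rn n × (Rn n →L[ℝ] ℝ)) →L[ℝ] Rn n × (Rn n →L[ℝ] ℝ)) v) = 0 := by
  constructor
  · rintro ⟨u, rfl⟩
    exact (congrArg _ (mfderiv_canCoord_conormalParam hφ hw hz u)).trans (coordDefect_coordEmb u)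
  · intro h
    refine ⟨coordPart n d ((mfderiv (cotModel n) 𝓘(ℝ, Rn n × (Rn n →L[ℝ] ℝ)) (canCoord φ) z :
      (Rn n × (Rn n →L[ℝ] ℝ)) →L[ℝ] Rn n × (Rn n →L[ℝ] ℝ)) v), mfderiv_canCoord_injective hφ.1 (z := z) (hz ▸ conormalParam_mem_source hw) ?_⟩
    exact (mfderiv_canCoord_conormalParam hφ hw hz _).trans (coordEmb_coordPart h)

theorem eventually_conormalParam (hφ : IsSliceChart d H φ) {w : Rn n} (hw : w ∈ paramDomain d φ)
    (h0 : (conormalParam d φ w : Cot n M).2 ≠ 0) {U : Set M} (hU : IsOpen U)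
    (hwU : (conormalParam d φ w).1 ∈ U) :
    ∀ᶠ w' in 𝓝 w, w' ∈ paramDomain d φ ∧ conormalParam d φ w' ∈ conormal d H ∧
      (conormalParam d φ w').1 ∈ U := by
  have hc := (contMDiffAt_conormalParam hφ hw).continuousAt
  filter_upwards [isOpen_paramDomain.mem_nhds hw, hc (isOpen_nonzero.mem_nhds h0),
    hc ((hU.preimage continuous_proj_cot).mem_nhds hwU)] with w' h1 h2 h3
  exact ⟨h1, conormalParam_mem_conormal hφ h1 h2, h3⟩

theorem exists_mfderiv_conormalParam_eq (hφ : IsSliceChart d H φ) (hψ : IsSliceChart d H ψ)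
    {w w' : Rn n} (hw : w ∈ paramDomain d φ) (hw' : w' ∈ paramDomain d ψ)
    (h : (conormalParam d φ w : Cot n M) = conormalParam d ψ w')
    (h0 : (conormalParam d φ w : Cot n M).2 ≠ 0) (u : Rn n) :
    ∃ u' : Rn n, (mfderiv 𝓘(ℝ, Rn n) (cotModel n) (conormalParam d ψ : Rn n → Cot n M) w' :
      Rn n →L[ℝ] Rn n × (Rn n →L[ℝ] ℝ)) u' =
      (mfderiv 𝓘(ℝ, Rn n) (cotModel n) (conormalParam d φ : Rn n → Cot n M) w :
      Rn n →L[ℝ] Rn n × (Rn n →L[ℝ] ℝ)) u := by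
  have hψs : (conormalParam d φ w).1 ∈ ψ.source := h ▸ conormalParam_mem_source hw'
  have h1 := contMDiffAt_conormalParam hφ hw
  have h2 := ContMDiffAt.comp w (contMDiffAt_canCoord hψ.1 hψs) h1
  have h3 : ContMDiffAt 𝓘(ℝ, Rn n) 𝓘(ℝ, Rn n) ∞
      (fun v => coordPart n d (canCoord ψ (conormalParam d φ v))) w :=
    ContMDiffAt.comp w (coordPart n d).contDiff.contMDiff.contMDiffAt h2
  have h4 := (h3.mdifferentiableAt (by simp)).hasMFDerivAt
  have he : coordPart n d (canCoord ψ (conormalParam d φ w)) = w' := by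
    rw [h]
    exact conormalCoord_conormalParam hψ hw'
  have h5 := ((contMDiffAt_conormalParam hψ (w := coordPart n d (canCoord ψ (conormalParam d φ w)))
    (he ▸ hw')).mdifferentiableAt (by simp)).hasMFDerivAt
  have h6 : HasMFDerivAt 𝓘(ℝ, Rn n) (cotModel n) (conormalParam d φ : Rn n → Cot n M) w _ :=
    (h5.comp w h4).congr_of_eventuallyEq (by
      filter_upwards [eventually_conormalParam hφ hw h0 ψ.open_source hψs] with v hv
      exact (mem_conormalParam_iff hψ hv.2.1 hv.2.2).2.symm)
  have h7 := DFunLike.congr_fun (h6.mfderiv) u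
  refine ⟨(mfderiv 𝓘(ℝ, Rn n) 𝓘(ℝ, Rn n)
    (fun v => coordPart n d (canCoord ψ (conormalParam d φ v))) w : Rn n →L[ℝ] Rn n) u, ?_⟩
  rw [he] at h7
  exact h7.symm

/-- The definition uses one chosen slice chart. Two parametrizations differ by a smooth
reparametrization near the point, so their derivatives have the same range, and any slice chart
serves. -/
theorem mem_conormalTangent_iff (hH : IsEmbeddedSubmanifold (n := n) d H) (hφ : IsSliceChart d H φ)
    {z : Cot n M} (hz : z ∈ conormal d H) (hzφ : z.1 ∈ φ.source)
    (v : Rn n × (Rn n →L[ℝ] ℝ)) : v ∈ conormalTangent d H z ↔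
    coordDefect n d ((mfderiv (cotModel n) 𝓘(ℝ, Rn n × (Rn n →L[ℝ] ℝ)) (canCoord φ) z :
      (Rn n × (Rn n →L[ℝ] ℝ)) →L[ℝ] Rn n × (Rn n →L[ℝ] ℝ)) v) = 0 := by
  obtain ⟨hψ, hzψ⟩ := sliceChartAt_spec hH hz.1
  set ψ := sliceChartAt (n := n) d H z.1
  obtain ⟨a1, a2⟩ := mem_conormalParam_iff hφ hz hzφ
  obtain ⟨b1, b2⟩ := mem_conormalParam_iff hψ hz hzψ
  rw [← mem_range_mfderiv_conormalParam hφ a1 a2]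
  constructor
  · rintro ⟨u, rfl⟩
    exact exists_mfderiv_conormalParam_eq hψ hφ b1 a1 (b2.trans a2.symm) (by rw [b2]; exact hz.2.1) u
  · rintro ⟨u, rfl⟩
    exact exists_mfderiv_conormalParam_eq hφ hψ a1 b1 (a2.trans b2.symm) (by rw [a2]; exact hz.2.1) u

/-- The geodesic flow, from the coordinates `(x', ξ'')` of the slice chart `φ` on the conormal
bundle to the canonical coordinates of `ψ`. -/
def flowCoord (g : Metric n M) (d : ℕ) (φ ψ : OpenPartialHomeomorph M (Rn n)) (q : ℝ × Rn n) :
    Rn n × (Rn n →L[ℝ] ℝ) :=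
  canCoord ψ (geodesicFlow g q.1 (conormalParam d φ q.2))

/-- The domain of `flowCoord`. -/
def flowDomain (g : Metric n M) (d : ℕ) (φ ψ : OpenPartialHomeomorph M (Rn n)) : Set (ℝ × Rn n) :=
  {q | q.2 ∈ paramDomain d φ ∧ (conormalParam d φ q.2 : Cot n M).2 ≠ 0 ∧
    (geodesicFlow g q.1 (conormalParam d φ q.2)).1 ∈ ψ.source}

/-- The derivative of `flowCoord` in the space variable. -/
def flowCoordDeriv (g : Metric n M) (d : ℕ) (φ ψ : OpenPartialHomeomorph M (Rn n))
    (q : ℝ × Rn n) : Rn n →L[ℝ] Rn n × (Rn n →L[ℝ] ℝ) :=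
  (fderiv ℝ (flowCoord g d φ ψ) q).comp (ContinuousLinearMap.inr ℝ ℝ (Rn n))

variable [T2Space M] [CompactSpace M]

theorem contMDiffAt_flow_conormalParam (hφ : IsSliceChart d H φ) {q : ℝ × Rn n}
    (hq : q.2 ∈ paramDomain d φ) (hq' : (conormalParam d φ q.2 : Cot n M).2 ≠ 0) :
    ContMDiffAt 𝓘(ℝ, ℝ × Rn n) (cotModel n) 1
      (fun q : ℝ × Rn n => geodesicFlow g q.1 (conormalParam d φ q.2)) q := by
  have h1 : ContMDiffAt 𝓘(ℝ, ℝ × Rn n) 𝓘(ℝ, ℝ) 1 (fun q : ℝ × Rn n => q.1) q :=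
    contDiff_fst.contMDiff.contMDiffAt
  have h2 : ContMDiffAt 𝓘(ℝ, ℝ × Rn n) 𝓘(ℝ, Rn n) 1 (fun q : ℝ × Rn n => q.2) q :=
    contDiff_snd.contMDiff.contMDiffAt
  have h3 := ContMDiffAt.comp q ((contMDiffAt_conormalParam hφ hq).of_le (m := 1) (by simp)) h2
  exact ContMDiffAt.comp q (contMDiffAt_geodesicFlow g q.1 hq') (h1.prodMk h3)

theorem isOpen_flowDomain (hφ : IsSliceChart d H φ) : IsOpen (flowDomain g d φ ψ) := by
  rw [isOpen_iff_mem_nhds]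
  rintro q ⟨h1, h2, h3⟩
  have hc := (contMDiffAt_flow_conormalParam (g := g) hφ h1 h2).continuousAt
  have hc2 : ContinuousAt (fun q : ℝ × Rn n => (conormalParam d φ q.2 : Cot n M)) q :=
    ContinuousAt.comp (g := (conormalParam d φ : Rn n → Cot n M)) (f := fun q : ℝ × Rn n => q.2)
      (contMDiffAt_conormalParam hφ h1).continuousAt continuousAt_snd
  filter_upwards [continuousAt_snd (isOpen_paramDomain.mem_nhds h1),
    hc2 (isOpen_nonzero.mem_nhds h2), hc ((isOpen_over ψ).mem_nhds h3)] with q a b c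
  exact ⟨a, b, c⟩

theorem contDiffAt_flowCoord (hφ : IsSliceChart d H φ)
    (hψ : ψ ∈ IsManifold.maximalAtlas 𝓘(ℝ, Rn n) ∞ M) {q : ℝ × Rn n}
    (hq : q ∈ flowDomain g d φ ψ) : ContDiffAt ℝ 1 (flowCoord g d φ ψ) q := by
  have h := ContMDiffAt.comp q ((contMDiffAt_canCoord hψ hq.2.2).of_le (m := 1) (by simp))
    (contMDiffAt_flow_conormalParam (g := g) hφ hq.1 hq.2.1)
  exact h.contDiffAt

theorem hasFDerivAt_flowCoord_right (hφ : IsSliceChart d H φ)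
    (hψ : ψ ∈ IsManifold.maximalAtlas 𝓘(ℝ, Rn n) ∞ M) {t : ℝ} {w : Rn n}
    (hq : (t, w) ∈ flowDomain g d φ ψ) :
    HasFDerivAt (fun v => flowCoord g d φ ψ (t, v)) (flowCoordDeriv g d φ ψ (t, w)) w :=
  ((contDiffAt_flowCoord hφ hψ hq).differentiableAt (by simp)).hasFDerivAt.comp w
    (hasFDerivAt_prodMk_right t w)

theorem continuousAt_flowCoordDeriv (hφ : IsSliceChart d H φ)
    (hψ : ψ ∈ IsManifold.maximalAtlas 𝓘(ℝ, Rn n) ∞ M) {q : ℝ × Rn n}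
    (hq : q ∈ flowDomain g d φ ψ) : ContinuousAt (flowCoordDeriv g d φ ψ) q :=
  ((contDiffAt_flowCoord hφ hψ hq).continuousAt_fderiv (by simp)).clm_comp continuousAt_const

theorem hasDerivAt_flowCoord_left
    (hψ : ψ ∈ IsManifold.maximalAtlas 𝓘(ℝ, Rn n) ∞ M) {t : ℝ} {w : Rn n}
    (hq : (t, w) ∈ flowDomain g d φ ψ) :
    HasDerivAt (fun s => flowCoord g d φ ψ (s, w)) (hamCoord g ψ (flowCoord g d φ ψ (t, w))) t :=
  (isFlowAt_geodesicFlow g hq.2.1 t).hasDerivAt hψ hq.2.2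

end
end ConormalFlow
end

/-! ### The loop condition in coordinates, and composition and inversion of loops. -/

noncomputable section
namespace ConormalFlow
section
variable {n : ℕ} {M : Type*} [TopologicalSpace M] [ChartedSpace (Rn n) M]
variable [IsManifold 𝓘(ℝ, Rn n) ∞ M]
variable {φ ψ χ : OpenPartialHomeomorph M (Rn n)} {g : Metric n M} {H : Set M} {d : ℕ}

instance phaseFiniteDimensional : FiniteDimensional ℝ (Rn n × (Rn n →L[ℝ] ℝ)) :=
  inferInstanceAs (Module.Finite ℝ (Rn n × (Rn n →L[ℝ] ℝ)))

theorem finrank_conormalTangent (hH : IsEmbeddedSubmanifold (n := n) d H)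
    {z : Cot n M} (hz : z ∈ conormal d H) : finrank ℝ (conormalTangent d H z) = n := by
  obtain ⟨hψ, hzψ⟩ := sliceChartAt_spec hH hz.1
  obtain ⟨b1, b2⟩ := mem_conormalParam_iff hψ hz hzψ
  rw [conormalTangent]
  have h := LinearMap.finrank_range_of_inj (f := (mfderiv 𝓘(ℝ, Rn n) (cotModel n)
    (conormalParam d (sliceChartAt d H z.1)) (conormalCoord d (sliceChartAt d H z.1) z) :
      Rn n →L[ℝ] Rn n × (Rn n →L[ℝ] ℝ)).toLinearMap) ?_
  · exact h.trans finrank_euclideanSpace_fin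
  · intro u u' huu
    have h1 := mfderiv_canCoord_conormalParam hψ b1 rfl u
    have h2 := mfderiv_canCoord_conormalParam hψ b1 rfl u'
    have h3 : coordEmb n d u = coordEmb n d u' :=
      h1.symm.trans ((congrArg _ huu).trans h2)
    exact (coordPart_coordEmb (d := d) u).symm.trans
      ((congrArg (coordPart n d) h3).trans (coordPart_coordEmb (d := d) u'))

variable [T2Space M] [CompactSpace M]

theorem mfderiv_flowCoord (hφ : IsSliceChart d H φ)
    (hψ : ψ ∈ IsManifold.maximalAtlas 𝓘(ℝ, Rn n) ∞ M) {t : ℝ} {w : Rn n}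
    (hq : (t, w) ∈ flowDomain g d φ ψ) (u : Rn n) :
    (mfderiv (cotModel n) 𝓘(ℝ, Rn n × (Rn n →L[ℝ] ℝ)) (canCoord ψ)
      (geodesicFlow g t (conormalParam d φ w)) :
      (Rn n × (Rn n →L[ℝ] ℝ)) →L[ℝ] Rn n × (Rn n →L[ℝ] ℝ))
      (flowDeriv g t (conormalParam d φ w)
        (mfderiv 𝓘(ℝ, Rn n) (cotModel n) (conormalParam d φ) w u)) =
      flowCoordDeriv g d φ ψ (t, w) u := by
  have h1 := ((contMDiffAt_conormalParam hφ hq.1).mdifferentiableAt (by simp)).hasMFDerivAt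
  have h2 := ((contMDiffAt_geodesicFlow_right g t hq.2.1).mdifferentiableAt
    (by simp)).hasMFDerivAt
  have h3 := ((contMDiffAt_canCoord hψ hq.2.2).mdifferentiableAt (by simp)).hasMFDerivAt
  have h4 := h3.comp w (h2.comp w h1)
  have h5 := (hasFDerivAt_flowCoord_right hφ hψ hq).hasMFDerivAt
  exact DFunLike.congr_fun (hasMFDerivAt_unique h4 h5) u

/-- The derivative of the flow is injective and both tangent spaces have dimension n, so an
inclusion of the image is already a bijection. -/
theorem mem_loopSet_iff_mapsTo (hH : IsEmbeddedSubmanifold (n := n) d H) {t : ℝ} {z : Cot n M}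
    (hz : z ∈ conormal d H) (hz' : geodesicFlow g t z ∈ conormal d H) :
    z ∈ loopSet g d H t ↔ MapsTo (flowDeriv g t z) (conormalTangent d H z)
      (conormalTangent d H (geodesicFlow g t z)) := by
  refine ⟨fun h => h.2.2.mapsTo, fun h => ⟨hz, hz', h, (flowDeriv_injective g t hz.2.1).injOn, ?_⟩⟩
  have hle : (conormalTangent d H z).map (flowDeriv g t z).toLinearMap ≤
      conormalTangent d H (geodesicFlow g t z) := by
    rintro _ ⟨v, hv, rfl⟩
    exact h hv
  have hfin : FiniteDimensional ℝ (TangentSpace (cotModel n) (geodesicFlow g t z)) :=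
    phaseFiniteDimensional
  have : FiniteDimensional ℝ (conormalTangent d H (geodesicFlow g t z)) :=
    FiniteDimensional.finiteDimensional_submodule _
  have heq := Submodule.eq_of_le_of_finrank_eq hle 
    ((LinearEquiv.finrank_eq (Submodule.equivMapOfInjective _
      (flowDeriv_injective g t hz.2.1) (conormalTangent d H z))).symm.trans
      ((finrank_conormalTangent hH hz).trans (finrank_conormalTangent hH hz').symm))
  intro v hv
  have : v ∈ (conormalTangent d H z).map (flowDeriv g t z).toLinearMap := heq ▸ hv
  exact this

/-- The loop condition in slice charts. -/
theorem mem_loopSet_iff (hH : IsEmbeddedSubmanifold (n := n) d H) (hφ : IsSliceChart d H φ)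
    (hψ : IsSliceChart d H ψ) {t : ℝ} {w : Rn n} (hq : (t, w) ∈ flowDomain g d φ ψ) :
    conormalParam d φ w ∈ loopSet g d H t ↔ coordDefect n d (flowCoord g d φ ψ (t, w)) = 0 ∧
      (coordDefect n d).comp (flowCoordDeriv g d φ ψ (t, w)) = 0 := by
  have hz : conormalParam d φ w ∈ conormal d H := conormalParam_mem_conormal hφ hq.1 hq.2.1
  have hz' : geodesicFlow g t (conormalParam d φ w) ∈ conormal d H ↔
      coordDefect n d (flowCoord g d φ ψ (t, w)) = 0 :=
    (mem_conormal_iff hψ hq.2.2).trans (and_iff_right (geodesicFlow_ne_zero g hq.2.1 t))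
  have hr := conormalParam_mem_source hq.1
  constructor
  · intro h
    refine ⟨hz'.1 h.2.1, ContinuousLinearMap.ext fun u => ?_⟩
    have h1 := (mem_loopSet_iff_mapsTo hH hz h.2.1).1 h
    have h2 := (mem_conormalTangent_iff hH hφ hz hr
      (mfderiv 𝓘(ℝ, Rn n) (cotModel n) (conormalParam d φ) w u)).2 (by
        exact (congrArg _ (mfderiv_canCoord_conormalParam hφ hq.1 rfl u)).trans
          (coordDefect_coordEmb u))
    have h3 := (mem_conormalTangent_iff hH hψ h.2.1 hq.2.2 _).1 (h1 h2)
    exact (congrArg _ (mfderiv_flowCoord hφ hψ.1 hq u)).symm.trans h3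
  · rintro ⟨h1, h2⟩
    rw [mem_loopSet_iff_mapsTo hH hz (hz'.2 h1)]
    intro v hv
    obtain ⟨u, rfl⟩ := (mem_range_mfderiv_conormalParam hφ hq.1 rfl v).2
      ((mem_conormalTangent_iff hH hφ hz hr v).1 hv)
    refine (mem_conormalTangent_iff hH hψ (hz'.2 h1) hq.2.2 _).2 ?_
    exact (congrArg _ (mfderiv_flowCoord hφ hψ.1 hq u)).trans (DFunLike.congr_fun h2 u)

/-- The derivative of the geodesic flow between the coordinates `(x', ξ'')` of slice charts. -/
def flowPartDeriv (g : Metric n M) (d : ℕ) (φ ψ : OpenPartialHomeomorph M (Rn n))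
    (q : ℝ × Rn n) : Rn n →L[ℝ] Rn n :=
  (coordPart n d).comp (flowCoordDeriv g d φ ψ q)

theorem flowCoordDeriv_eq {q : ℝ × Rn n}
    (h : (coordDefect n d).comp (flowCoordDeriv g d φ ψ q) = 0) :
    flowCoordDeriv g d φ ψ q = (coordEmb n d).comp (flowPartDeriv g d φ ψ q) :=
  ContinuousLinearMap.ext fun u => (coordEmb_coordPart (DFunLike.congr_fun h u)).symm

/-- The chain rule for the geodesic flow at a point of `Σ_t`. -/
theorem flowCoordDeriv_add (hφ : IsSliceChart d H φ)
    (hψ : IsSliceChart d H ψ) (hχ : χ ∈ IsManifold.maximalAtlas 𝓘(ℝ, Rn n) ∞ M) {s t : ℝ}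
    {w w' : Rn n} (hq : (t, w) ∈ flowDomain g d φ ψ) (hw' : w' ∈ paramDomain d ψ)
    (h : conormalParam d ψ w' = geodesicFlow g t (conormalParam d φ w))
    (hL : (coordDefect n d).comp (flowCoordDeriv g d φ ψ (t, w)) = 0)
    (hs : (geodesicFlow g (s + t) (conormalParam d φ w)).1 ∈ χ.source) :
    flowCoordDeriv g d φ χ (s + t, w) =
      (flowCoordDeriv g d ψ χ (s, w')).comp (flowPartDeriv g d φ ψ (t, w)) := by
  have hq1 : (s, w') ∈ flowDomain g d ψ χ := ⟨hw', by
    rw [h]; exact geodesicFlow_ne_zero g hq.2.1 t, by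
    simp only
    rw [h, ← geodesicFlow_add]; exact hs⟩
  have hq2 : (s + t, w) ∈ flowDomain g d φ χ := ⟨hq.1, hq.2.1, hs⟩
  have hemb : flowCoord g d φ ψ (t, w) = coordEmb n d w' := by
    rw [← canCoord_conormalParam hψ hw', h]
    rfl
  -- The second flow must be read on a neighbourhood in T*M: for points near w the first flow need
  -- not end in the conormal bundle. Only its linearization at w is tangent to it, and
  -- `flowCoordDeriv_eq` inserts this fact at the end.
  have hK : ContDiffAt ℝ 1 (fun v => canCoord χ (geodesicFlow g s (canPoint ψ v)))
      (coordEmb n d w') := by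
    have h1 := (contMDiffAt_canPoint hψ.1 (w := coordEmb n d w') hw').of_le (m := 1) (by simp)
    have hp : canPoint ψ (coordEmb n d w') = conormalParam d ψ w' := (conormalParam_eq w').symm
    have h2 : ContMDiffAt (cotModel n) (cotModel n) 1 (geodesicFlow g s)
        (canPoint ψ (coordEmb n d w')) :=
      contMDiffAt_geodesicFlow_right g s (by rw [hp]; exact hq1.2.1)
    have h3 : ContMDiffAt (cotModel n) 𝓘(ℝ, Rn n × (Rn n →L[ℝ] ℝ)) 1 (canCoord χ)
        (geodesicFlow g s (canPoint ψ (coordEmb n d w'))) :=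
      (contMDiffAt_canCoord hχ (by rw [hp]; exact hq1.2.2)).of_le (by simp)
    have h4 := ContMDiffAt.comp (coordEmb n d w') h2 h1
    have h5 := ContMDiffAt.comp (coordEmb n d w') (g := canCoord χ) h3 h4
    exact h5.contDiffAt
  have hKd := (hK.differentiableAt (by simp)).hasFDerivAt
  have e1 : flowCoordDeriv g d ψ χ (s, w') =
      (fderiv ℝ (fun v => canCoord χ (geodesicFlow g s (canPoint ψ v))) (coordEmb n d w')).comp
        (coordEmb n d) := by
    refine (hasFDerivAt_flowCoord_right hψ hχ hq1).unique ?_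
    refine (hKd.comp w' (coordEmb n d).hasFDerivAt).congr_of_eventuallyEq
      (Eventually.of_forall fun v => ?_)
    simp only [flowCoord, Function.comp, conormalParam_eq]
  have e2 : flowCoordDeriv g d φ χ (s + t, w) =
      (fderiv ℝ (fun v => canCoord χ (geodesicFlow g s (canPoint ψ v))) (coordEmb n d w')).comp
        (flowCoordDeriv g d φ ψ (t, w)) := by
    refine (hasFDerivAt_flowCoord_right hφ hχ hq2).unique ?_
    rw [← hemb] at hKd ⊢
    refine (hKd.comp w (hasFDerivAt_flowCoord_right hφ hψ.1 hq)).congr_of_eventuallyEq ?_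
    have hev : ∀ᶠ v in 𝓝 w, (t, v) ∈ flowDomain g d φ ψ :=
      (Continuous.prodMk_right t).continuousAt.preimage_mem_nhds
        ((isOpen_flowDomain hφ).mem_nhds hq)
    filter_upwards [hev] with v hv
    simp only [flowCoord, Function.comp]
    rw [canPoint_canCoord hψ.1 hv.2.2, geodesicFlow_add]
  rw [e2, e1, flowCoordDeriv_eq hL]
  rfl

theorem flowCoordDeriv_zero (hφ : IsSliceChart d H φ) {w : Rn n}
    (hw : (0, w) ∈ flowDomain g d φ φ) : flowCoordDeriv g d φ φ (0, w) = coordEmb n d := by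
  refine (hasFDerivAt_flowCoord_right hφ hφ.1 hw).unique ?_
  refine (coordEmb n d).hasFDerivAt.congr_of_eventuallyEq ?_
  filter_upwards [isOpen_paramDomain.mem_nhds hw.1] with v hv
  simp only [flowCoord, geodesicFlow_zero]
  exact canCoord_conormalParam hφ hv

theorem flowPartDeriv_zero (hφ : IsSliceChart d H φ) {w : Rn n}
    (hw : (0, w) ∈ flowDomain g d φ φ) :
    flowPartDeriv g d φ φ (0, w) = ContinuousLinearMap.id ℝ (Rn n) := by
  rw [flowPartDeriv, flowCoordDeriv_zero hφ hw]
  exact ContinuousLinearMap.ext fun v => coordPart_coordEmb v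

theorem mem_loopSet_zero (hH : IsEmbeddedSubmanifold (n := n) d H) {z : Cot n M}
    (hz : z ∈ conormal d H) : z ∈ loopSet g d H 0 := by
  obtain ⟨hφ, hzφ⟩ := sliceChartAt_spec hH hz.1
  obtain ⟨b1, b2⟩ := mem_conormalParam_iff hφ hz hzφ
  set φ := sliceChartAt (n := n) d H z.1
  have hq : (0, conormalCoord d φ z) ∈ flowDomain g d φ φ :=
    ⟨b1, by rw [b2]; exact hz.2.1, by simp only [geodesicFlow_zero]; rwa [b2]⟩
  have h := (mem_loopSet_iff hH hφ hφ hq).2 ⟨by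
    simp only [flowCoord, geodesicFlow_zero]
    rw [canCoord_conormalParam hφ b1, coordDefect_coordEmb], by
    rw [flowCoordDeriv_zero hφ hq]
    exact ContinuousLinearMap.ext fun v => coordDefect_coordEmb v⟩
  rwa [b2] at h

theorem exists_flow_charts (hH : IsEmbeddedSubmanifold (n := n) d H) {t : ℝ} {z : Cot n M}
    (hz : z ∈ conormal d H) (hz' : geodesicFlow g t z ∈ conormal d H) :
    ∃ φ ψ : OpenPartialHomeomorph M (Rn n), IsSliceChart d H φ ∧ IsSliceChart d H ψ ∧
      ∃ w w' : Rn n, conormalParam d φ w = z ∧ (t, w) ∈ flowDomain g d φ ψ ∧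
        w' ∈ paramDomain d ψ ∧ conormalParam d ψ w' = geodesicFlow g t z := by
  obtain ⟨hφ, hzφ⟩ := sliceChartAt_spec hH hz.1
  obtain ⟨a1, a2⟩ := mem_conormalParam_iff hφ hz hzφ
  obtain ⟨hψ, hzψ⟩ := sliceChartAt_spec hH hz'.1
  obtain ⟨b1, b2⟩ := mem_conormalParam_iff hψ hz' hzψ
  refine ⟨_, _, hφ, hψ, _, _, a2, ⟨a1, ?_, ?_⟩, b1, b2⟩
  · rw [a2]; exact hz.2.1
  · simp only
    rw [a2]; exact hzψ

/-- By the chain rule the defect of the composite derivative factors through the vanishing defect of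
the second one. -/
theorem mem_loopSet_add (hH : IsEmbeddedSubmanifold (n := n) d H) {s t : ℝ} {z : Cot n M}
    (hz : z ∈ loopSet g d H t) (hz' : geodesicFlow g t z ∈ loopSet g d H s) :
    z ∈ loopSet g d H (s + t) := by
  refine ⟨hz.1, ?_, ?_⟩
  · rw [geodesicFlow_add]; exact hz'.2.1
  have h : geodesicFlow g (s + t) z ∈ conormal d H := by
    rw [geodesicFlow_add]; exact hz'.2.1
  refine ((mem_loopSet_iff_mapsTo hH hz.1 h).2 ?_).2.2
  obtain ⟨φ, ψ, hφ, hψ, w, w', rfl, hq, hw', e⟩ := exists_flow_charts hH hz.1 hz.2.1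
  obtain ⟨hχ, hzχ⟩ := sliceChartAt_spec hH h.1
  set χ := sliceChartAt (n := n) d H (geodesicFlow g (s + t) (conormalParam d φ w)).1
  have hL := ((mem_loopSet_iff hH hφ hψ hq).1 hz).2
  have hadd := flowCoordDeriv_add hφ hψ hχ.1 hq hw' e hL hzχ
  have hq1 : (s, w') ∈ flowDomain g d ψ χ := ⟨hw', by
    rw [e]; exact hz'.1.2.1, by
    simp only
    rw [e, ← geodesicFlow_add]; exact hzχ⟩
  have h1 := (mem_loopSet_iff hH hψ hχ hq1).1 (by rwa [e])
  refine (mem_loopSet_iff_mapsTo hH hz.1 h).1 ((mem_loopSet_iff hH hφ hχ (t := s + t)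
    ⟨hq.1, hq.2.1, hzχ⟩).2 ⟨((mem_conormal_iff hχ hzχ).1 h).2, ?_⟩)
  rw [hadd, ← ContinuousLinearMap.comp_assoc, h1.2, ContinuousLinearMap.zero_comp]

/-- The derivative of the flow on the conormal bundle is invertible at the points of `Σ_t`. -/
theorem flowPartDeriv_neg_comp (hφ : IsSliceChart d H φ)
    (hψ : IsSliceChart d H ψ) {t : ℝ} {w w' : Rn n} (hq : (t, w) ∈ flowDomain g d φ ψ)
    (hw' : w' ∈ paramDomain d ψ)
    (h : conormalParam d ψ w' = geodesicFlow g t (conormalParam d φ w))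
    (hL : (coordDefect n d).comp (flowCoordDeriv g d φ ψ (t, w)) = 0) :
    (flowPartDeriv g d ψ φ (-t, w')).comp (flowPartDeriv g d φ ψ (t, w)) =
      ContinuousLinearMap.id ℝ (Rn n) := by
  have hs : (geodesicFlow g (-t + t) (conormalParam d φ w)).1 ∈ φ.source := by
    rw [neg_add_cancel, geodesicFlow_zero]
    exact conormalParam_mem_source hq.1
  have h1 := flowCoordDeriv_add hφ hψ hφ.1 hq hw' h hL hs
  rw [neg_add_cancel] at h1 hs
  rw [← flowPartDeriv_zero hφ (g := g) ⟨hq.1, hq.2.1, hs⟩, flowPartDeriv, flowPartDeriv,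
    flowPartDeriv, h1]
  rfl

theorem det_flowPartDeriv_ne_zero (hφ : IsSliceChart d H φ)
    (hψ : IsSliceChart d H ψ) {t : ℝ} {w w' : Rn n} (hq : (t, w) ∈ flowDomain g d φ ψ)
    (hw' : w' ∈ paramDomain d ψ)
    (h : conormalParam d ψ w' = geodesicFlow g t (conormalParam d φ w))
    (hL : (coordDefect n d).comp (flowCoordDeriv g d φ ψ (t, w)) = 0) :
    (flowPartDeriv g d φ ψ (t, w)).det ≠ 0 := by
  intro h0
  have h1 := congrArg ContinuousLinearMap.det (flowPartDeriv_neg_comp hφ hψ hq hw' h hL)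
  have h2 : ((flowPartDeriv g d ψ φ (-t, w')).comp (flowPartDeriv g d φ ψ (t, w))).det =
      (flowPartDeriv g d ψ φ (-t, w')).det * (flowPartDeriv g d φ ψ (t, w)).det :=
    LinearMap.det_comp _ _
  rw [h2, h0, mul_zero] at h1
  have h3 : (ContinuousLinearMap.id ℝ (Rn n)).det = 1 := LinearMap.det_id
  rw [h3] at h1
  exact zero_ne_one h1

/-- The invertible derivative at time t is cancelled from the composite derivative. This is what
turns the time left after a return into a loop time of the returned point. -/
theorem mem_loopSet_of_add (hH : IsEmbeddedSubmanifold (n := n) d H) {s t : ℝ} {z : Cot n M}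
    (hz : z ∈ loopSet g d H t) (hz' : z ∈ loopSet g d H (s + t)) :
    geodesicFlow g t z ∈ loopSet g d H s := by
  obtain ⟨φ, ψ, hφ, hψ, w, w', rfl, hq, hw', e⟩ := exists_flow_charts hH hz.1 hz.2.1
  obtain ⟨hχ, hzχ⟩ := sliceChartAt_spec hH hz'.2.1.1
  set χ := sliceChartAt (n := n) d H (geodesicFlow g (s + t) (conormalParam d φ w)).1
  have hL := ((mem_loopSet_iff hH hφ hψ hq).1 hz).2
  have hadd := flowCoordDeriv_add hφ hψ hχ.1 hq hw' e hL hzχ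
  have hq1 : (s, w') ∈ flowDomain g d ψ χ := ⟨hw', by
    rw [e]; exact hz.2.1.2.1, by
    simp only
    rw [e, ← geodesicFlow_add]; exact hzχ⟩
  rw [← e]
  refine (mem_loopSet_iff hH hψ hχ hq1).2 ⟨?_, ?_⟩
  · have := ((mem_conormal_iff hχ hzχ).1 hz'.2.1).2
    rw [geodesicFlow_add, ← e] at this
    exact this
  · have h1 := ((mem_loopSet_iff hH hφ hχ (t := s + t) ⟨hq.1, hq.2.1, hzχ⟩).1 hz').2
    rw [hadd] at h1
    have hinj : Function.Injective (flowPartDeriv g d φ ψ (t, w)).toLinearMap :=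
      Function.LeftInverse.injective (g := flowPartDeriv g d ψ φ (-t, w'))
        fun v => DFunLike.congr_fun (flowPartDeriv_neg_comp hφ hψ hq hw' e hL) v
    have hsurj := LinearMap.injective_iff_surjective.1 hinj
    refine ContinuousLinearMap.ext fun u => ?_
    obtain ⟨v, rfl⟩ := hsurj u
    exact DFunLike.congr_fun h1 v

theorem neg_mem_loopSet (hH : IsEmbeddedSubmanifold (n := n) d H) {t : ℝ} {z : Cot n M}
    (hz : z ∈ loopSet g d H t) : geodesicFlow g t z ∈ loopSet g d H (-t) :=
  mem_loopSet_of_add hH hz (by rw [neg_add_cancel]; exact mem_loopSet_zero hH hz.1)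

end
end ConormalFlow
end

/-- The determinant of a restricted product, if the left lower block of the second factor
vanishes. -/
theorem Matrix.toSquareBlockProp_mul_of_lower_eq_zero {ι R : Type*} [Fintype ι] [CommRing R]
    (p : ι → Prop) [DecidablePred p] (A B : Matrix ι ι R)
    (hB : ∀ i, ¬ p i → ∀ j, p j → B i j = 0) :
    (A * B).toSquareBlockProp p = A.toSquareBlockProp p * B.toSquareBlockProp p := by
  ext i j
  simp only [Matrix.toSquareBlockProp_def, Matrix.of_apply, Matrix.mul_apply]
  rw [← Fintype.sum_subtype_add_sum_subtype p fun k => A i k * B k j]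
  rw [add_eq_left]
  exact Finset.sum_eq_zero fun k _ => by rw [hB k k.2 j j.2, mul_zero]

theorem Matrix.toSquareBlockProp_mul_of_lower_eq_zero' {ι R : Type*} [Fintype ι] [CommRing R]
    (p : ι → Prop) [DecidablePred p] (A B : Matrix ι ι R)
    (hA : ∀ i, p i → ∀ j, ¬ p j → A i j = 0) :
    (A * B).toSquareBlockProp p = A.toSquareBlockProp p * B.toSquareBlockProp p := by
  ext i j
  simp only [Matrix.toSquareBlockProp_def, Matrix.of_apply, Matrix.mul_apply]
  rw [← Fintype.sum_subtype_add_sum_subtype p fun k => A i k * B k j]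
  rw [add_eq_left]
  exact Finset.sum_eq_zero fun k _ => by rw [hA i i.2 k k.2, zero_mul]

/-! ### The natural density of the conormal bundle does not depend on the slice chart. -/

noncomputable section
namespace ConormalFlow
section
variable {n : ℕ} {M : Type*} [TopologicalSpace M] [ChartedSpace (Rn n) M]
variable [IsManifold 𝓘(ℝ, Rn n) ∞ M]
variable {φ ψ χ : OpenPartialHomeomorph M (Rn n)} {g : Metric n M} {H : Set M} {d : ℕ}

theorem conormalDensity_eq_div (g : Metric n M) (w : Rn n) : conormalDensity g d φ w =
    ((metricMatrix g φ (φ.symm (basePart d w))).toSquareBlockProp fun i => (i : ℕ) < d).det /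
      √(metricMatrix g φ (φ.symm (basePart d w))).det := rfl

theorem conormalDensity_pos (g : Metric n M) (hφ : φ ∈ IsManifold.maximalAtlas 𝓘(ℝ, Rn n) ∞ M)
    {w : Rn n} (hw : w ∈ paramDomain d φ) : 0 < conormalDensity g d φ w := by
  have h := metricMatrix_posDef g hφ (φ.map_target hw)
  refine div_pos ?_ (Real.sqrt_pos.2 h.det_pos)
  exact (h.submatrix Subtype.val_injective).det_pos

theorem continuousOn_conormalDensity (g : Metric n M)
    (hφ : φ ∈ IsManifold.maximalAtlas 𝓘(ℝ, Rn n) ∞ M) :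
    ContinuousOn (conormalDensity g d φ) (paramDomain d φ) := by
  intro w hw
  refine ContinuousAt.continuousWithinAt ?_
  have hG : ∀ i j, ContinuousAt
      (fun w : Rn n => metricMatrix g φ (φ.symm (basePart d w)) i j) w := by
    intro i j
    have h1 : ContinuousAt (fun w : Rn n => φ.symm (basePart d w)) w :=
      ContinuousAt.comp (g := φ.symm) (f := basePart d) (φ.symm.continuousAt hw)
        continuous_basePart.continuousAt
    exact ContinuousAt.comp (g := fun x => metricMatrix g φ x i j)
      (contMDiffAt_metricMatrix g hφ (φ.map_target hw) i j).continuousAt h1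
  have hM : ContinuousAt (fun w : Rn n => metricMatrix g φ (φ.symm (basePart d w))) w :=
    continuousAt_pi.2 fun i => continuousAt_pi.2 fun j => hG i j
  have hdet : ContinuousAt
      (fun w : Rn n => (metricMatrix g φ (φ.symm (basePart d w))).det) w :=
    (continuous_id.matrix_det).continuousAt.comp hM
  have hdet' : ContinuousAt (fun w : Rn n => ((metricMatrix g φ (φ.symm (basePart d w))).submatrix
      (Subtype.val : {i : Fin n // (i : ℕ) < d} → Fin n) Subtype.val).det) w :=
    ((continuous_id.matrix_submatrix _ _).matrix_det).continuousAt.comp hM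
  exact hdet'.div hdet.sqrt
    (Real.sqrt_pos.2 (metricMatrix_posDef g hφ (φ.map_target hw)).det_pos).ne'

variable [T2Space M] [CompactSpace M]

/-- At time 0 the flow between two charts is just the change of coordinates, so the transformation
of densities becomes a special case of statements about the flow. -/
theorem flowCoordDeriv_zero_eq (hφ : IsSliceChart d H φ) (hψ : IsSliceChart d H ψ) {w : Rn n}
    (hq : (0, w) ∈ flowDomain g d φ ψ) :
    flowCoordDeriv g d φ ψ (0, w) =
      (fderiv ℝ (canTransition φ ψ) (coordEmb n d w)).comp (coordEmb n d) := by
  have hs : φ.symm (coordEmb n d w).1 ∈ ψ.source := by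
    have := hq.2.2
    simp only [geodesicFlow_zero] at this
    exact this
  refine (hasFDerivAt_flowCoord_right hφ hψ.1 hq).unique ?_
  have h1 := ((canTransition_contDiffAt hφ.1 hψ.1 (w := coordEmb n d w) hq.1
    hs).differentiableAt (by simp)).hasFDerivAt
  refine (h1.comp w (coordEmb n d).hasFDerivAt).congr_of_eventuallyEq ?_
  have hev : ∀ᶠ v in 𝓝 w, ((0 : ℝ), v) ∈ flowDomain g d φ ψ :=
    (Continuous.prodMk_right (0 : ℝ)).continuousAt.preimage_mem_nhds
      ((isOpen_flowDomain hφ).mem_nhds hq)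
  filter_upwards [hev] with v hv
  have hs : φ.symm (coordEmb n d v).1 ∈ ψ.source := by
    have := hv.2.2
    simp only [geodesicFlow_zero] at this
    exact this
  simp only [flowCoord, geodesicFlow_zero, Function.comp]
  rw [conormalParam_eq, canCoord_canPoint_eq hφ.1 hψ.1 (w := coordEmb n d v) hv.1 hs]

/-- In the coordinates (x', ξ'') the change of charts is block triangular, because ξ'' has no
influence on y'. The diagonal blocks are the tangential block of the frame change and, on covectors,
the transposed normal block of the inverse frame change. -/
theorem det_flowPartDeriv_zero (hφ : IsSliceChart d H φ) (hψ : IsSliceChart d H ψ) {w : Rn n}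
    (hq : (0, w) ∈ flowDomain g d φ ψ) {x : M} (hx : φ.symm (basePart d w) = x) :
    (flowPartDeriv g d φ ψ (0, w)).det =
      ((frameMatrix ψ φ x).toSquareBlockProp fun i => (i : ℕ) < d).det *
      ((frameMatrix φ ψ x).toSquareBlockProp fun i => ¬ (i : ℕ) < d).det := by
  have hs : φ.symm (coordEmb n d w).1 ∈ ψ.source := by
    have := hq.2.2
    simp only [geodesicFlow_zero] at this
    exact this
  have hxφ : x ∈ φ.source := hx ▸ φ.map_target hq.1
  have hxψ : x ∈ ψ.source := hx ▸ hs
  have hφx : φ x = basePart d w := hx ▸ φ.right_inv hq.1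
  have hT : fderiv ℝ (ψ ∘ φ.symm) (basePart d w) = (chartDeriv ψ x).comp (chartDeriv φ x).inverse := by
    rw [chartDeriv_comp_inverse_eq_fderiv hψ.1 hφ.1 hxψ hxφ, hφx]
  have hS : fderiv ℝ (φ ∘ ψ.symm) (ψ x) = (chartDeriv φ x).comp (chartDeriv ψ x).inverse :=
    (chartDeriv_comp_inverse_eq_fderiv hφ.1 hψ.1 hxφ hxψ).symm
  have hentry : ∀ u : Rn n, flowPartDeriv g d φ ψ (0, w) u =
      coordPart n d (fderiv ℝ (canTransition φ ψ) (coordEmb n d w) (coordEmb n d u)) := fun u => by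
    rw [flowPartDeriv, flowCoordDeriv_zero_eq hφ hψ hq]
    rfl
  set b := (EuclideanSpace.basisFun (Fin n) ℝ).toBasis with hb
  have hM : ∀ i j : Fin n, LinearMap.toMatrix b b (flowPartDeriv g d φ ψ (0, w)).toLinearMap i j =
      (flowPartDeriv g d φ ψ (0, w) (EuclideanSpace.single j (1 : ℝ))) i := by
    intro i j
    rw [LinearMap.toMatrix_apply]
    simp [hb]
  have hdet : (flowPartDeriv g d φ ψ (0, w)).det =
      (LinearMap.toMatrix b b (flowPartDeriv g d φ ψ (0, w)).toLinearMap).det :=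
    (LinearMap.det_toMatrix b _).symm
  have hbase1 : ∀ j : Fin n, (j : ℕ) < d →
      basePart d (EuclideanSpace.single j (1 : ℝ)) = EuclideanSpace.single j (1 : ℝ) := by
    intro j hj
    ext i
    by_cases hij : i = j
    · subst hij; simp [basePart, hj]
    · simp [basePart, hij]
  have hbase2 : ∀ j : Fin n, ¬ (j : ℕ) < d →
      basePart d (EuclideanSpace.single j (1 : ℝ)) = 0 := by
    intro j hj
    ext i
    by_cases hij : i = j
    · subst hij; simp [basePart, hj]
    · simp [basePart, hij]
  have hcov : ∀ j : Fin n, ¬ (j : ℕ) < d →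
      (coordEmb n d (EuclideanSpace.single j (1 : ℝ))).2 = EuclideanSpace.proj j := by
    intro j hj
    rw [covector_eq_sum_proj (coordEmb n d (EuclideanSpace.single j (1 : ℝ))).2,
      Finset.sum_eq_single j]
    · rw [coordEmb_snd_single]; simp [hj]
    · intro i _ hij
      rw [coordEmb_snd_single]
      simp [hij]
    · simp
  have hxe : φ.symm (coordEmb n d w).1 = x := hx
  have hderiv := hasFDerivAt_canTransition hφ.1 hψ.1 (w := coordEmb n d w) hq.1 hs
  rw [hxe] at hderiv
  rw [hdet, Matrix.twoBlockTriangular_det' _ fun i : Fin n => (i : ℕ) < d,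
    ← Matrix.det_transpose ((frameMatrix φ ψ x).toSquareBlockProp fun i => ¬ (i : ℕ) < d)]
  · congr 2
    · ext i j
      rw [Matrix.toSquareBlockProp_def, Matrix.of_apply, hM, hentry, coordPart_apply, if_pos i.2,
        hderiv, coordEmb_fst, coordEmb_fst, hbase1 j j.2, hT]
      rfl
    · ext i j
      rw [Matrix.transpose_apply, Matrix.toSquareBlockProp_def, Matrix.of_apply, hM, hentry,
        coordPart_apply, if_neg i.2, hderiv, coordEmb_fst (EuclideanSpace.single _ _),
        hbase2 j j.2, hcov j j.2, hS]
      simp only [map_zero, ContinuousLinearMap.comp_zero, add_zero]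
      rfl
  · intro i hi j hj
    rw [hM, hentry, coordPart_apply, if_pos hi, hderiv, coordEmb_fst (EuclideanSpace.single _ _),
      hbase2 j hj]
    simp

/-- Let b₁ and b₂ be the determinants of the diagonal blocks of B. Passing from φ to ψ multiplies
|g_H| by b₁² and |g|^{1/2} by |b₁ b₂|, while |dx' dξ''| is stretched by |b₂| / |b₁|; the product is
invariant. -/
theorem conormalDensity_transform (hφ : IsSliceChart d H φ) (hψ : IsSliceChart d H ψ) {w w' : Rn n}
    (hq : (0, w) ∈ flowDomain g d φ ψ) (hw' : w' ∈ paramDomain d ψ)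
    (h : (conormalParam d ψ w' : Cot n M) = conormalParam d φ w) :
    conormalDensity g d φ w = |(flowPartDeriv g d φ ψ (0, w)).det| * conormalDensity g d ψ w' := by
  set x := φ.symm (basePart d w) with hx
  have hx' : ψ.symm (basePart d w') = x := congrArg (fun z : Cot n M => z.1) h
  have hxφ : x ∈ φ.source := φ.map_target hq.1
  have hxψ : x ∈ ψ.source := hx' ▸ ψ.map_target hw'
  have hxH : x ∈ H := conormalParam_fst_mem hφ hq.1
  rw [det_flowPartDeriv_zero hφ hψ hq hx.symm, conormalDensity_eq_div, conormalDensity_eq_div, hx',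
    ← hx]
  have hB : ∀ i : Fin n, ¬ (i : ℕ) < d → ∀ j : Fin n, (j : ℕ) < d → frameMatrix φ ψ x i j = 0 :=
    fun i hi j hj => hφ.frameMatrix_eq_zero hψ hxφ hxψ hxH (not_lt.1 hi) hj
  have hTB := frameMatrix_mul_self hψ.1 hφ.1 hxψ hxφ
  have hT11 := Matrix.toSquareBlockProp_mul_of_lower_eq_zero (fun i : Fin n => (i : ℕ) < d)
    (frameMatrix ψ φ x) _ hB
  have hG11 := Matrix.toSquareBlockProp_mul_of_lower_eq_zero (fun i : Fin n => (i : ℕ) < d)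
    ((frameMatrix φ ψ x).transpose * metricMatrix g φ x) _ hB
  rw [← metricMatrix_transform g hφ.1 hxφ ψ, Matrix.toSquareBlockProp_mul_of_lower_eq_zero'
    (fun i : Fin n => (i : ℕ) < d) (frameMatrix φ ψ x).transpose _
    (fun i hi j hj => hB j hj i hi)] at hG11
  have hGdet := congrArg Matrix.det (metricMatrix_transform g hφ.1 hxφ ψ)
  have hBdet := Matrix.twoBlockTriangular_det (frameMatrix φ ψ x) _ hB
  have hG11det := congrArg Matrix.det hG11
  rw [hTB] at hT11
  have hone : (1 : Matrix (Fin n) (Fin n) ℝ).toSquareBlockProp (fun i : Fin n => (i : ℕ) < d) = 1 :=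
    Matrix.submatrix_one _ Subtype.val_injective
  have hT11det := congrArg Matrix.det (hone.symm.trans hT11)
  have htr : ((frameMatrix φ ψ x).transpose.toSquareBlockProp fun i : Fin n => (i : ℕ) < d).det =
      ((frameMatrix φ ψ x).toSquareBlockProp fun i : Fin n => (i : ℕ) < d).det := by
    rw [← Matrix.det_transpose]
    rfl
  simp only [Matrix.det_mul, Matrix.det_transpose, Matrix.det_one] at hGdet hG11det hT11det
  rw [htr] at hG11det
  rw [hG11det, hGdet, hBdet, abs_mul]
  have hgpos := (metricMatrix_posDef g hφ.1 hxφ).det_pos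
  set b1 := ((frameMatrix φ ψ x).toSquareBlockProp fun i : Fin n => (i : ℕ) < d).det
  set b2 := ((frameMatrix φ ψ x).toSquareBlockProp fun i : Fin n => ¬ (i : ℕ) < d).det
  set t1 := ((frameMatrix ψ φ x).toSquareBlockProp fun i : Fin n => (i : ℕ) < d).det
  set γ := (metricMatrix g φ x).det
  have hb12 : b1 * b2 ≠ 0 := by
    rw [← hBdet]
    exact (isUnit_det_frameMatrix hφ.1 hψ.1 hxφ hxψ).ne_zero
  have hb1 : b1 ≠ 0 := left_ne_zero_of_mul hb12
  have hb2 : b2 ≠ 0 := right_ne_zero_of_mul hb12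
  have hsq : √(b1 * b2 * γ * (b1 * b2)) = |b1| * |b2| * √γ := by
    rw [show b1 * b2 * γ * (b1 * b2) = (b1 * b2) ^ 2 * γ by ring, Real.sqrt_mul (sq_nonneg _),
      Real.sqrt_sq_eq_abs, abs_mul]
  have ht1 : |t1| = |b1|⁻¹ := by
    rw [eq_inv_of_mul_eq_one_left hT11det.symm, abs_inv]
  rw [hsq, ht1]
  have h1 := abs_pos.2 hb1
  have h2 := abs_pos.2 hb2
  have h3 := Real.sqrt_pos.2 hgpos
  have h4 : b1 * b1 = |b1| * |b1| := (abs_mul_abs_self b1).symm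
  field_simp
  rw [sq_abs]

end
end ConormalFlow
end

/-! ### The Jacobian J_t: independence of charts, cocycle property, continuity, homogeneity. -/

noncomputable section
namespace ConormalFlow
section
variable {n : ℕ} {M : Type*} [TopologicalSpace M] [ChartedSpace (Rn n) M]
variable [IsManifold 𝓘(ℝ, Rn n) ∞ M]
variable {φ ψ χ : OpenPartialHomeomorph M (Rn n)} {g : Metric n M} {H : Set M} {d : ℕ}
variable [T2Space M] [CompactSpace M]

theorem det_comp_rn (A B : Rn n →L[ℝ] Rn n) : (A.comp B).det = A.det * B.det :=
  LinearMap.det_comp _ _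

theorem det_flowPartDeriv_add (hφ : IsSliceChart d H φ)
    (hψ : IsSliceChart d H ψ) (hχ : χ ∈ IsManifold.maximalAtlas 𝓘(ℝ, Rn n) ∞ M) {s t : ℝ}
    {w w' : Rn n} (hq : (t, w) ∈ flowDomain g d φ ψ) (hw' : w' ∈ paramDomain d ψ)
    (h : conormalParam d ψ w' = geodesicFlow g t (conormalParam d φ w))
    (hL : (coordDefect n d).comp (flowCoordDeriv g d φ ψ (t, w)) = 0)
    (hs : (geodesicFlow g (s + t) (conormalParam d φ w)).1 ∈ χ.source) :
    (flowPartDeriv g d φ χ (s + t, w)).det =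
      (flowPartDeriv g d ψ χ (s, w')).det * (flowPartDeriv g d φ ψ (t, w)).det := by
  rw [← det_comp_rn, flowPartDeriv, flowCoordDeriv_add hφ hψ hχ hq hw' h hL hs]
  rfl

theorem jacobian_eq_sliceChartAt (hH : IsEmbeddedSubmanifold (n := n) d H) {t : ℝ} {z : Cot n M}
    (hz : z ∈ loopSet g d H t) : ∃ φ ψ : OpenPartialHomeomorph M (Rn n), IsSliceChart d H φ ∧
      IsSliceChart d H ψ ∧
      ∃ w w' : Rn n, conormalParam d φ w = z ∧ (t, w) ∈ flowDomain g d φ ψ ∧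
        w' ∈ paramDomain d ψ ∧ conormalParam d ψ w' = geodesicFlow g t z ∧
        jacobian g d H t z = |(flowPartDeriv g d φ ψ (t, w)).det| * conormalDensity g d ψ w' /
          conormalDensity g d φ w := by
  obtain ⟨hφ, hzφ⟩ := sliceChartAt_spec hH hz.1.1
  obtain ⟨a1, a2⟩ := mem_conormalParam_iff hφ hz.1 hzφ
  obtain ⟨hψ, hzψ⟩ := sliceChartAt_spec hH hz.2.1.1
  obtain ⟨b1, b2⟩ := mem_conormalParam_iff hψ hz.2.1 hzψ
  have hq : (t, conormalCoord d (sliceChartAt d H z.1) z) ∈ flowDomain g d (sliceChartAt d H z.1)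
      (sliceChartAt d H (geodesicFlow g t z).1) := by
    refine ⟨a1, ?_, ?_⟩
    · rw [a2]; exact hz.1.2.1
    · simp only
      rw [a2]; exact hzψ
  refine ⟨_, _, hφ, hψ, _, _, a2, hq, b1, b2, ?_⟩
  have h1 : fderiv ℝ (conormalCoord d (sliceChartAt d H (geodesicFlow g t z).1) ∘ geodesicFlow g t ∘
      conormalParam d (sliceChartAt d H z.1)) (conormalCoord d (sliceChartAt d H z.1) z) =
      flowPartDeriv g d (sliceChartAt d H z.1) (sliceChartAt d H (geodesicFlow g t z).1)
        (t, conormalCoord d (sliceChartAt d H z.1) z) :=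
    ((coordPart n d).hasFDerivAt.comp _ (hasFDerivAt_flowCoord_right hφ hψ.1 hq)).fderiv
  simp only [jacobian]
  rw [h1]

/-- The Jacobian can be computed in arbitrary slice charts. -/
theorem jacobian_eq (hH : IsEmbeddedSubmanifold (n := n) d H) (hφ : IsSliceChart d H φ)
    (hψ : IsSliceChart d H ψ) {t : ℝ} {w w' : Rn n} (hq : (t, w) ∈ flowDomain g d φ ψ)
    (hw' : w' ∈ paramDomain d ψ)
    (h : conormalParam d ψ w' = geodesicFlow g t (conormalParam d φ w))
    (hz : conormalParam d φ w ∈ loopSet g d H t) :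
    jacobian g d H t (conormalParam d φ w) = |(flowPartDeriv g d φ ψ (t, w)).det| *
      conormalDensity g d ψ w' / conormalDensity g d φ w := by
  obtain ⟨φ₀, ψ₀, hφ₀, hψ₀, w₀, w₀', e, hq₀, hw₀', h₀, hJ⟩ := jacobian_eq_sliceChartAt hH hz
  have hz0 : (conormalParam d φ w : Cot n M).2 ≠ 0 := hz.1.2.1
  have hqa : (0, w) ∈ flowDomain g d φ φ₀ := ⟨hq.1, hq.2.1, by
    simp only [geodesicFlow_zero]
    rw [← e]; exact conormalParam_mem_source hq₀.1⟩
  have ea : conormalParam d φ₀ w₀ = geodesicFlow g 0 (conormalParam d φ w) := by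
    rw [geodesicFlow_zero, e]
  have hLa := ((mem_loopSet_iff hH hφ hφ₀ hqa).1 (mem_loopSet_zero hH hz.1)).2
  have hLb := ((mem_loopSet_iff hH hφ₀ hψ₀ hq₀).1 (by rwa [e])).2
  -- The flow from φ₀ to ψ is compared in two ways: `d1` precedes it by the change from φ to φ₀ at
  -- time 0, and `d2` factors it through ψ₀ with a change to ψ at time 0. The two transformation
  -- laws of the density absorb the extra determinants.
  have d1 := det_flowPartDeriv_add (s := t) hφ hφ₀ hψ.1 hqa hq₀.1 ea hLa
    (by rw [add_zero]; exact hq.2.2)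
  have d2 := det_flowPartDeriv_add (s := 0) hφ₀ hψ₀ hψ.1 hq₀ hw₀' (by rw [h₀, e]) hLb
    (by rw [zero_add, e]; exact hq.2.2)
  rw [add_zero] at d1
  rw [zero_add] at d2
  have hqb : (0, w₀') ∈ flowDomain g d ψ₀ ψ := ⟨hw₀', by
    rw [h₀]; exact geodesicFlow_ne_zero g hz0 t, by
    simp only [geodesicFlow_zero]
    rw [h₀]; exact hq.2.2⟩
  have t1 := conormalDensity_transform hφ hφ₀ hqa hq₀.1 e
  have t2 := conormalDensity_transform hψ₀ hψ hqb hw' (by rw [h, h₀])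
  have p1 := conormalDensity_pos g hφ.1 hq.1
  have p2 := conormalDensity_pos g hφ₀.1 hq₀.1
  rw [t1] at p1
  have p3 : 0 < |(flowPartDeriv g d φ φ₀ (0, w)).det| := pos_of_mul_pos_left p1 p2.le
  rw [hJ, t1, t2, d1, d2, abs_mul, abs_mul]
  field_simp

theorem jacobian_pos (hH : IsEmbeddedSubmanifold (n := n) d H) {t : ℝ} {z : Cot n M}
    (hz : z ∈ loopSet g d H t) : 0 < jacobian g d H t z := by
  obtain ⟨φ, ψ, hφ, hψ, w, w', rfl, hq, hw', e, hJ⟩ := jacobian_eq_sliceChartAt hH hz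
  rw [hJ]
  have hL := ((mem_loopSet_iff hH hφ hψ hq).1 hz).2
  exact div_pos (mul_pos (abs_pos.2 (det_flowPartDeriv_ne_zero hφ hψ hq hw' e hL))
    (conormalDensity_pos g hψ.1 hw')) (conormalDensity_pos g hφ.1 hq.1)

/-- The determinants multiply by the chain rule, and the density at the intermediate point cancels.
-/
theorem jacobian_add (hH : IsEmbeddedSubmanifold (n := n) d H) {s t : ℝ} {z : Cot n M}
    (hz : z ∈ loopSet g d H t) (hz' : geodesicFlow g t z ∈ loopSet g d H s) :
    jacobian g d H (s + t) z = jacobian g d H s (geodesicFlow g t z) * jacobian g d H t z := by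
  have hst := mem_loopSet_add hH hz hz'
  obtain ⟨φ, ψ, hφ, hψ, w, w', rfl, hq, hw', e, hJ⟩ := jacobian_eq_sliceChartAt hH hz
  obtain ⟨hχ, hzχ⟩ := sliceChartAt_spec hH hst.2.1.1
  obtain ⟨c1, c2⟩ := mem_conormalParam_iff hχ hst.2.1 hzχ
  set χ := sliceChartAt (n := n) d H (geodesicFlow g (s + t) (conormalParam d φ w)).1
  have hL := ((mem_loopSet_iff hH hφ hψ hq).1 hz).2
  have hq1 : (s, w') ∈ flowDomain g d ψ χ := ⟨hw', by
    rw [e]; exact hz.2.1.2.1, by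
    simp only
    rw [e, ← geodesicFlow_add]; exact hzχ⟩
  have hq2 : (s + t, w) ∈ flowDomain g d φ χ := ⟨hq.1, hq.2.1, hzχ⟩
  rw [jacobian_eq hH hφ hχ hq2 c1 c2 hst, hJ, ← e,
    jacobian_eq hH hψ hχ hq1 c1 (by rw [c2, e, geodesicFlow_add]) (by rwa [e]),
    det_flowPartDeriv_add hφ hψ hχ.1 hq hw' e hL hzχ, abs_mul]
  have p1 := conormalDensity_pos g hψ.1 hw'
  field_simp

/-- The cocycle identity at time 0 reads J₀ = J₀², and J₀ is positive. -/
theorem jacobian_zero (hH : IsEmbeddedSubmanifold (n := n) d H) {z : Cot n M}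
    (hz : z ∈ conormal d H) : jacobian g d H 0 z = 1 := by
  have h0 : z ∈ loopSet g d H 0 := mem_loopSet_zero hH hz
  have h1 := jacobian_add hH (s := 0) h0 (by rwa [geodesicFlow_zero])
  rw [add_zero, geodesicFlow_zero] at h1
  have hp := jacobian_pos hH h0
  exact (mul_eq_left₀ hp.ne').1 h1.symm

theorem jacobian_neg_mul (hH : IsEmbeddedSubmanifold (n := n) d H) {t : ℝ} {z : Cot n M}
    (hz : z ∈ loopSet g d H t) :
    jacobian g d H (-t) (geodesicFlow g t z) * jacobian g d H t z = 1 := by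
  rw [← jacobian_add hH hz (neg_mem_loopSet hH hz), neg_add_cancel, jacobian_zero hH hz.1]

theorem eventually_over {t : ℝ}
    {z : Cot n M} (hz : z ∈ conormal d H) (hzφ : z.1 ∈ φ.source)
    (hzψ : (geodesicFlow g t z).1 ∈ ψ.source) :
    ∀ᶠ q : ℝ × Cot n M in 𝓝 (t, z), q.2.1 ∈ φ.source ∧ (geodesicFlow g q.1 q.2).1 ∈ ψ.source := by
  filter_upwards [continuousAt_snd ((isOpen_over φ).mem_nhds hzφ),
    continuousAt_geodesicFlow g t hz.2.1 ((isOpen_over ψ).mem_nhds hzψ)] with q h1 h2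
  exact ⟨h1, h2⟩

theorem mem_flowDomain_of_mem_conormal (hφ : IsSliceChart d H φ) {t : ℝ} {z : Cot n M}
    (hz : z ∈ conormal d H) (hzφ : z.1 ∈ φ.source)
    (hzψ : (geodesicFlow g t z).1 ∈ ψ.source) :
    (t, conormalCoord d φ z) ∈ flowDomain g d φ ψ := by
  obtain ⟨a1, a2⟩ := mem_conormalParam_iff hφ hz hzφ
  refine ⟨a1, ?_, ?_⟩
  · rw [a2]; exact hz.2.1
  · simp only
    rw [a2]; exact hzψ

theorem continuousAt_conormalCoord (hφ : φ ∈ IsManifold.maximalAtlas 𝓘(ℝ, Rn n) ∞ M) {z : Cot n M}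
    (hz : z.1 ∈ φ.source) : ContinuousAt (conormalCoord d φ) z :=
  (coordPart n d).continuous.continuousAt.comp (continuousAt_canCoord hφ hz)

/-- The Jacobian is continuous on the set of the `(t, z)` with `z ∈ Σ_t`. -/
theorem continuousOn_jacobian (hH : IsEmbeddedSubmanifold (n := n) d H) :
    ContinuousOn (fun q : ℝ × Cot n M => jacobian g d H q.1 q.2) {q | q.2 ∈ loopSet g d H q.1} := by
  rintro ⟨t, z⟩ hz
  change z ∈ loopSet g d H t at hz
  obtain ⟨hφ, hzφ⟩ := sliceChartAt_spec hH hz.1.1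
  obtain ⟨hψ, hzψ⟩ := sliceChartAt_spec hH hz.2.1.1
  set φ := sliceChartAt (n := n) d H z.1
  set ψ := sliceChartAt (n := n) d H (geodesicFlow g t z).1
  have hq := mem_flowDomain_of_mem_conormal hφ hz.1 hzφ hzψ
  have hc1 : ContinuousAt (fun q : ℝ × Cot n M => conormalCoord d φ q.2) (t, z) :=
    ContinuousAt.comp (g := conormalCoord d φ) (continuousAt_conormalCoord hφ.1 hzφ)
      continuousAt_snd
  have hc2 : ContinuousAt (fun q : ℝ × Cot n M => conormalCoord d ψ (geodesicFlow g q.1 q.2))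
      (t, z) :=
    ContinuousAt.comp (g := conormalCoord d ψ) (f := fun q : ℝ × Cot n M => geodesicFlow g q.1 q.2)
      (continuousAt_conormalCoord hψ.1 hzψ) (continuousAt_geodesicFlow g t hz.1.2.1)
  have hc3 : ContinuousAt (fun q : ℝ × Cot n M =>
      flowCoordDeriv g d φ ψ (q.1, conormalCoord d φ q.2)) (t, z) :=
    ContinuousAt.comp (g := flowCoordDeriv g d φ ψ)
      (f := fun q : ℝ × Cot n M => (q.1, conormalCoord d φ q.2))
      (continuousAt_flowCoordDeriv hφ hψ.1 hq) (continuousAt_fst.prodMk hc1)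
  have hc4 : ContinuousAt (fun q : ℝ × Cot n M =>
      |(flowPartDeriv g d φ ψ (q.1, conormalCoord d φ q.2)).det|) (t, z) := by
    refine ContinuousAt.abs ?_
    exact ContinuousAt.comp (g := ContinuousLinearMap.det)
      ContinuousLinearMap.continuous_det.continuousAt (continuousAt_const.clm_comp hc3)
  have hc5 : ContinuousAt (fun q : ℝ × Cot n M =>
      conormalDensity g d φ (conormalCoord d φ q.2)) (t, z) :=
    ContinuousAt.comp (g := conormalDensity g d φ) ((continuousOn_conormalDensity g hφ.1).continuousAt
      (isOpen_paramDomain.mem_nhds hq.1)) hc1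
  have hb := mem_conormalParam_iff hψ hz.2.1 hzψ
  have hc6 : ContinuousAt (fun q : ℝ × Cot n M =>
      conormalDensity g d ψ (conormalCoord d ψ (geodesicFlow g q.1 q.2))) (t, z) :=
    ContinuousAt.comp (g := conormalDensity g d ψ)
      (f := fun q : ℝ × Cot n M => conormalCoord d ψ (geodesicFlow g q.1 q.2))
      ((continuousOn_conormalDensity g hψ.1).continuousAt (isOpen_paramDomain.mem_nhds hb.1)) hc2
  have hc7 := (hc4.mul hc6).div hc5 (conormalDensity_pos g hφ.1 hq.1).ne'
  have hev : ∀ᶠ q : ℝ × Cot n M in 𝓝[{q | q.2 ∈ loopSet g d H q.1}] (t, z),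
      jacobian g d H q.1 q.2 = |(flowPartDeriv g d φ ψ (q.1, conormalCoord d φ q.2)).det| *
        conormalDensity g d ψ (conormalCoord d ψ (geodesicFlow g q.1 q.2)) /
        conormalDensity g d φ (conormalCoord d φ q.2) := by
    filter_upwards [self_mem_nhdsWithin,
      mem_nhdsWithin_of_mem_nhds (eventually_over hz.1 hzφ hzψ)] with q hq1 hq2
    obtain ⟨a1, a2⟩ := mem_conormalParam_iff hφ hq1.1 hq2.1
    obtain ⟨b1, b2⟩ := mem_conormalParam_iff hψ hq1.2.1 hq2.2
    have h := jacobian_eq hH hφ hψ (mem_flowDomain_of_mem_conormal hφ hq1.1 hq2.1 hq2.2) b1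
      (by rw [a2, b2]) (by rw [a2]; exact hq1)
    rwa [a2] at h
  exact hc7.continuousWithinAt.congr_of_eventuallyEq hev (hev.self_of_nhdsWithin hz)

/-- The dilation of the coordinates `ξ''`. -/
def dilationPart (n d : ℕ) (r : ℝ) : Rn n →L[ℝ] Rn n :=
  (coordPart n d).comp ((dilationCoord n r).comp (coordEmb n d))

theorem dilationCoord_coordEmb (r : ℝ) (w : Rn n) :
    dilationCoord n r (coordEmb n d w) = coordEmb n d (dilationPart n d r w) := by
  refine (coordEmb_coordPart ?_).symm
  have h := coordDefect_coordEmb (d := d) w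
  have hi := fun i => congrArg (fun v : Rn n => v i) h
  ext i
  specialize hi i
  rw [coordDefect_apply] at hi ⊢
  by_cases hid : (i : ℕ) < d <;> simp_all

theorem basePart_dilationPart (r : ℝ) (w : Rn n) :
    basePart d (dilationPart n d r w) = basePart d w :=
  congrArg Prod.fst (dilationCoord_coordEmb (d := d) r w).symm

theorem conormalParam_dilationPart (φ : OpenPartialHomeomorph M (Rn n)) (r : ℝ) (w : Rn n) :
    conormalParam d φ (dilationPart n d r w) = dilation r (conormalParam d φ w) := by
  rw [conormalParam_eq, ← dilationCoord_coordEmb, conormalParam_eq]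
  rfl

theorem dilationPart_comp_inv {r : ℝ} (hr : r ≠ 0) :
    (dilationPart n d r).comp (dilationPart n d r⁻¹) = ContinuousLinearMap.id ℝ (Rn n) := by
  refine ContinuousLinearMap.ext fun w => ?_
  have h : coordEmb n d (dilationPart n d r (dilationPart n d r⁻¹ w)) = coordEmb n d w := by
    rw [← dilationCoord_coordEmb, ← dilationCoord_coordEmb]
    simp [smul_smul, hr]
  have := congrArg (coordPart n d) h
  rwa [coordPart_coordEmb, coordPart_coordEmb] at this

theorem det_dilationPart_ne_zero {r : ℝ} (hr : r ≠ 0) : (dilationPart n d r).det ≠ 0 := by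
  intro h
  have h1 := congrArg ContinuousLinearMap.det (dilationPart_comp_inv (n := n) (d := d) hr)
  rw [det_comp_rn, h, zero_mul] at h1
  have h3 : (ContinuousLinearMap.id ℝ (Rn n)).det = 1 := LinearMap.det_id
  rw [h3] at h1
  exact zero_ne_one h1

theorem dilation_mem_flowDomain {r : ℝ} (hr : 0 < r) {t : ℝ} {w : Rn n}
    (hq : (t, w) ∈ flowDomain g d φ ψ) : (t, dilationPart n d r w) ∈ flowDomain g d φ ψ := by
  refine ⟨?_, ?_, ?_⟩
  · change basePart d (dilationPart n d r w) ∈ φ.target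
    rw [basePart_dilationPart]; exact hq.1
  · simp only
    rw [conormalParam_dilationPart]
    exact smul_ne_zero hr.ne' hq.2.1
  · simp only
    rw [conormalParam_dilationPart, geodesicFlow_dilation g hr]
    exact hq.2.2

theorem flowCoordDeriv_dilation (hφ : IsSliceChart d H φ)
    (hψ : ψ ∈ IsManifold.maximalAtlas 𝓘(ℝ, Rn n) ∞ M) {r : ℝ} (hr : 0 < r) {t : ℝ} {w : Rn n}
    (hq : (t, w) ∈ flowDomain g d φ ψ) :
    (flowCoordDeriv g d φ ψ (t, dilationPart n d r w)).comp (dilationPart n d r) =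
      (dilationCoord n r).comp (flowCoordDeriv g d φ ψ (t, w)) := by
  have h1 := (hasFDerivAt_flowCoord_right hφ hψ (dilation_mem_flowDomain hr hq)).comp w
    (dilationPart n d r).hasFDerivAt
  have h2 := (dilationCoord n r).hasFDerivAt.comp w (hasFDerivAt_flowCoord_right hφ hψ hq)
  refine h1.unique (h2.congr_of_eventuallyEq (Eventually.of_forall fun v => ?_))
  simp only [Function.comp, flowCoord]
  rw [conormalParam_dilationPart, geodesicFlow_dilation g hr, canCoord_dilation]

/-- `Σ_t` is conic, and the Jacobian is homogeneous of degree `0`. -/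
theorem dilation_mem_loopSet_and_jacobian (hH : IsEmbeddedSubmanifold (n := n) d H) {r : ℝ}
    (hr : 0 < r) {t : ℝ} {z : Cot n M} (hz : z ∈ loopSet g d H t) :
    dilation r z ∈ loopSet g d H t ∧ jacobian g d H t (dilation r z) = jacobian g d H t z := by
  obtain ⟨φ, ψ, hφ, hψ, w, w', rfl, hq, hw', e, hJ⟩ := jacobian_eq_sliceChartAt hH hz
  have hq' := dilation_mem_flowDomain hr hq
  have hL := (mem_loopSet_iff hH hφ hψ hq).1 hz
  have hD := flowCoordDeriv_dilation hφ hψ.1 hr hq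
  rw [flowCoordDeriv_eq hL.2] at hD
  have hD' : (flowCoordDeriv g d φ ψ (t, dilationPart n d r w)).comp (dilationPart n d r) =
      (coordEmb n d).comp ((dilationPart n d r).comp (flowPartDeriv g d φ ψ (t, w))) := by
    rw [hD]
    exact ContinuousLinearMap.ext fun u => dilationCoord_coordEmb r _
  have hw'' : dilationPart n d r w' ∈ paramDomain d ψ := by
    change basePart d (dilationPart n d r w') ∈ ψ.target
    rw [basePart_dilationPart]; exact hw'
  have e' : conormalParam d ψ (dilationPart n d r w') =
      geodesicFlow g t (conormalParam d φ (dilationPart n d r w)) := by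
    rw [conormalParam_dilationPart, conormalParam_dilationPart, geodesicFlow_dilation g hr, e]
  have hmem : conormalParam d φ (dilationPart n d r w) ∈ loopSet g d H t := by
    refine (mem_loopSet_iff hH hφ hψ hq').2 ⟨?_, ?_⟩
    · simp only [flowCoord]
      rw [← e', canCoord_conormalParam hψ hw'', coordDefect_coordEmb]
    · have h1 : (flowCoordDeriv g d φ ψ (t, dilationPart n d r w)) =
          (flowCoordDeriv g d φ ψ (t, dilationPart n d r w)).comp
            ((dilationPart n d r).comp (dilationPart n d r⁻¹)) := by
        rw [dilationPart_comp_inv hr.ne']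
        rfl
      rw [h1, ← ContinuousLinearMap.comp_assoc (flowCoordDeriv g d φ ψ _), hD']
      exact ContinuousLinearMap.ext fun u => coordDefect_coordEmb _
  rw [← conormalParam_dilationPart]
  refine ⟨hmem, ?_⟩
  rw [hJ, jacobian_eq hH hφ hψ hq' hw'' e' hmem]
  -- The two derivatives are conjugate by the dilation of ξ'', whose nonzero determinant appears on
  -- both sides.
  have hdet : (flowPartDeriv g d φ ψ (t, dilationPart n d r w)).det =
      (flowPartDeriv g d φ ψ (t, w)).det := by
    have h1 := congrArg (fun A => ((coordPart n d).comp A).det) hD'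
    have h2 : (coordPart n d).comp ((flowCoordDeriv g d φ ψ (t, dilationPart n d r w)).comp
      (dilationPart n d r)) = (flowPartDeriv g d φ ψ (t, dilationPart n d r w)).comp
        (dilationPart n d r) := rfl
    have h3 : (coordPart n d).comp ((coordEmb n d).comp ((dilationPart n d r).comp
        (flowPartDeriv g d φ ψ (t, w)))) =
        (dilationPart n d r).comp (flowPartDeriv g d φ ψ (t, w)) :=
      ContinuousLinearMap.ext fun u => coordPart_coordEmb _
    simp only [h2, h3, det_comp_rn] at h1
    rw [mul_comm] at h1
    exact mul_left_cancel₀ (det_dilationPart_ne_zero hr.ne') h1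
  have hdens : ∀ (χ : OpenPartialHomeomorph M (Rn n)) (v : Rn n),
      conormalDensity g d χ (dilationPart n d r v) = conormalDensity g d χ v := by
    intro χ v
    simp only [conormalDensity, basePart_dilationPart]
  rw [hdet, hdens, hdens]

end
end ConormalFlow
end

/-! ### Transversality: the loop relation is closed and returns to H are separated in time. -/

noncomputable section
namespace ConormalFlow
section
variable {n : ℕ} {M : Type*} [TopologicalSpace M] [ChartedSpace (Rn n) M]
variable [IsManifold 𝓘(ℝ, Rn n) ∞ M]
variable {φ ψ χ : OpenPartialHomeomorph M (Rn n)} {g : Metric n M} {H : Set M} {d : ℕ}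

/-- Euler's identity for the symbol. -/
theorem apply_hamCoord_fst (g : Metric n M) (hφ : φ ∈ IsManifold.maximalAtlas 𝓘(ℝ, Rn n) ∞ M)
    {w : Rn n × (Rn n →L[ℝ] ℝ)} (hw : w.1 ∈ φ.target) (hw2 : w.2 ≠ 0) :
    w.2 (hamCoord g φ w).1 = symbolCoord g φ w := by
  have hd := ((symbolCoord_contDiffAt g hφ hw hw2).differentiableAt (by simp)).hasFDerivAt
  have h1 := symplecticDual_pairing (fderiv ℝ (symbolCoord g φ) w) (0, w.2)
  simp only [map_zero, sub_zero] at h1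
  rw [hamCoord, h1]
  have hline : HasDerivAt (fun r : ℝ => dilationCoord n r w) ((0 : Rn n), w.2) 1 := by
    have h2 := (hasDerivAt_const (1 : ℝ) w.1).prodMk ((hasDerivAt_id (1 : ℝ)).smul_const w.2)
    simpa using h2
  have hd' : HasFDerivAt (symbolCoord g φ) (fderiv ℝ (symbolCoord g φ) w) (dilationCoord n 1 w) := by
    rw [show dilationCoord n 1 w = w by simp]
    exact hd
  have h3 := hd'.comp_hasDerivAt (1 : ℝ) hline
  have h4 : HasDerivAt (fun r : ℝ => r * symbolCoord g φ w) (1 * symbolCoord g φ w) 1 :=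
    (hasDerivAt_id (1 : ℝ)).mul_const _
  rw [one_mul] at h4
  refine h3.unique (h4.congr_of_eventuallyEq ?_)
  filter_upwards [lt_mem_nhds (zero_lt_one' ℝ)] with r hr
  exact symbolCoord_dilationCoord g hr w

theorem coordEmb_snd_apply_eq_zero {v y : Rn n} (hy : ∀ i : Fin n, d ≤ (i : ℕ) → y i = 0) :
    (coordEmb n d v).2 y = 0 := by
  rw [covector_apply_eq_sum]
  refine Finset.sum_eq_zero fun i _ => ?_
  rw [coordEmb_snd_single]
  split_ifs with h
  · simp
  · rw [hy i (not_lt.1 h), mul_zero]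

/-- The Hamilton vector field is transversal to the part of `T*M` over `H`, at conormal points. -/
theorem coordDefect_hamCoord_ne_zero (g : Metric n M)
    (hφ : φ ∈ IsManifold.maximalAtlas 𝓘(ℝ, Rn n) ∞ M) {w : Rn n} (hw : w ∈ paramDomain d φ)
    (hw2 : (coordEmb n d w).2 ≠ 0) : ∃ i : Fin n, d ≤ (i : ℕ) ∧
      (hamCoord g φ (coordEmb n d w)).1 i ≠ 0 := by
  by_contra! h
  have h1 := apply_hamCoord_fst g hφ (w := coordEmb n d w) hw hw2
  rw [coordEmb_snd_apply_eq_zero h] at h1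
  exact (symbolCoord_pos g hφ (w := coordEmb n d w) hw hw2).ne h1

variable [T2Space M] [CompactSpace M]

theorem isCompact_unitConormal (hH : IsEmbeddedSubmanifold (n := n) d H) (hHc : IsCompact H) :
    IsCompact (unitConormal g d H) := by
  refine (isCompact_symbol_eq g 1).of_isClosed_subset ?_ fun z hz => hz.2
  refine isClosed_of_closure_subset fun z hz => ?_
  have hs : symbol g z = 1 :=
    closure_minimal (fun w hw => hw.2) (isClosed_eq (continuous_symbol g) continuous_const) hz
  have hzH : z.1 ∈ H := closure_minimal (fun w (hw : w ∈ unitConormal g d H) => hw.1.1)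
    (hHc.isClosed.preimage continuous_proj_cot) hz
  obtain ⟨hφ, hzφ⟩ := sliceChartAt_spec hH hzH
  set φ := sliceChartAt (n := n) d H z.1
  refine ⟨(mem_conormal_iff hφ hzφ).2 ⟨ne_zero_of_symbol_pos (g := g) (by rw [hs]; exact one_pos), ?_⟩,
    hs⟩
  have hc : ContinuousAt (fun w => coordDefect n d (canCoord φ w)) z :=
    (coordDefect n d).continuous.continuousAt.comp (continuousAt_canCoord hφ.1 hzφ)
  by_contra hne
  obtain ⟨w, hw, hw1, hw2⟩ := ((mem_closure_iff_frequently.1 hz).and_eventually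
    ((hc.eventually_ne hne).and ((isOpen_over φ).mem_nhds hzφ))).exists
  exact hw1 ((mem_conormal_iff hφ hw2).1 hw.1).2

theorem geodesicFlow_mem_unitConormal {t : ℝ} {z : Cot n M} (hz : z ∈ unitLoopSet g d H t) :
    geodesicFlow g t z ∈ unitConormal g d H :=
  ⟨hz.1.2.1, by rw [symbol_geodesicFlow]; exact hz.2.2⟩

/-- The set of the `(t, z)` with `z ∈ SΣ_t` is closed. -/
theorem isClosed_unitLoopSet (hH : IsEmbeddedSubmanifold (n := n) d H) (hHc : IsCompact H) :
    IsClosed {q : ℝ × Cot n M | q.2 ∈ unitLoopSet g d H q.1} := by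
  refine isClosed_of_closure_subset ?_
  rintro ⟨t, z⟩ hq
  have hXc := (isCompact_unitConormal (g := g) hH hHc).isClosed
  have hzX : z ∈ unitConormal g d H := closure_minimal
    (fun (q : ℝ × Cot n M) (hq : q.2 ∈ unitLoopSet g d H q.1) => hq.2)
    (hXc.preimage continuous_snd) hq
  have hfreq := mem_closure_iff_frequently.1 hq
  have hflow := continuousAt_geodesicFlow g t hzX.1.2.1
  have hGX : geodesicFlow g t z ∈ unitConormal g d H := by
    by_contra hne
    obtain ⟨q, h1, h2⟩ := (hfreq.and_eventually (hflow (hXc.isOpen_compl.mem_nhds hne))).exists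
    exact h2 (geodesicFlow_mem_unitConormal h1)
  obtain ⟨hφ, hzφ⟩ := sliceChartAt_spec hH hzX.1.1
  obtain ⟨hψ, hzψ⟩ := sliceChartAt_spec hH hGX.1.1
  set φ := sliceChartAt (n := n) d H z.1
  set ψ := sliceChartAt (n := n) d H (geodesicFlow g t z).1
  have hqd := mem_flowDomain_of_mem_conormal hφ hzX.1 hzφ hzψ
  have ha := mem_conormalParam_iff hφ hzX.1 hzφ
  have hmem := mem_loopSet_iff hH hφ hψ hqd
  rw [ha.2] at hmem
  refine ⟨hmem.2 ⟨?_, ?_⟩, hzX⟩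
  · simp only [flowCoord]
    rw [ha.2]
    exact ((mem_conormal_iff hψ hzψ).1 hGX.1).2
  -- Tangency passes to the limit because the derivative of the flow is continuous in (t, z).
  · by_contra hne
    have hc1 : ContinuousAt (fun q : ℝ × Cot n M => conormalCoord d φ q.2) (t, z) :=
      ContinuousAt.comp (g := conormalCoord d φ) (continuousAt_conormalCoord hφ.1 hzφ)
        continuousAt_snd
    have hc3 : ContinuousAt (fun q : ℝ × Cot n M =>
        flowCoordDeriv g d φ ψ (q.1, conormalCoord d φ q.2)) (t, z) :=
      ContinuousAt.comp (g := flowCoordDeriv g d φ ψ)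
        (f := fun q : ℝ × Cot n M => (q.1, conormalCoord d φ q.2))
        (continuousAt_flowCoordDeriv hφ hψ.1 hqd) (continuousAt_fst.prodMk hc1)
    have hc4 : ContinuousAt (fun q : ℝ × Cot n M => (coordDefect n d).comp
        (flowCoordDeriv g d φ ψ (q.1, conormalCoord d φ q.2))) (t, z) :=
      continuousAt_const.clm_comp hc3
    obtain ⟨q, h1, h2, h3⟩ := (hfreq.and_eventually ((hc4.eventually_ne hne).and
      (eventually_over hzX.1 hzφ hzψ))).exists
    have hb := mem_conormalParam_iff hφ h1.2.1 h3.1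
    have := (mem_loopSet_iff hH hφ hψ (mem_flowDomain_of_mem_conormal hφ h1.2.1 h3.1 h3.2)).1
      (by rw [hb.2]; exact h1.1)
    exact h2 this.2

/-- Geodesics which start conormally to `H` do not meet `H` again for a uniform time. -/
theorem exists_separation (hH : IsEmbeddedSubmanifold (n := n) d H) (hHc : IsCompact H) :
    ∃ ε > (0 : ℝ), ∀ z ∈ unitConormal g d H, ∀ s : ℝ, |s| < ε → (geodesicFlow g s z).1 ∈ H →
      s = 0 := by
  have hloc : ∀ z ∈ unitConormal g d H, ∃ ε > (0 : ℝ), ∃ U ∈ 𝓝 z, ∀ z' ∈ U,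
      z' ∈ unitConormal g d H → ∀ s : ℝ, |s| < ε → (geodesicFlow g s z').1 ∈ H → s = 0 := by
    intro z hz
    obtain ⟨hφ, hzφ⟩ := sliceChartAt_spec hH hz.1.1
    set φ := sliceChartAt (n := n) d H z.1
    have hzφ' : (geodesicFlow g 0 z).1 ∈ φ.source := by rwa [geodesicFlow_zero]
    have hq := mem_flowDomain_of_mem_conormal hφ hz.1 hzφ hzφ'
    obtain ⟨a1, a2⟩ := mem_conormalParam_iff hφ hz.1 hzφ
    set w := conormalCoord d φ z
    have hflow0 : flowCoord g d φ φ (0, w) = coordEmb n d w := by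
      simp only [flowCoord, geodesicFlow_zero]
      exact canCoord_conormalParam hφ a1
    have hw2 : (coordEmb n d w).2 ≠ 0 := by
      rw [← canCoord_conormalParam hφ a1]
      exact (canCoord_snd_ne_zero hφ.1 (conormalParam_mem_source a1)).2 hq.2.1
    have hcf : ContinuousAt (flowCoord g d φ φ) (0, w) :=
      (contDiffAt_flowCoord hφ hφ.1 hq).continuousAt
    have hcham : ContinuousAt (fun q : ℝ × Rn n => hamCoord g φ (flowCoord g d φ φ q)) (0, w) := by
      refine ContinuousAt.comp (g := hamCoord g φ) ?_ hcf
      rw [hflow0]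
      exact (hamCoord_contDiffAt g hφ.1 (w := coordEmb n d w) a1 hw2).continuousAt
    have hcemb : ContinuousAt (fun q : ℝ × Rn n => (coordEmb n d q.2).2) (0, w) :=
      ((continuous_snd.comp (coordEmb n d).continuous).comp continuous_snd).continuousAt
    have hck : ContinuousAt (fun q : ℝ × Rn n =>
        (coordEmb n d q.2).2 (hamCoord g φ (flowCoord g d φ φ q)).1) (0, w) :=
      hcemb.clm_apply hcham.fst
    have hpos : 0 < (coordEmb n d w).2 (hamCoord g φ (flowCoord g d φ φ (0, w))).1 := by
      rw [hflow0, apply_hamCoord_fst g hφ.1 (w := coordEmb n d w) a1 hw2]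
      exact symbolCoord_pos g hφ.1 (w := coordEmb n d w) a1 hw2
    have hev := (hck.eventually (lt_mem_nhds hpos)).and ((isOpen_flowDomain hφ).mem_nhds hq)
    rw [nhds_prod_eq] at hev
    obtain ⟨P, hP, Q, hQ, hPQ⟩ := eventually_prod_iff.1 hev
    obtain ⟨ε, hε, hεP⟩ := Metric.eventually_nhds_iff.1 hP
    refine ⟨ε, hε, {z' | Q (conormalCoord d φ z') ∧ z'.1 ∈ φ.source},
      ((continuousAt_conormalCoord hφ.1 hzφ).eventually hQ).and ((isOpen_over φ).mem_nhds hzφ), ?_⟩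
    rintro z' ⟨hz'Q, hz'φ⟩ hz'X s hs hsH
    obtain ⟨b1, b2⟩ := mem_conormalParam_iff hφ hz'X.1 hz'φ
    set v := conormalCoord d φ z'
    have hPs : ∀ r : ℝ, |r| < ε → P r := fun r hr => hεP (by simpa using hr)
    -- The function k pairs the initial covector, frozen in the chart, with the position. It
    -- vanishes over H since the covector is (0, ξ'') and x'' = 0 there, and its derivative is close
    -- to p > 0 by Euler's identity. A strictly increasing function has only the zero r = 0.
    set k : ℝ → ℝ := fun r => (coordEmb n d v).2 (flowCoord g d φ φ (r, v)).1 with hk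
    have hkd : ∀ r ∈ Ioo (-ε) ε, HasDerivAt k
        ((coordEmb n d v).2 (hamCoord g φ (flowCoord g d φ φ (r, v))).1) r := by
      intro r hr
      have h1 := hasDerivAt_flowCoord_left hφ.1 (hPQ (hPs r (abs_lt.2 hr)) hz'Q).2
      exact ((coordEmb n d v).2.comp (ContinuousLinearMap.fst ℝ (Rn n)
        (Rn n →L[ℝ] ℝ))).hasFDerivAt.comp_hasDerivAt r h1
    have hmono : StrictMonoOn k (Ioo (-ε) ε) := by
      refine strictMonoOn_of_deriv_pos (convex_Ioo _ _)
        (fun r hr => (hkd r hr).continuousAt.continuousWithinAt) fun r hr => ?_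
      rw [interior_Ioo] at hr
      rw [(hkd r hr).deriv]
      exact (hPQ (hPs r (abs_lt.2 hr)) hz'Q).1
    have hzero : ∀ r ∈ Ioo (-ε) ε, (geodesicFlow g r z').1 ∈ H → k r = 0 := by
      intro r hr hrH
      have hd := (hPQ (hPs r (abs_lt.2 hr)) hz'Q).2
      refine coordEmb_snd_apply_eq_zero fun i hi => ?_
      have h3 := hd.2.2
      simp only at h3
      rw [b2] at h3
      simp only [flowCoord]
      rw [b2]
      exact (hφ.2 _ h3).1 hrH i hi
    have h0 : (0 : ℝ) ∈ Ioo (-ε) ε := ⟨by linarith, hε⟩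
    refine hmono.injOn (abs_lt.1 hs) h0 ?_
    rw [hzero s (abs_lt.1 hs) hsH, hzero 0 h0 (by rw [geodesicFlow_zero]; exact hz'X.1.1)]
  choose! ε hε U hU hUs using hloc
  obtain ⟨t, ht, htc⟩ := (isCompact_unitConormal (g := g) hH hHc).elim_nhds_subcover U
    fun z hz => hU z hz
  obtain ⟨δ, hδ, hδt⟩ : ∃ δ > 0, ∀ z ∈ t, δ ≤ ε z := by
    rcases t.eq_empty_or_nonempty with h | h
    · exact ⟨1, one_pos, by simp [h]⟩
    · obtain ⟨z, hz, hmin⟩ := t.exists_min_image ε h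
      exact ⟨ε z, hε z (ht z hz), hmin⟩
  refine ⟨δ, hδ, fun z hz s hs hsH => ?_⟩
  obtain ⟨z₀, hz₀, hz₀U⟩ := mem_iUnion₂.1 (htc hz)
  exact hUs z₀ (ht z₀ hz₀) z hz₀U hz s (hs.trans_le (hδt z₀ hz₀)) hsH

end
end ConormalFlow
end

/-! ### Differentiability of return maps and change of variables between two slice charts. -/

noncomputable section
namespace ConormalFlow
section
variable {n : ℕ} {M : Type*} [TopologicalSpace M] [ChartedSpace (Rn n) M]
variable [IsManifold 𝓘(ℝ, Rn n) ∞ M]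
variable {φ ψ χ : OpenPartialHomeomorph M (Rn n)} {g : Metric n M} {H : Set M} {d : ℕ}

theorem continuousOn_conormalParam (hφ : IsSliceChart d H φ) :
    ContinuousOn (conormalParam d φ : Rn n → Cot n M) (paramDomain d φ) :=
  fun _ hw => (contMDiffAt_conormalParam hφ hw).continuousAt.continuousWithinAt

theorem measurableSet_paramDomain : MeasurableSet (paramDomain d φ) :=
  isOpen_paramDomain.measurableSet

theorem measurableSet_inter_conormalParam (hφ : IsSliceChart d H φ) {B : Set (Cot n M)}
    (hB : MeasurableSet B) : MeasurableSet (paramDomain d φ ∩ conormalParam d φ ⁻¹' B) := by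
  have h := (continuousOn_iff_continuous_domRestrict.1 (continuousOn_conormalParam hφ)).measurable hB
  have h2 := (measurableSet_paramDomain (d := d) (φ := φ)).subtype_image h
  convert h2 using 1
  ext w
  simp [and_comm]

theorem aemeasurable_conormalDensity (g : Metric n M)
    (hφ : φ ∈ IsManifold.maximalAtlas 𝓘(ℝ, Rn n) ∞ M) :
    AEMeasurable (fun w => ENNReal.ofReal (conormalDensity g d φ w))
      (volume.restrict (paramDomain d φ)) :=
  ((continuousOn_conormalDensity g hφ).aemeasurable measurableSet_paramDomain).ennreal_ofReal

/-- No measurability of the integrand is asked for, at the price of an inequality; this spares a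
discussion of the Jacobian away from the loops. -/
theorem lintegral_chartVolume_le (g : Metric n M) (hφ : IsSliceChart d H φ)
    (F : Cot n M → ℝ≥0∞) : ∫⁻ z, F z ∂(chartVolume g d φ) ≤
      ∫⁻ w in paramDomain d φ, ENNReal.ofReal (conormalDensity g d φ w) *
        F (conormalParam d φ w) := by
  refine (lintegral_map_le _ _).trans (le_of_eq ?_)
  rw [lintegral_withDensity_eq_lintegral_mul_non_measurable₀ _ (aemeasurable_conormalDensity g hφ.1)
    (Eventually.of_forall fun _ => ENNReal.ofReal_lt_top)]
  rfl

theorem lintegral_chartVolume (g : Metric n M) (hφ : IsSliceChart d H φ)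
    {F : Cot n M → ℝ≥0∞} (hF : Measurable F) : ∫⁻ z, F z ∂(chartVolume g d φ) =
      ∫⁻ w in paramDomain d φ, ENNReal.ofReal (conormalDensity g d φ w) *
        F (conormalParam d φ w) := by
  rw [chartVolume, lintegral_map' hF.aemeasurable (((continuousOn_conormalParam hφ).aemeasurable
    measurableSet_paramDomain).mono_ac (withDensity_absolutelyContinuous _ _)),
    lintegral_withDensity_eq_lintegral_mul_non_measurable₀ _ (aemeasurable_conormalDensity g hφ.1)
    (Eventually.of_forall fun _ => ENNReal.ofReal_lt_top)]
  rfl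

variable [T2Space M] [CompactSpace M]

/-- Along a set of points which return to the conormal bundle with tangent derivative, a continuous
return time has vanishing derivative. -/
theorem hasFDerivWithinAt_returnTime (hφ : IsSliceChart d H φ) (hψ : IsSliceChart d H ψ)
    {A : Set (Rn n)} {θ : Rn n → ℝ} {w : Rn n} (hwA : w ∈ A) (hθ : ContinuousWithinAt θ A w)
    (hq : (θ w, w) ∈ flowDomain g d φ ψ)
    (hA : ∀ v ∈ A, coordDefect n d (flowCoord g d φ ψ (θ v, v)) = 0)
    (hL : (coordDefect n d).comp (flowCoordDeriv g d φ ψ (θ w, w)) = 0) :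
    HasFDerivWithinAt θ (0 : Rn n →L[ℝ] ℝ) A w := by
  set Fl := flowCoord g d φ ψ with hFl
  set L := fderiv ℝ Fl (θ w, w) with hLdef
  have hd : HasFDerivAt Fl L (θ w, w) :=
    ((contDiffAt_flowCoord hφ hψ.1 hq).differentiableAt (by simp)).hasFDerivAt
  set X := L (1, 0) with hX
  have hXham : X = hamCoord g ψ (Fl (θ w, w)) := by
    have h1 := HasFDerivAt.comp (g := Fl) (f := fun s => (s, w)) (θ w) hd
      (hasFDerivAt_prodMk_left (θ w) w)
    exact h1.hasDerivAt.unique (hasDerivAt_flowCoord_left hψ.1 hq)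
  -- The Hamilton field at a conormal covector has a component normal to H, since otherwise Euler's
  -- identity would give p = 0.
  have hXne : coordDefect n d X ≠ 0 := by
    intro h0
    have hw0 := hA w hwA
    have hemb := coordEmb_coordPart hw0
    have hmem : coordPart n d (Fl (θ w, w)) ∈ paramDomain d ψ := by
      rw [mem_paramDomain, hemb]
      exact ψ.map_source hq.2.2
    obtain ⟨i, hi, hne⟩ := coordDefect_hamCoord_ne_zero g hψ.1 hmem (by
      rw [hemb]
      exact (canCoord_snd_ne_zero hψ.1 hq.2.2).2 (geodesicFlow_ne_zero g hq.2.1 _))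
    rw [hemb, ← hXham] at hne
    have h1 := congrArg (fun v : Rn n => v i) h0
    simp only [coordDefect_apply, if_neg (not_lt.2 hi), PiLp.zero_apply] at h1
    exact hne h1
  have hLs : ∀ (s : ℝ) (u : Rn n), coordDefect n d (L (s, u)) = s • coordDefect n d X := by
    intro s u
    have h1 : ((s, u) : ℝ × Rn n) = s • ((1 : ℝ), (0 : Rn n)) + (0, u) := by simp
    have h2 : coordDefect n d (L (0, u)) = 0 := DFunLike.congr_fun hL u
    rw [h1, map_add, map_add, h2, add_zero, map_smul, map_smul]
  have htend : Tendsto (fun v => (θ v, v)) (𝓝[A] w) (𝓝 (θ w, w)) := by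
    rw [nhds_prod_eq]
    exact hθ.tendsto.prodMk (tendsto_id.mono_left nhdsWithin_le_nhds)
  have h1 := hd.isLittleO.comp_tendsto htend
  -- The defect vanishes at both end points and on the spatial part of the linearization. What
  -- remains of the linearization error is -(θ v - θ w) times the nonzero defect of X, so the error
  -- controls the difference of times.
  have h2 : (fun v => θ v - θ w) =O[𝓝[A] w]
      ((fun q => Fl q - Fl (θ w, w) - L (q - (θ w, w))) ∘ fun v => (θ v, v)) := by
    refine Asymptotics.IsBigO.of_bound (‖coordDefect n d X‖⁻¹ * ‖coordDefect n d‖) ?_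
    filter_upwards [self_mem_nhdsWithin] with v hv
    have h3 : coordDefect n d (Fl (θ v, v) - Fl (θ w, w) - L ((θ v, v) - (θ w, w))) =
        -((θ v - θ w) • coordDefect n d X) := by
      rw [map_sub, map_sub, hA v hv, hA w hwA, Prod.mk_sub_mk, hLs]
      simp
    have h4 := (coordDefect n d).le_opNorm (Fl (θ v, v) - Fl (θ w, w) - L ((θ v, v) - (θ w, w)))
    rw [h3, norm_neg, norm_smul] at h4
    have h5 : 0 < ‖coordDefect n d X‖ := norm_pos_iff.2 hXne
    simp only [Function.comp]
    rw [mul_assoc, inv_mul_eq_div, le_div_iff₀ h5]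
    exact h4
  have h3 : (fun v => θ v - θ w) =o[𝓝[A] w] fun v => ((θ v, v) : ℝ × Rn n) - (θ w, w) :=
    h2.trans_isLittleO h1
  have h4 : (fun v => ((θ v - θ w, 0) : ℝ × Rn n)) =o[𝓝[A] w]
      fun v => ((θ v, v) : ℝ × Rn n) - (θ w, w) := by
    refine (Asymptotics.isLittleO_norm_left.1 ?_)
    refine (Asymptotics.isLittleO_norm_left.2 h3).congr_left fun v => ?_
    simp [Prod.norm_def]
  have h5 := h4.right_isBigO_sub
  have h6 : (fun v => ((θ v, v) : ℝ × Rn n) - (θ w, w)) =O[𝓝[A] w] fun v => v - w := by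
    refine h5.trans (Asymptotics.IsBigO.of_bound 1 (Eventually.of_forall fun v => ?_))
    simp [Prod.norm_def]
  refine HasFDerivWithinAt.of_isLittleO ?_
  refine (h3.trans_isBigO h6).congr_left fun v => ?_
  simp

/-- Since the return time is constant to first order along A, only the flow derivative at the frozen
time survives. The determinant of a variable-time return map is thus the one occurring in J_t. -/
theorem hasFDerivWithinAt_returnMap (hφ : IsSliceChart d H φ) (hψ : IsSliceChart d H ψ)
    {A : Set (Rn n)} {θ : Rn n → ℝ} {w : Rn n} (hwA : w ∈ A) (hθ : ContinuousWithinAt θ A w)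
    (hq : (θ w, w) ∈ flowDomain g d φ ψ)
    (hA : ∀ v ∈ A, coordDefect n d (flowCoord g d φ ψ (θ v, v)) = 0)
    (hL : (coordDefect n d).comp (flowCoordDeriv g d φ ψ (θ w, w)) = 0) :
    HasFDerivWithinAt (fun v => coordPart n d (flowCoord g d φ ψ (θ v, v)))
      (flowPartDeriv g d φ ψ (θ w, w)) A w := by
  have h1 := hasFDerivWithinAt_returnTime hφ hψ hwA hθ hq hA hL
  have hd := ((contDiffAt_flowCoord hφ hψ.1 hq).differentiableAt (by simp)).hasFDerivAt
  have h2 := HasFDerivAt.comp_hasFDerivWithinAt (f := fun v => (θ v, v)) w hd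
    (h1.prodMk (hasFDerivWithinAt_id w A))
  have h3 := (coordPart n d).hasFDerivAt.comp_hasFDerivWithinAt w h2
  refine h3.congr_fderiv (ContinuousLinearMap.ext fun v => ?_)
  simp [flowPartDeriv, flowCoordDeriv]

/-- Change of variables for a return map between two slice charts. -/
theorem lintegral_returnMap_chart (hH : IsEmbeddedSubmanifold (n := n) d H)
    (hφ : IsSliceChart d H φ) (hψ : IsSliceChart d H ψ)
    {A : Set (Rn n)} (hA : MeasurableSet A) (hAφ : A ⊆ paramDomain d φ) {θ : Rn n → ℝ}
    (hθ : ContinuousOn θ A) (hloop : ∀ w ∈ A, conormalParam d φ w ∈ loopSet g d H (θ w))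
    (hover : ∀ w ∈ A, (geodesicFlow g (θ w) (conormalParam d φ w)).1 ∈ ψ.source)
    (hinj : InjOn (fun w => geodesicFlow g (θ w) (conormalParam d φ w)) A) :
    ∃ A' ⊆ paramDomain d ψ, MeasurableSet A' ∧
      (∀ v ∈ A', ∃ w ∈ A, conormalParam d ψ v = geodesicFlow g (θ w) (conormalParam d φ w)) ∧
      ∀ F : Cot n M → ℝ≥0∞, ∫⁻ w in A, ENNReal.ofReal (conormalDensity g d φ w) *
          (ENNReal.ofReal (jacobian g d H (θ w) (conormalParam d φ w)) *
            F (geodesicFlow g (θ w) (conormalParam d φ w))) =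
        ∫⁻ v in A', ENNReal.ofReal (conormalDensity g d ψ v) * F (conormalParam d ψ v) := by
  have hq : ∀ w ∈ A, (θ w, w) ∈ flowDomain g d φ ψ := fun w hw =>
    ⟨hAφ hw, (hloop w hw).1.2.1, hover w hw⟩
  set f : Rn n → Rn n := fun v => coordPart n d (flowCoord g d φ ψ (θ v, v)) with hf
  have hmem := fun w hw => (mem_loopSet_iff hH hφ hψ (hq w hw)).1 (hloop w hw)
  have hf' : ∀ w ∈ A, HasFDerivWithinAt f (flowPartDeriv g d φ ψ (θ w, w)) A w := fun w hw =>
    hasFDerivWithinAt_returnMap hφ hψ hw (hθ w hw) (hq w hw) (fun v hv => (hmem v hv).1)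
      (hmem w hw).2
  have hparam := fun w (hw : w ∈ A) => mem_conormalParam_iff hψ (hloop w hw).2.1 (hover w hw)
  have hfinj : InjOn f A := by
    intro w hw w' hw' h
    refine hinj hw hw' ?_
    simp only
    rw [← (hparam w hw).2, ← (hparam w' hw').2]
    exact congrArg _ h
  refine ⟨f '' A, ?_, measurable_image_of_fderivWithin hA hf' hfinj, ?_, fun F => ?_⟩
  · rintro _ ⟨w, hw, rfl⟩
    exact (hparam w hw).1
  · rintro _ ⟨w, hw, rfl⟩
    exact ⟨w, hw, (hparam w hw).2⟩
  -- The area formula for injective maps needs only derivatives within A. The densities at the two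
  -- ends turn the coordinate determinant into the Jacobian.
  · rw [lintegral_image_eq_lintegral_abs_det_fderiv_mul volume hA hf' hfinj]
    refine setLIntegral_congr_fun hA fun w hw => ?_
    have hJ := jacobian_eq hH hφ hψ (hq w hw) (hparam w hw).1 (hparam w hw).2 (hloop w hw)
    have hp := conormalDensity_pos g hφ.1 (hAφ hw)
    have hfw : f w = conormalCoord d ψ (geodesicFlow g (θ w) (conormalParam d φ w)) := rfl
    rw [hfw, (hparam w hw).2, ← mul_assoc, ← mul_assoc, ← ENNReal.ofReal_mul hp.le,
      ← ENNReal.ofReal_mul (abs_nonneg _), hJ]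
    congr 2
    field_simp

end
end ConormalFlow
end

theorem ContinuousOn.measurableSet_inter_preimage {α β : Type*} [TopologicalSpace α]
    [MeasurableSpace α] [OpensMeasurableSpace α] [TopologicalSpace β] [MeasurableSpace β]
    [BorelSpace β] {f : α → β} {s : Set α} (hf : ContinuousOn f s) (hs : MeasurableSet s)
    {t : Set β} (ht : MeasurableSet t) : MeasurableSet (s ∩ f ⁻¹' t) := by
  have h := (continuousOn_iff_continuous_domRestrict.1 hf).measurable ht
  convert hs.subtype_image h using 1
  ext w
  simp [and_comm]

/-! ### The natural volume of the conormal bundle and its behaviour under return maps. -/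

noncomputable section
namespace ConormalFlow
section
variable {n : ℕ} {M : Type*} [TopologicalSpace M] [ChartedSpace (Rn n) M]
variable [IsManifold 𝓘(ℝ, Rn n) ∞ M]
variable {φ ψ χ : OpenPartialHomeomorph M (Rn n)} {g : Metric n M} {H : Set M} {d : ℕ}

/-- The conormal bundle is locally closed: it is the part of its closure off the zero section. -/
theorem measurableSet_conormal (hH : IsEmbeddedSubmanifold (n := n) d H) (hHc : IsClosed H) :
    MeasurableSet (conormal d H : Set (Cot n M)) := by
  have h : (conormal d H : Set (Cot n M)) = closure (conormal d H) ∩ {z | z.2 ≠ 0} := by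
    refine Subset.antisymm (fun z hz => ⟨subset_closure hz, hz.2.1⟩) ?_
    rintro z ⟨hz, hz0⟩
    have hzH : z.1 ∈ H := closure_minimal (fun w (hw : w ∈ conormal d H) => hw.1)
      (hHc.preimage continuous_proj_cot) hz
    obtain ⟨hφ, hzφ⟩ := sliceChartAt_spec hH hzH
    set φ := sliceChartAt (n := n) d H z.1
    refine (mem_conormal_iff hφ hzφ).2 ⟨hz0, ?_⟩
    have hc : ContinuousAt (fun w => coordDefect n d (canCoord φ w)) z :=
      (coordDefect n d).continuous.continuousAt.comp (continuousAt_canCoord hφ.1 hzφ)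
    by_contra hne
    obtain ⟨w, hw, hw1, hw2⟩ := ((mem_closure_iff_frequently.1 hz).and_eventually
      ((hc.eventually_ne hne).and ((isOpen_over φ).mem_nhds hzφ))).exists
    exact hw1 ((mem_conormal_iff hφ hw2).1 hw).2
  rw [h]
  exact isClosed_closure.measurableSet.inter isOpen_nonzero.measurableSet

theorem continuousAt_radialProj (g : Metric n M) {z : Cot n M} (hz : z.2 ≠ 0) :
    ContinuousAt (radialProj g) z := by
  have hφ : chartAt (Rn n) z.1 ∈ IsManifold.maximalAtlas 𝓘(ℝ, Rn n) ∞ M :=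
    IsManifold.chart_mem_maximalAtlas z.1
  have h0 : z.1 ∈ (chartAt (Rn n) z.1).source := mem_chart_source _ _
  set φ := chartAt (Rn n) z.1
  have hc := continuousAt_canCoord hφ h0
  have hs : ContinuousAt (fun w => (symbol g w)⁻¹) z :=
    (continuous_symbol g).continuousAt.inv₀ (symbol_pos g hz).ne'
  have h1 : ContinuousAt (fun w => canPoint φ ((canCoord φ w).1,
      (symbol g w)⁻¹ • (canCoord φ w).2)) z := by
    refine ContinuousAt.comp (g := canPoint φ)
      (f := fun w => ((canCoord φ w).1, (symbol g w)⁻¹ • (canCoord φ w).2)) ?_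
      (hc.fst.prodMk (hs.smul hc.snd))
    exact (contMDiffAt_canPoint hφ (w := ((canCoord φ z).1, (symbol g z)⁻¹ • (canCoord φ z).2))
      (φ.map_source h0)).continuousAt
  refine h1.congr ?_
  filter_upwards [(isOpen_over φ).mem_nhds h0] with w hw
  exact canPoint_canCoord hφ (z := radialProj g w) hw

theorem radialProj_of_eq_zero (g : Metric n M) {z : Cot n M} (hz : z.2 = 0) :
    radialProj g z = z :=
  congrArg (fun ξ => (⟨z.1, ξ⟩ : Cot n M)) (by rw [hz]; exact smul_zero _)

theorem measurable_radialProj (g : Metric n M) : Measurable (radialProj g) := by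
  classical
  have h : radialProj g = {z : Cot n M | z.2 ≠ 0}.piecewise (radialProj g) id := by
    funext z
    by_cases hz : z.2 = 0
    · rw [piecewise_eq_of_notMem _ _ _ (by simpa using hz), radialProj_of_eq_zero g hz]
      rfl
    · rw [piecewise_eq_of_mem _ _ _ hz]
  rw [h]
  exact ContinuousOn.measurable_piecewise
    (fun z hz => (continuousAt_radialProj g hz).continuousWithinAt) continuousOn_id
    isOpen_nonzero.measurableSet

theorem dilation_symbol_radialProj (g : Metric n M) {z : Cot n M} (hz : z.2 ≠ 0) :
    dilation (symbol g z) (radialProj g z) = z := by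
  rw [radialProj_eq_dilation, dilation_dilation, mul_inv_cancel₀ (symbol_pos g hz).ne',
    dilation_one]

theorem chartVolume_le_conormalVolume (g : Metric n M) (hφ : IsSliceChart d H φ) :
    chartVolume g d φ ≤ conormalVolume g d H :=
  le_iSup (fun φ : {φ : OpenPartialHomeomorph M (Rn n) // IsSliceChart d H φ} =>
    chartVolume g d φ.1) ⟨φ, hφ⟩

variable [T2Space M] [CompactSpace M]

theorem setLIntegral_indicator_conormalParam (hφ : IsSliceChart d H φ) {B : Set (Cot n M)}
    (hB : MeasurableSet B) (c : Rn n → ℝ≥0∞) (K : Cot n M → ℝ≥0∞) :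
    ∫⁻ w in paramDomain d φ, c w * B.indicator K (conormalParam d φ w) =
      ∫⁻ w in paramDomain d φ ∩ conormalParam d φ ⁻¹' B, c w * K (conormalParam d φ w) := by
  rw [← lintegral_indicator measurableSet_paramDomain,
    ← lintegral_indicator (measurableSet_inter_conormalParam hφ hB)]
  congr 1
  funext w
  by_cases h1 : w ∈ paramDomain d φ <;> by_cases h2 : conormalParam d φ w ∈ B <;>
    simp [h1, h2]

/-- Changing the slice chart is the return map with constant time 0, whose Jacobian is 1. -/
theorem chartVolume_apply_le (hH : IsEmbeddedSubmanifold (n := n) d H) (hφ : IsSliceChart d H φ)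
    (hψ : IsSliceChart d H ψ) {E : Set (Cot n M)} (hE : MeasurableSet E) (hEc : E ⊆ conormal d H)
    (hEφ : ∀ z ∈ E, z.1 ∈ φ.source) : chartVolume g d ψ E ≤ chartVolume g d φ E := by
  set A := paramDomain d ψ ∩ conormalParam d ψ ⁻¹' E with hA
  have hAm : MeasurableSet A := measurableSet_inter_conormalParam hψ hE
  obtain ⟨A', hA', hA'm, -, hint⟩ := lintegral_returnMap_chart (g := g) hH hψ hφ hAm
    inter_subset_left (θ := fun _ => 0) continuousOn_const
    (fun w hw => mem_loopSet_zero hH (hEc hw.2))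
    (fun w hw => by rw [geodesicFlow_zero]; exact hEφ _ hw.2)
    (fun w hw w' hw' h => by
      simp only [geodesicFlow_zero] at h
      rw [← conormalCoord_conormalParam hψ hw.1, h, conormalCoord_conormalParam hψ hw'.1])
  have hF : Measurable (E.indicator (1 : Cot n M → ℝ≥0∞)) := measurable_one.indicator hE
  rw [← lintegral_indicator_one hE, ← lintegral_indicator_one hE,
    lintegral_chartVolume g hψ hF, lintegral_chartVolume g hφ hF]
  calc ∫⁻ w in paramDomain d ψ, ENNReal.ofReal (conormalDensity g d ψ w) *
        E.indicator 1 (conormalParam d ψ w)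
      = ∫⁻ w in A, ENNReal.ofReal (conormalDensity g d ψ w) *
          (ENNReal.ofReal (jacobian g d H 0 (conormalParam d ψ w)) *
            E.indicator 1 (geodesicFlow g 0 (conormalParam d ψ w))) := by
        rw [setLIntegral_indicator_conormalParam hψ hE]
        refine setLIntegral_congr_fun hAm fun w hw => ?_
        have hwE : conormalParam d ψ w ∈ E := hw.2
        simp only [jacobian_zero hH (hEc hwE), geodesicFlow_zero, indicator_of_mem hwE]
        simp
    _ ≤ _ := by
        rw [hint]
        exact lintegral_mono_set hA'

theorem conormalVolume_apply_le (hH : IsEmbeddedSubmanifold (n := n) d H) (hHc : IsClosed H)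
    (hφ : IsSliceChart d H φ) {E : Set (Cot n M)} (hE : MeasurableSet E) (hEc : E ⊆ conormal d H)
    (hEφ : ∀ z ∈ E, z.1 ∈ φ.source) : conormalVolume g d H E ≤ chartVolume g d φ E := by
  set S : Set (Cot n M) := conormal d H ∩ {z | z.1 ∈ φ.source} with hS
  have hSm : MeasurableSet S := (measurableSet_conormal hH hHc).inter (isOpen_over φ).measurableSet
  -- A supremum of measures cannot be evaluated set by set, so a single measure dominating every
  -- chart volume is exhibited: the volume of φ plus a measure that is infinite on every nonempty
  -- set outside S. The latter does not charge E.
  have hle : conormalVolume g d H ≤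
      chartVolume g d φ + ((⊤ : ℝ≥0∞) • Measure.count).restrict Sᶜ := by
    refine iSup_le fun ψ => Measure.le_iff.2 fun F hF => ?_
    rw [Measure.add_apply, Measure.restrict_apply hF]
    by_cases hFS : F ⊆ S
    · exact (chartVolume_apply_le hH hφ ψ.2 hF (fun z hz => (hFS hz).1)
        fun z hz => (hFS hz).2).trans le_self_add
    · obtain ⟨z, hz, hzS⟩ := not_subset.1 hFS
      have h1 : Measure.count (F ∩ Sᶜ) ≠ 0 := fun h0 => by
        rw [Measure.count_eq_zero_iff] at h0
        exact h0.subset ⟨hz, hzS⟩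
      rw [Measure.smul_apply, smul_eq_mul, ENNReal.top_mul h1, add_top]
      exact le_top
  refine (hle E).trans ?_
  rw [Measure.add_apply, Measure.restrict_apply hE]
  have : E ∩ Sᶜ = ∅ := by
    rw [← Set.sdiff_eq, Set.sdiff_eq_empty]
    exact fun z hz => ⟨hEc hz, hEφ z hz⟩
  simp [this]

theorem setLIntegral_conormalVolume_le (hH : IsEmbeddedSubmanifold (n := n) d H)
    (hHc : IsClosed H) (hφ : IsSliceChart d H φ) {B : Set (Cot n M)} (hB : MeasurableSet B)
    (hBc : B ⊆ conormal d H) (hBφ : ∀ z ∈ B, z.1 ∈ φ.source) (K : Cot n M → ℝ≥0∞) :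
    ∫⁻ z in B, K z ∂(conormalVolume g d H) ≤
      ∫⁻ w in paramDomain d φ ∩ conormalParam d φ ⁻¹' B,
        ENNReal.ofReal (conormalDensity g d φ w) * K (conormalParam d φ w) := by
  have hle : (conormalVolume g d H).restrict B ≤ (chartVolume g d φ).restrict B := by
    refine Measure.le_iff.2 fun E hE => ?_
    rw [Measure.restrict_apply hE, Measure.restrict_apply hE]
    exact conormalVolume_apply_le hH hHc hφ (hE.inter hB) (fun z hz => hBc hz.2)
      fun z hz => hBφ z hz.2
  refine (lintegral_mono' hle le_rfl).trans ?_
  rw [← lintegral_indicator hB, ← setLIntegral_indicator_conormalParam hφ hB]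
  exact lintegral_chartVolume_le g hφ _

/-- Change of variables for a return map into one slice chart. -/
theorem tsum_setLIntegral_returnMap_le (hH : IsEmbeddedSubmanifold (n := n) d H)
    (hHc : IsClosed H) {ι : Type*} [Countable ι] {φ : ι → OpenPartialHomeomorph M (Rn n)}
    (hφ : ∀ i, IsSliceChart d H (φ i)) (hψ : IsSliceChart d H ψ) {B : ι → Set (Cot n M)}
    (hB : ∀ i, MeasurableSet (B i)) (hBd : Pairwise (Function.onFun Disjoint B))
    (hBφ : ∀ i, ∀ z ∈ B i, z.1 ∈ (φ i).source) {θ : Cot n M → ℝ}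
    (hθ : ∀ i, ContinuousOn θ (B i)) (hloop : ∀ i, ∀ z ∈ B i, z ∈ loopSet g d H (θ z))
    (hover : ∀ i, ∀ z ∈ B i, (geodesicFlow g (θ z) z).1 ∈ ψ.source)
    (hinj : InjOn (fun z => geodesicFlow g (θ z) z) (⋃ i, B i)) {F : Cot n M → ℝ≥0∞}
    (hF : Measurable F) :
    ∑' i, ∫⁻ z in B i, ENNReal.ofReal (jacobian g d H (θ z) z) * F (geodesicFlow g (θ z) z)
      ∂(conormalVolume g d H) ≤ ∫⁻ z, F z ∂(conormalVolume g d H) := by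
  have hchart := fun i => lintegral_returnMap_chart (g := g) hH (hφ i) hψ
    (measurableSet_inter_conormalParam (hφ i) (hB i)) inter_subset_left
    (θ := fun w => θ (conormalParam d (φ i) w))
    ((hθ i).comp ((continuousOn_conormalParam (hφ i)).mono inter_subset_left) fun w hw => hw.2)
    (fun w hw => hloop i _ hw.2) (fun w hw => hover i _ hw.2)
    (fun w hw w' hw' h => by
      have h2 := hinj (mem_iUnion.2 ⟨i, hw.2⟩) (mem_iUnion.2 ⟨i, hw'.2⟩) h
      rw [← conormalCoord_conormalParam (hφ i) hw.1, h2,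
        conormalCoord_conormalParam (hφ i) hw'.1])
  choose A' hA' hA'm hA'B hint using hchart
  -- The coordinate images of the disjoint pieces are disjoint since the return map is injective on
  -- their union.
  have hdisj : Pairwise (Function.onFun Disjoint A') := by
    intro i j hij
    refine disjoint_left.2 fun v hvi hvj => ?_
    obtain ⟨w, hw, h1⟩ := hA'B i v hvi
    obtain ⟨w', hw', h2⟩ := hA'B j v hvj
    have h3 := hinj (mem_iUnion.2 ⟨i, hw.2⟩) (mem_iUnion.2 ⟨j, hw'.2⟩) (h1.symm.trans h2)
    exact disjoint_left.1 (hBd hij) hw.2 (h3 ▸ hw'.2)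
  calc ∑' i, ∫⁻ z in B i, ENNReal.ofReal (jacobian g d H (θ z) z) *
        F (geodesicFlow g (θ z) z) ∂(conormalVolume g d H)
      ≤ ∑' i, ∫⁻ v in A' i, ENNReal.ofReal (conormalDensity g d ψ v) *
          F (conormalParam d ψ v) := by
        refine ENNReal.tsum_le_tsum fun i => ?_
        rw [← hint i F]
        exact setLIntegral_conormalVolume_le hH hHc (hφ i) (hB i) (fun z hz => (hloop i z hz).1)
          (hBφ i) _
    _ = ∫⁻ v in ⋃ i, A' i, ENNReal.ofReal (conormalDensity g d ψ v) * F (conormalParam d ψ v) :=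
        (lintegral_iUnion hA'm hdisj _).symm
    _ ≤ ∫⁻ v in paramDomain d ψ, ENNReal.ofReal (conormalDensity g d ψ v) *
          F (conormalParam d ψ v) := lintegral_mono_set (iUnion_subset hA')
    _ = ∫⁻ z, F z ∂(chartVolume g d ψ) := (lintegral_chartVolume g hψ hF).symm
    _ ≤ _ := lintegral_mono' (chartVolume_le_conormalVolume g hψ) le_rfl

theorem exists_sliceCharts (hH : IsEmbeddedSubmanifold (n := n) d H) (hHc : IsCompact H)
    (hne : H.Nonempty) : ∃ φ : ℕ → OpenPartialHomeomorph M (Rn n),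
      (∀ k, IsSliceChart d H (φ k)) ∧ ∀ x ∈ H, ∃ k, x ∈ (φ k).source := by
  obtain ⟨t, ht, htc⟩ := hHc.elim_nhds_subcover (fun x => (sliceChartAt (n := n) d H x).source)
    fun x hx => (sliceChartAt (n := n) d H x).open_source.mem_nhds (sliceChartAt_spec hH hx).2
  have htne : (t : Set M).Nonempty := by
    obtain ⟨x, hx⟩ := hne
    obtain ⟨y, hy, -⟩ := mem_iUnion₂.1 (htc hx)
    exact ⟨y, hy⟩
  obtain ⟨f, hf⟩ := t.countable_toSet.exists_eq_range htne
  refine ⟨fun k => sliceChartAt d H (f k), fun k => (sliceChartAt_spec hH (ht _ ?_)).1,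
    fun x hx => ?_⟩
  · have : f k ∈ (t : Set M) := hf ▸ mem_range_self k
    exact this
  · obtain ⟨y, hy, hxy⟩ := mem_iUnion₂.1 (htc hx)
    have hy' : y ∈ range f := hf ▸ hy
    obtain ⟨k, rfl⟩ := hy'
    exact ⟨k, hxy⟩

/-- Change of variables for a return map of the conormal bundle. -/
theorem setLIntegral_returnMap_le (hH : IsEmbeddedSubmanifold (n := n) d H)
    (hHc : IsCompact H) {B : Set (Cot n M)} (hB : MeasurableSet B) {θ : Cot n M → ℝ}
    (hloop : ∀ z ∈ B, z ∈ loopSet g d H (θ z))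
    (hinj : InjOn (fun z => geodesicFlow g (θ z) z) B) {C : ℕ → Set (Cot n M)}
    (hC : ∀ k, MeasurableSet (C k)) (hBC : B ⊆ ⋃ k, C k) (hθ : ∀ k, ContinuousOn θ (B ∩ C k))
    {F : Cot n M → ℝ≥0∞} (hF : Measurable F) :
    ∫⁻ z in B, ENNReal.ofReal (jacobian g d H (θ z) z) * F (geodesicFlow g (θ z) z)
      ∂(conormalVolume g d H) ≤ ∫⁻ z, F z ∂(conormalVolume g d H) := by
  rcases H.eq_empty_or_nonempty with hemp | hne
  · have : B = ∅ := eq_empty_of_forall_notMem fun z hz => by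
      have := (hloop z hz).1.1
      rw [hemp] at this
      exact this
    simp [this]
  obtain ⟨φ, hφ, hφH⟩ := exists_sliceCharts hH hHc hne
  set R : ℕ → Set (Cot n M) := disjointed fun k => {z | z.1 ∈ (φ k).source} with hR
  have hRm : ∀ k, MeasurableSet (R k) := fun k =>
    MeasurableSet.disjointed (fun k => (isOpen_over (φ k)).measurableSet) k
  have hRsub : ∀ k, ∀ z ∈ R k, z.1 ∈ (φ k).source := fun k z hz =>
    disjointed_subset (fun k => {z : Cot n M | z.1 ∈ (φ k).source}) k hz
  have hRcov : ∀ z : Cot n M, z.1 ∈ H → ∃ k, z ∈ R k := by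
    intro z hz
    obtain ⟨k, hk⟩ := hφH z.1 hz
    have : z ∈ ⋃ k, R k := by
      rw [hR, iUnion_disjointed]
      exact mem_iUnion.2 ⟨k, hk⟩
    exact mem_iUnion.1 this
  have hRd : Pairwise (Function.onFun Disjoint R) := disjoint_disjointed _
  set D : ℕ → Set (Cot n M) := disjointed C with hD
  have hDm : ∀ k, MeasurableSet (D k) := fun k => MeasurableSet.disjointed hC k
  have hDd : Pairwise (Function.onFun Disjoint D) := disjoint_disjointed _
  have hθD : ∀ k, ContinuousOn θ (B ∩ D k) := fun k =>
    (hθ k).mono (inter_subset_inter_right _ (disjointed_subset _ _))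
  have hΦD : ∀ k, ContinuousOn (fun z => geodesicFlow g (θ z) z) (B ∩ D k) := by
    intro k z hz
    exact ContinuousAt.comp_continuousWithinAt (f := fun z => (θ z, z))
      (g := fun q : ℝ × Cot n M => geodesicFlow g q.1 q.2)
      (continuousAt_geodesicFlow g (θ z) (hloop z hz.1).1.2.1)
      ((hθD k z hz).prodMk continuousWithinAt_id)
  -- Here j is the chart in which the return lands, while i records the starting chart and the piece
  -- on which the return time is continuous. Pieces with the same j are added in one target chart,
  -- and the disjoint targets R j together give at most the integral of F.
  set P : ℕ → ℕ × ℕ → Set (Cot n M) := fun j i =>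
    (B ∩ D i.2 ∩ (fun z => geodesicFlow g (θ z) z) ⁻¹' R j) ∩ R i.1 with hP
  have hPm : ∀ j i, MeasurableSet (P j i) := fun j i =>
    ((hΦD i.2).measurableSet_inter_preimage (hB.inter (hDm i.2)) (hRm j)).inter (hRm i.1)
  have hPd : ∀ j, Pairwise (Function.onFun Disjoint (P j)) := by
    intro j i i' hii'
    refine disjoint_left.2 fun z hz hz' => hii' ?_
    refine Prod.ext ?_ ?_
    · by_contra h
      exact disjoint_left.1 (hRd h) hz.2 hz'.2
    · by_contra h
      exact disjoint_left.1 (hDd h) hz.1.1.2 hz'.1.1.2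
  have hBP : B = ⋃ j, ⋃ i, P j i := by
    ext z
    simp only [mem_iUnion]
    refine ⟨fun hz => ?_, fun ⟨j, i, hz⟩ => hz.1.1.1⟩
    obtain ⟨k, hk⟩ := mem_iUnion.1 (hBC hz)
    have hzD : z ∈ ⋃ k, D k := by
      rw [hD, iUnion_disjointed]
      exact mem_iUnion.2 ⟨k, hk⟩
    obtain ⟨k', hk'⟩ := mem_iUnion.1 hzD
    obtain ⟨i, hi⟩ := hRcov z (hloop z hz).1.1
    obtain ⟨j, hj⟩ := hRcov _ (hloop z hz).2.1.1
    exact ⟨j, (i, k'), ⟨⟨hz, hk'⟩, hj⟩, hi⟩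
  have hQd : Pairwise (Function.onFun Disjoint fun j => ⋃ i, P j i) := by
    intro j j' hjj'
    refine disjoint_left.2 fun z hz hz' => ?_
    obtain ⟨i, hi⟩ := mem_iUnion.1 hz
    obtain ⟨i', hi'⟩ := mem_iUnion.1 hz'
    exact disjoint_left.1 (hRd hjj') hi.1.2 hi'.1.2
  conv_lhs => rw [hBP]
  rw [lintegral_iUnion (fun j => MeasurableSet.iUnion (hPm j)) hQd]
  calc ∑' j, ∫⁻ z in ⋃ i, P j i, ENNReal.ofReal (jacobian g d H (θ z) z) *
        F (geodesicFlow g (θ z) z) ∂(conormalVolume g d H)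
      ≤ ∑' j, ∫⁻ z in R j, F z ∂(conormalVolume g d H) := by
        refine ENNReal.tsum_le_tsum fun j => ?_
        rw [lintegral_iUnion (hPm j) (hPd j), ← lintegral_indicator (hRm j)]
        refine le_trans (le_of_eq ?_) (tsum_setLIntegral_returnMap_le hH hHc.isClosed
          (φ := fun i : ℕ × ℕ => φ i.1) (fun i => hφ i.1) (hφ j) (hPm j) (hPd j)
          (fun i z hz => hRsub _ z hz.2) (θ := θ)
          (fun i => (hθD i.2).mono fun z hz => hz.1.1) (fun i z hz => hloop z hz.1.1.1)
          (fun i z hz => hRsub _ _ hz.1.2)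
          (hinj.mono (iUnion_subset fun i z hz => hz.1.1.1)) (hF.indicator (hRm j)))
        refine tsum_congr fun i => setLIntegral_congr_fun (hPm j i) fun z hz => ?_
        have : geodesicFlow g (θ z) z ∈ R j := hz.1.2
        simp only [indicator_of_mem this]
    _ = ∫⁻ z in ⋃ j, R j, F z ∂(conormalVolume g d H) := (lintegral_iUnion hRm hRd _).symm
    _ ≤ _ := setLIntegral_le_lintegral _ _

end
end ConormalFlow
end

/-! ### The Leray measure of SN*H: finiteness and change of variables. -/

noncomputable section
namespace ConormalFlow
section
variable {n : ℕ} {M : Type*} [TopologicalSpace M] [ChartedSpace (Rn n) M]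
variable [IsManifold 𝓘(ℝ, Rn n) ∞ M]
variable {φ ψ χ : OpenPartialHomeomorph M (Rn n)} {g : Metric n M} {H : Set M} {d : ℕ}

/-- The part of the conormal bundle where `p ≤ 1`. -/
def conormalBall (g : Metric n M) (d : ℕ) (H : Set M) : Set (Cot n M) :=
  {z ∈ conormal d H | symbol g z ≤ 1}

theorem measurableSet_conormalBall (hH : IsEmbeddedSubmanifold (n := n) d H) (hHc : IsClosed H) :
    MeasurableSet (conormalBall g d H) :=
  (measurableSet_conormal hH hHc).inter
    ((continuous_symbol g).measurable measurableSet_Iic : MeasurableSet {z | symbol g z ≤ 1})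

theorem lerayMeasure_eq (g : Metric n M) (d : ℕ) (H : Set M) : lerayMeasure g d H =
    ((n - d : ℕ) : ℝ≥0∞) •
      ((conormalVolume g d H).restrict (conormalBall g d H)).map (radialProj g) := rfl

theorem symbol_radialProj (g : Metric n M) {z : Cot n M} (hz : z.2 ≠ 0) :
    symbol g (radialProj g z) = 1 := by
  have hp := symbol_pos g hz
  rw [radialProj_eq_dilation, symbol_dilation g (inv_pos.2 hp), inv_mul_cancel₀ hp.ne']

theorem dilation_mem_conormal {r : ℝ} (hr : r ≠ 0)
    {z : Cot n M} (hz : z ∈ conormal d H) : dilation r z ∈ conormal d H := by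
  refine ⟨hz.1, smul_ne_zero hr hz.2.1, fun φ hφ hzφ i hi => ?_⟩
  have h := hz.2.2 φ hφ hzφ i hi
  change r • z.2 (frame φ z.1 i) = 0
  rw [h, smul_zero]

theorem radialProj_mem_unitConormal {z : Cot n M} (hz : z ∈ conormal d H) : radialProj g z ∈ unitConormal g d H :=
  ⟨dilation_mem_conormal (inv_ne_zero (symbol_pos g hz.2.1).ne') hz, symbol_radialProj g hz.2.1⟩

theorem lintegral_lerayMeasure (g : Metric n M) (d : ℕ) (H : Set M) {F : Cot n M → ℝ≥0∞}
    (hF : Measurable F) : ∫⁻ z, F z ∂(lerayMeasure g d H) =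
      ((n - d : ℕ) : ℝ≥0∞) * ∫⁻ z in conormalBall g d H, F (radialProj g z)
        ∂(conormalVolume g d H) := by
  rw [lerayMeasure_eq, lintegral_smul_measure, lintegral_map hF (measurable_radialProj g),
    smul_eq_mul]

theorem setLIntegral_lerayMeasure_le (g : Metric n M) (d : ℕ) (H : Set M) {B : Set (Cot n M)}
    (hB : MeasurableSet B) (F : Cot n M → ℝ≥0∞) : ∫⁻ z in B, F z ∂(lerayMeasure g d H) ≤
      ((n - d : ℕ) : ℝ≥0∞) * ∫⁻ z in radialProj g ⁻¹' B ∩ conormalBall g d H, F (radialProj g z)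
        ∂(conormalVolume g d H) := by
  rw [lerayMeasure_eq, Measure.restrict_smul, lintegral_smul_measure, smul_eq_mul,
    Measure.restrict_map (measurable_radialProj g) hB,
    Measure.restrict_restrict (measurable_radialProj g hB)]
  refine mul_le_mul' le_rfl ?_
  exact lintegral_map_le F (radialProj g)

theorem measurableSet_unitConormal (hH : IsEmbeddedSubmanifold (n := n) d H) (hHc : IsClosed H) :
    MeasurableSet (unitConormal g d H) :=
  (measurableSet_conormal hH hHc).inter ((continuous_symbol g).measurable
    (measurableSet_singleton 1) : MeasurableSet {z | symbol g z = 1})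

theorem ae_mem_unitConormal (hH : IsEmbeddedSubmanifold (n := n) d H) (hHc : IsClosed H) :
    ∀ᵐ z ∂(lerayMeasure g d H), z ∈ unitConormal g d H := by
  rw [lerayMeasure_eq]
  have h := (ae_map_iff (μ := (conormalVolume g d H).restrict (conormalBall g d H))
    (measurable_radialProj g).aemeasurable (measurableSet_unitConormal (g := g) hH hHc)).2
    (ae_restrict_of_forall_mem (measurableSet_conormalBall hH hHc)
      fun z hz => radialProj_mem_unitConormal hz.1)
  exact Measure.ae_smul_measure h _

variable [T2Space M] [CompactSpace M]

/-- Over a compact piece of a slice chart the covectors with p ≤ 1 fill a compact set, on which the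
continuous density is integrable; finitely many such pieces cover H. Finiteness puts the constant
function 1 into L². -/
theorem isFiniteMeasure_lerayMeasure (hH : IsEmbeddedSubmanifold (n := n) d H)
    (hHc : IsCompact H) : IsFiniteMeasure (lerayMeasure g d H) := by
  have hloc : ∀ x ∈ H, ∃ U : Set M, IsOpen U ∧ x ∈ U ∧ conormalVolume g d H
      (conormalBall g d H ∩ {z | z.1 ∈ U}) < ⊤ := by
    intro x hx
    obtain ⟨hφ, hxφ⟩ := sliceChartAt_spec hH hx
    set φ := sliceChartAt (n := n) d H x
    obtain ⟨K, hKn, hKt, hK⟩ := local_compact_nhds (φ.open_target.mem_nhds (φ.map_source hxφ))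
    obtain ⟨Q, hQ, hQt, hQs⟩ := isCompact_sublevel_over g hφ.1 hK hKt 1
    refine ⟨φ.source ∩ φ ⁻¹' interior K, φ.isOpen_inter_preimage isOpen_interior,
      ⟨hxφ, mem_interior_iff_mem_nhds.2 hKn⟩, ?_⟩
    set U := φ.source ∩ φ ⁻¹' interior K
    have hUo : IsOpen U := φ.isOpen_inter_preimage isOpen_interior
    set E := conormalBall g d H ∩ {z : Cot n M | z.1 ∈ U}
    have hEm : MeasurableSet E := (measurableSet_conormalBall hH hHc.isClosed).inter
      (hUo.preimage continuous_proj_cot).measurableSet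
    set P : Set (Rn n) := coordPart n d '' (Q ∩ {w | coordDefect n d w = 0})
    have hP : IsCompact P := (hQ.inter_right (isClosed_eq (coordDefect n d).continuous
      continuous_const)).image (coordPart n d).continuous
    have hPd : P ⊆ paramDomain d φ := by
      rintro _ ⟨w, ⟨hw, hw0⟩, rfl⟩
      rw [mem_paramDomain, coordEmb_coordPart hw0]
      exact hQt hw
    have hEP : paramDomain d φ ∩ conormalParam d φ ⁻¹' E ⊆ P := by
      rintro w ⟨hw, hwE⟩
      have hemb := canCoord_conormalParam hφ hw
      refine ⟨coordEmb n d w, ⟨hQs _ ?_ ?_, coordDefect_coordEmb w⟩, coordPart_coordEmb w⟩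
      · rw [← hemb]
        exact interior_subset hwE.2.2
      · rw [← hemb, ← symbol_eq_symbolCoord g hφ.1 (conormalParam_mem_source hw)]
        exact hwE.1.2
    have hint : IntegrableOn (conormalDensity g d φ) P volume :=
      ((continuousOn_conormalDensity g hφ.1).mono hPd).integrableOn_compact hP
    calc conormalVolume g d H E = ∫⁻ z in E, 1 ∂(conormalVolume g d H) := by simp
      _ ≤ _ := setLIntegral_conormalVolume_le hH hHc.isClosed hφ hEm (fun z hz => hz.1.1)
          (fun z hz => hz.2.1) _
      _ ≤ ∫⁻ w in P, ENNReal.ofReal (conormalDensity g d φ w) := by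
          simp only [mul_one]
          exact lintegral_mono_set hEP
      _ < ⊤ := hint.lintegral_lt_top
  choose! U hUo hxU hU using hloc
  obtain ⟨t, ht, htc⟩ := hHc.elim_nhds_subcover U fun x hx => (hUo x hx).mem_nhds (hxU x hx)
  have hfin : conormalVolume g d H (conormalBall g d H) < ⊤ := by
    refine (measure_mono (t := ⋃ x ∈ t, conormalBall g d H ∩ {z | z.1 ∈ U x}) fun z hz => ?_).trans_lt
      ((measure_biUnion_finset_le _ _).trans_lt (ENNReal.sum_lt_top.2 fun x hx => hU x (ht x hx)))
    obtain ⟨x, hx, hzx⟩ := mem_iUnion₂.1 (htc hz.1.1)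
    exact mem_iUnion₂.2 ⟨x, hx, hz, hzx⟩
  refine ⟨?_⟩
  rw [lerayMeasure_eq, Measure.smul_apply, Measure.map_apply (measurable_radialProj g)
    MeasurableSet.univ, preimage_univ, Measure.restrict_apply_univ, smul_eq_mul]
  exact ENNReal.mul_lt_top (ENNReal.natCast_lt_top _) hfin

/-- Change of variables for a return map of the unit conormal bundle. -/
theorem setLIntegral_unit_returnMap_le (hH : IsEmbeddedSubmanifold (n := n) d H)
    (hHc : IsCompact H) {B : Set (Cot n M)} (hB : MeasurableSet B) {θ : Cot n M → ℝ}
    (hloop : ∀ z ∈ B, z ∈ unitLoopSet g d H (θ z))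
    (hinj : InjOn (fun z => geodesicFlow g (θ z) z) B) {C : ℕ → Set (Cot n M)}
    (hC : ∀ k, MeasurableSet (C k)) (hBC : B ⊆ ⋃ k, C k) (hθ : ∀ k, ContinuousOn θ (B ∩ C k))
    {F : Cot n M → ℝ≥0∞} (hF : Measurable F) :
    ∫⁻ z in B, ENNReal.ofReal (jacobian g d H (θ z) z) * F (geodesicFlow g (θ z) z)
      ∂(lerayMeasure g d H) ≤ ∫⁻ z, F z ∂(lerayMeasure g d H) := by
  have hKm := measurableSet_conormalBall (g := g) hH hHc.isClosed
  set K := conormalBall g d H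
  set B' := radialProj g ⁻¹' B ∩ K with hB'
  have hB'm : MeasurableSet B' := (measurable_radialProj g hB).inter hKm
  -- The return time is extended to the cone p ≤ 1 to be homogeneous of degree 0. This is legitimate
  -- because the loop sets are conic, J_t has degree 0 and the flow commutes with dilations and
  -- preserves p, so the change of variables for the volume passes to the Leray measure.
  set θ' : Cot n M → ℝ := fun z => θ (radialProj g z) with hθ'
  have hloop' : ∀ z ∈ B', z ∈ loopSet g d H (θ' z) ∧
      jacobian g d H (θ' z) z = jacobian g d H (θ (radialProj g z)) (radialProj g z) := by
    intro z hz
    have h0 : z.2 ≠ 0 := hz.2.1.2.1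
    have h1 := dilation_mem_loopSet_and_jacobian hH (symbol_pos g h0) (hloop _ hz.1).1
    rwa [dilation_symbol_radialProj g h0] at h1
  have hrad : ∀ z ∈ B', radialProj g (geodesicFlow g (θ' z) z) =
      geodesicFlow g (θ (radialProj g z)) (radialProj g z) := by
    intro z hz
    have h0 : z.2 ≠ 0 := hz.2.1.2.1
    rw [radialProj_eq_dilation, symbol_geodesicFlow, radialProj_eq_dilation,
      geodesicFlow_dilation g (inv_pos.2 (symbol_pos g h0))]
    rfl
  have hinj' : InjOn (fun z => geodesicFlow g (θ' z) z) B' := by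
    intro z hz z' hz' h
    simp only at h
    have h1 : symbol g z = symbol g z' := by
      rw [← symbol_geodesicFlow g (θ' z) z, h, symbol_geodesicFlow]
    have h2 : radialProj g z = radialProj g z' :=
      hinj hz.1 hz'.1 (by simp only; rw [← hrad z hz, h, hrad z' hz'])
    rw [← dilation_symbol_radialProj g hz.2.1.2.1, h1, h2, dilation_symbol_radialProj g hz'.2.1.2.1]
  have hFm : Measurable (K.indicator fun z => F (radialProj g z)) :=
    (hF.comp (measurable_radialProj g)).indicator hKm
  have key := setLIntegral_returnMap_le hH hHc hB'm (fun z hz => (hloop' z hz).1) hinj'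
    (C := fun k => radialProj g ⁻¹' C k) (fun k => measurable_radialProj g (hC k))
    (fun z hz => by
      obtain ⟨k, hk⟩ := mem_iUnion.1 (hBC hz.1)
      exact mem_iUnion.2 ⟨k, hk⟩)
    (fun k => (hθ k).comp (fun z hz => (continuousAt_radialProj g
      hz.1.2.1.2.1).continuousWithinAt) fun z hz => ⟨hz.1.1, hz.2⟩) hFm
  refine (setLIntegral_lerayMeasure_le g d H hB _).trans ?_
  rw [lintegral_lerayMeasure g d H hF]
  refine mul_le_mul' le_rfl ?_
  rw [lintegral_indicator hKm] at key
  refine le_trans (le_of_eq ?_) key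
  refine setLIntegral_congr_fun hB'm fun z hz => ?_
  have hmem : geodesicFlow g (θ' z) z ∈ K :=
    ⟨(hloop' z hz).1.2.1, by rw [symbol_geodesicFlow]; exact hz.2.2⟩
  simp only [indicator_of_mem hmem, (hloop' z hz).2, hrad z hz]

end
end ConormalFlow
end

/-! ### Weighted composition operators on L² and the mean ergodic theorem. -/

namespace WeightedTransfer

section
variable {α : Type*} {w : α → ℝ} {Φ : α → α}

/-- The weighted composition operator `f ↦ w · f ∘ Φ`. -/
def transfer (w : α → ℝ) (Φ : α → α) (f : α → ℝ) : α → ℝ := fun z => w z * f (Φ z)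

/-- The iterates on the constant function `1` of the weighted composition operator. -/
def iterates (w : α → ℝ) (Φ : α → α) : ℕ → α → ℝ
  | 0 => fun _ => 1
  | k + 1 => transfer w Φ (iterates w Φ k)

theorem iterates_nonneg (hw0 : ∀ z, 0 ≤ w z) (k : ℕ) (z : α) : 0 ≤ iterates w Φ k z := by
  induction k generalizing z with
  | zero => exact zero_le_one
  | succ k ih => exact mul_nonneg (hw0 z) (ih _)

variable [MeasurableSpace α] {μ : Measure α}

theorem measurable_iterates (hw : Measurable w) (hΦ : Measurable Φ) (k : ℕ) :
    Measurable (iterates w Φ k) := by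
  induction k with
  | zero => exact measurable_const
  | succ k ih => exact hw.mul (ih.comp hΦ)

/-- The map Φ may carry a set of positive measure into a null set N. The integral inequality for the
indicator of N shows that the weight vanishes almost everywhere on the preimage of N, so the
operator is well defined on classes. -/
theorem transfer_congr_ae (hcov : ∀ F : α → ℝ≥0∞, Measurable F →
    ∫⁻ z, ENNReal.ofReal (w z ^ 2) * F (Φ z) ∂μ ≤ ∫⁻ z, F z ∂μ) (hw : Measurable w)
    (hΦ : Measurable Φ) {f f' : α → ℝ} (h : f =ᵐ[μ] f') : transfer w Φ f =ᵐ[μ] transfer w Φ f' := by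
  have hN := measure_toMeasurable {z | f z ≠ f' z} (μ := μ)
  set N := toMeasurable μ {z | f z ≠ f' z}
  have hNm : MeasurableSet N := measurableSet_toMeasurable _ _
  have hF : Measurable (N.indicator (1 : α → ℝ≥0∞)) := measurable_one.indicator hNm
  have h1 := hcov _ hF
  rw [lintegral_indicator_one hNm, hN, show μ {z | f z ≠ f' z} = 0 from h, nonpos_iff_eq_zero]
    at h1
  have h2 := (lintegral_eq_zero_iff (((hw.pow_const 2).ennreal_ofReal).mul (hF.comp hΦ))).1 h1
  filter_upwards [h2] with z hz
  by_cases hzN : Φ z ∈ N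
  · have h2 : ENNReal.ofReal (w z ^ 2) = 0 := by simpa [hzN] using hz
    have h3 : w z = 0 := pow_eq_zero_iff (two_ne_zero) |>.1
      (le_antisymm (ENNReal.ofReal_eq_zero.1 h2) (sq_nonneg _))
    simp [transfer, h3]
  · have : f (Φ z) = f' (Φ z) := by
      by_contra hne
      exact hzN (subset_toMeasurable μ _ hne)
    simp [transfer, this]

/-- This is the integral inequality with F = |f|². -/
theorem eLpNorm_transfer_le (hcov : ∀ F : α → ℝ≥0∞, Measurable F →
    ∫⁻ z, ENNReal.ofReal (w z ^ 2) * F (Φ z) ∂μ ≤ ∫⁻ z, F z ∂μ) {f : α → ℝ} (hf : Measurable f) :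
    eLpNorm (transfer w Φ f) 2 μ ≤ eLpNorm f 2 μ := by
  rw [eLpNorm_eq_lintegral_rpow_enorm_toReal two_ne_zero ENNReal.ofNat_ne_top,
    eLpNorm_eq_lintegral_rpow_enorm_toReal two_ne_zero ENNReal.ofNat_ne_top]
  refine ENNReal.rpow_le_rpow (le_trans (le_of_eq ?_) (hcov _ (hf.enorm.pow_const _))) (by simp)
  refine lintegral_congr fun z => ?_
  rw [transfer, enorm_mul, ENNReal.mul_rpow_of_nonneg _ _ (by simp)]
  congr 1
  rw [← Real.enorm_eq_ofReal (sq_nonneg _), enorm_pow]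
  simp

theorem memLp_transfer (hcov : ∀ F : α → ℝ≥0∞, Measurable F →
    ∫⁻ z, ENNReal.ofReal (w z ^ 2) * F (Φ z) ∂μ ≤ ∫⁻ z, F z ∂μ) (hw : Measurable w)
    (hΦ : Measurable Φ) {f : α → ℝ} (hf : Measurable f) (hfp : MemLp f 2 μ) :
    MemLp (transfer w Φ f) 2 μ :=
  ⟨(hw.mul (hf.comp hΦ)).aestronglyMeasurable, (eLpNorm_transfer_le hcov hf).trans_lt hfp.2⟩

theorem memLp_iterates [IsFiniteMeasure μ] (hcov : ∀ F : α → ℝ≥0∞, Measurable F →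
    ∫⁻ z, ENNReal.ofReal (w z ^ 2) * F (Φ z) ∂μ ≤ ∫⁻ z, F z ∂μ) (hw : Measurable w)
    (hΦ : Measurable Φ) (k : ℕ) : MemLp (iterates w Φ k) 2 μ := by
  induction k with
  | zero => exact memLp_const 1
  | succ k ih => exact memLp_transfer hcov hw hΦ (measurable_iterates hw hΦ k) ih

theorem integrable_iterates [IsFiniteMeasure μ] (hcov : ∀ F : α → ℝ≥0∞, Measurable F →
    ∫⁻ z, ENNReal.ofReal (w z ^ 2) * F (Φ z) ∂μ ≤ ∫⁻ z, F z ∂μ) (hw : Measurable w)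
    (hΦ : Measurable Φ) (k : ℕ) : Integrable (iterates w Φ k) μ :=
  (memLp_iterates hcov hw hΦ k).integrable one_le_two

/-- The weighted composition operator on `L²`. -/
noncomputable def transferL2 (hcov : ∀ F : α → ℝ≥0∞, Measurable F →
    ∫⁻ z, ENNReal.ofReal (w z ^ 2) * F (Φ z) ∂μ ≤ ∫⁻ z, F z ∂μ) (hw : Measurable w)
    (hΦ : Measurable Φ) : Lp ℝ 2 μ →L[ℝ] Lp ℝ 2 μ :=
  LinearMap.mkContinuous
    { toFun := fun f => (memLp_transfer hcov hw hΦ (Lp.stronglyMeasurable f).measurable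
        (Lp.memLp f)).toLp _
      map_add' := fun f f' => by
        rw [← MemLp.toLp_add, MemLp.toLp_eq_toLp_iff]
        refine (transfer_congr_ae hcov hw hΦ (Lp.coeFn_add f f')).trans (.of_eq ?_)
        ext z
        simp [transfer, mul_add]
      map_smul' := fun c f => by
        rw [← MemLp.toLp_const_smul, MemLp.toLp_eq_toLp_iff]
        refine (transfer_congr_ae hcov hw hΦ (Lp.coeFn_smul c f)).trans (.of_eq ?_)
        ext z
        simp [transfer, mul_left_comm] }
    1 fun f => by
      rw [one_mul]
      change ‖MemLp.toLp _ (memLp_transfer hcov hw hΦ (Lp.stronglyMeasurable f).measurable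
        (Lp.memLp f))‖ ≤ _
      rw [Lp.norm_toLp, Lp.norm_def]
      exact ENNReal.toReal_mono (Lp.eLpNorm_ne_top f)
        (eLpNorm_transfer_le hcov (Lp.stronglyMeasurable f).measurable)

theorem coeFn_transferL2 (hcov : ∀ F : α → ℝ≥0∞, Measurable F →
    ∫⁻ z, ENNReal.ofReal (w z ^ 2) * F (Φ z) ∂μ ≤ ∫⁻ z, F z ∂μ) (hw : Measurable w)
    (hΦ : Measurable Φ) (f : Lp ℝ 2 μ) : transferL2 hcov hw hΦ f =ᵐ[μ] transfer w Φ f :=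
  MemLp.coeFn_toLp (memLp_transfer hcov hw hΦ (Lp.stronglyMeasurable f).measurable (Lp.memLp f))

/-- If the only integrable density invariant under a weighted composition is trivial, then the
integrals of the iterates of the square root operator tend to zero in the mean. -/
theorem tendsto_average_integral_iterates [IsFiniteMeasure μ]
    (hcov : ∀ F : α → ℝ≥0∞, Measurable F →
      ∫⁻ z, ENNReal.ofReal (w z ^ 2) * F (Φ z) ∂μ ≤ ∫⁻ z, F z ∂μ) (hw : Measurable w)
    (hΦ : Measurable Φ)
    (hinv : ∀ f : α → ℝ, Integrable f μ → (∀ z, 0 ≤ f z) →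
      (∀ᵐ z ∂μ, f z = w z ^ 2 * f (Φ z)) → ∀ᵐ z ∂μ, f z = 0) :
    Tendsto (fun N : ℕ => (N : ℝ)⁻¹ * ∑ k ∈ Finset.range N, ∫ z, iterates w Φ k z ∂μ)
      atTop (𝓝 0) := by
  set U := transferL2 hcov hw hΦ with hU
  set e : Lp ℝ 2 μ := (memLp_iterates hcov hw hΦ 0).toLp _ with he
  have hiter : ∀ k, U^[k] e =ᵐ[μ] iterates w Φ k := by
    intro k
    induction k with
    | zero => exact MemLp.coeFn_toLp (memLp_iterates hcov hw hΦ 0)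
    | succ k ih =>
      rw [Function.iterate_succ_apply']
      exact (coeFn_transferL2 hcov hw hΦ _).trans (transfer_congr_ae hcov hw hΦ ih)
  have hnorm : ‖U‖ ≤ 1 := LinearMap.mkContinuous_norm_le _ zero_le_one _
  -- The square of a fixed vector is a nonnegative integrable function that satisfies the invariance
  -- equation with weight w².
  have hfix : ∀ x : Lp ℝ 2 μ, U x = x → x = 0 := by
    intro x hx
    have h1 : (x : α → ℝ) =ᵐ[μ] transfer w Φ x := by
      have := coeFn_transferL2 hcov hw hΦ x
      rwa [← hU, hx] at this
    have h2 := hinv (fun z => x z ^ 2) (Lp.memLp x).integrable_sq (fun z => sq_nonneg _) (by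
      filter_upwards [h1] with z hz
      conv_lhs => rw [hz]
      simp only [transfer]
      ring)
    refine (Lp.eq_zero_iff_ae_eq_zero).2 ?_
    filter_upwards [h2] with z hz
    exact pow_eq_zero_iff two_ne_zero |>.1 hz
  -- Averages of powers of a contraction of a Hilbert space converge to the projection onto its
  -- fixed vectors, here onto {0}; pairing with e = 1 turns this into a statement about integrals.
  have hlim := U.tendsto_birkhoffAverage_orthogonalProjection hnorm e
  have hzero : ((((U : Lp ℝ 2 μ →L[ℝ] Lp ℝ 2 μ).eqLocus
      (1 : Lp ℝ 2 μ →L[ℝ] Lp ℝ 2 μ)).orthogonalProjectionOnto e : _) : Lp ℝ 2 μ) = 0 :=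
    hfix _ (Submodule.coe_mem (((U : Lp ℝ 2 μ →L[ℝ] Lp ℝ 2 μ).eqLocus
      (1 : Lp ℝ 2 μ →L[ℝ] Lp ℝ 2 μ)).orthogonalProjectionOnto e))
  rw [hzero] at hlim
  have hlim2 := (tendsto_const_nhds (x := e)).inner (𝕜 := ℝ) hlim
  rw [inner_zero_right] at hlim2
  refine hlim2.congr fun N => ?_
  rw [birkhoffAverage, birkhoffSum, real_inner_smul_right, inner_sum]
  congr 1
  refine Finset.sum_congr rfl fun k _ => ?_
  rw [L2.inner_def]
  refine integral_congr_ae ?_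
  filter_upwards [hiter k, hiter 0] with z hz hz0
  have : e z = 1 := hz0
  simp [hz, this]

end
end WeightedTransfer

theorem measurable_of_continuousOn_iUnion {ι α β : Type*} [Countable ι] [TopologicalSpace α]
    [MeasurableSpace α] [OpensMeasurableSpace α] [TopologicalSpace β] [MeasurableSpace β]
    [BorelSpace β] {f : α → β} {s : ι → Set α} (hs : ∀ i, MeasurableSet (s i))
    (hcov : ∀ z, ∃ i, z ∈ s i) (hf : ∀ i, ContinuousOn f (s i)) : Measurable f := by
  intro t ht
  have h : f ⁻¹' t = ⋃ i, s i ∩ f ⁻¹' t := by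
    ext z
    obtain ⟨i, hi⟩ := hcov z
    exact ⟨fun hz => mem_iUnion.2 ⟨i, hi, hz⟩, fun hz => (mem_iUnion.1 hz).choose_spec.2⟩
  rw [h]
  exact MeasurableSet.iUnion fun i => (hf i).measurableSet_inter_preimage (hs i) ht

/-! ### The first return map: measurability, injectivity, contraction, decomposition of loops. -/

noncomputable section
namespace ConormalFlow
section
variable {n : ℕ} {M : Type*} [TopologicalSpace M] [ChartedSpace (Rn n) M]
variable [IsManifold 𝓘(ℝ, Rn n) ∞ M]
variable {φ ψ χ : OpenPartialHomeomorph M (Rn n)} {g : Metric n M} {H : Set M} {d : ℕ}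
variable [T2Space M] [CompactSpace M]

/-- The geodesics of unit conormal covectors meet `H` at times that are at least `ε` apart. -/
def IsSeparation (g : Metric n M) (d : ℕ) (H : Set M) (ε : ℝ) : Prop :=
  0 < ε ∧ ∀ z ∈ unitConormal g d H, ∀ s : ℝ, |s| < ε → (geodesicFlow g s z).1 ∈ H → s = 0

/-- The set where the first return map is defined. -/
def returnSet (g : Metric n M) (d : ℕ) (H : Set M) : Set (Cot n M) :=
  {z | (returnTimes g d H z).Nonempty}

/-- The first return map, extended by the identity. -/
def returnMap (g : Metric n M) (d : ℕ) (H : Set M) (z : Cot n M) : Cot n M :=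
  geodesicFlow g (firstReturnTime g d H z) z

variable {ε : ℝ}

theorem IsSeparation.eq_of_abs_sub_lt (hε : IsSeparation g d H ε) {s t : ℝ} {z : Cot n M}
    (hs : z ∈ unitLoopSet g d H s) (ht : z ∈ unitLoopSet g d H t) (h : |s - t| < ε) : s = t := by
  have h1 : (geodesicFlow g (s - t) (geodesicFlow g t z)).1 ∈ H := by
    rw [← geodesicFlow_add, sub_add_cancel]
    exact hs.1.2.1.1
  exact sub_eq_zero.1 (hε.2 _ (geodesicFlow_mem_unitConormal ht) _ h h1)

theorem IsSeparation.le_of_mem_returnTimes (hε : IsSeparation g d H ε)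
    {t : ℝ} {z : Cot n M} (ht : t ∈ returnTimes g d H z) :
    ε ≤ t := by
  by_contra! h
  have := hε.2 z ht.2.2 t (by rwa [abs_of_pos ht.1]) ht.2.1.2.1.1
  exact ht.1.ne' this

theorem isClosed_loopTimes_at (hH : IsEmbeddedSubmanifold (n := n) d H) (hHc : IsCompact H)
    (z : Cot n M) : IsClosed {t : ℝ | z ∈ unitLoopSet g d H t} :=
  (isClosed_unitLoopSet hH hHc).preimage (continuous_id.prodMk continuous_const)

theorem measurableSet_unitLoopSet (hH : IsEmbeddedSubmanifold (n := n) d H) (hHc : IsCompact H)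
    (t : ℝ) : MeasurableSet (unitLoopSet g d H t) :=
  ((isClosed_unitLoopSet hH hHc).preimage
    (continuous_const.prodMk continuous_id : Continuous fun z : Cot n M => (t, z))).measurableSet

theorem bddBelow_returnTimes (z : Cot n M) : BddBelow (returnTimes g d H z) :=
  ⟨0, fun _ ht => ht.1.le⟩

/-- The infimum is attained because the loop times of z form a closed set and the positive ones are
bounded away from 0 by ε. -/
theorem IsSeparation.firstReturnTime_mem (hε : IsSeparation g d H ε)
    (hH : IsEmbeddedSubmanifold (n := n) d H) (hHc : IsCompact H) {z : Cot n M}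
    (hz : z ∈ returnSet g d H) : firstReturnTime g d H z ∈ returnTimes g d H z := by
  have h : returnTimes g d H z = Ici ε ∩ {t : ℝ | z ∈ unitLoopSet g d H t} := by
    ext t
    exact ⟨fun ht => ⟨hε.le_of_mem_returnTimes ht, ht.2⟩, fun ht => ⟨hε.1.trans_le ht.1, ht.2⟩⟩
  have hc : IsClosed (returnTimes g d H z) := by
    rw [h]
    exact isClosed_Ici.inter (isClosed_loopTimes_at hH hHc z)
  exact hc.csInf_mem hz (bddBelow_returnTimes z)

theorem firstReturnTime_le {t : ℝ} {z : Cot n M} (ht : t ∈ returnTimes g d H z) :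
    firstReturnTime g d H z ≤ t :=
  csInf_le (bddBelow_returnTimes z) ht

/-- The infimum of the empty set of reals is 0, which is why the return map extends by the identity.
-/
theorem firstReturnTime_of_notMem {z : Cot n M} (hz : z ∉ returnSet g d H) :
    firstReturnTime g d H z = 0 := by
  rw [firstReturnTime, not_nonempty_iff_eq_empty.1 hz, Real.sInf_empty]

/-- A cluster value of θ at z₀ is again a loop time of z₀, the loop relation being closed, and two
loop times of one point within a window shorter than ε coincide. -/
theorem IsSeparation.continuousOn_time (hε : IsSeparation g d H ε)
    (hH : IsEmbeddedSubmanifold (n := n) d H) (hHc : IsCompact H) {C : Set (Cot n M)}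
    {θ : Cot n M → ℝ} (hC : ∀ z ∈ C, z ∈ unitLoopSet g d H (θ z)) {a δ : ℝ} (hδ : δ < ε)
    (hθ : ∀ z ∈ C, θ z ∈ Icc a (a + δ)) : ContinuousOn θ C := by
  intro z₀ hz₀
  refine isCompact_Icc.tendsto_nhds_of_unique_mapClusterPt (s := Icc a (a + δ))
    (eventually_mem_nhdsWithin.mono hθ) fun y hy hcl => ?_
  obtain ⟨U, hU, hUt⟩ := mapClusterPt_iff_ultrafilter.1 hcl
  have h1 : Tendsto (fun z => (θ z, z)) U (𝓝 (y, z₀)) :=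
    hUt.prodMk_nhds (hU.trans nhdsWithin_le_nhds)
  have h2 : z₀ ∈ unitLoopSet g d H y := (isClosed_unitLoopSet hH hHc).mem_of_tendsto h1
    ((eventually_mem_nhdsWithin.filter_mono hU).mono hC)
  have h3 := hθ z₀ hz₀
  exact hε.eq_of_abs_sub_lt h2 (hC z₀ hz₀)
    (abs_lt.2 ⟨by linarith [hy.1, h3.2], by linarith [hy.2, h3.1]⟩)

/-- The lower bound ε on return times makes this set the projection of a compact set, hence closed.
-/
theorem IsSeparation.measurableSet_exists_le (hε : IsSeparation g d H ε)
    (hH : IsEmbeddedSubmanifold (n := n) d H) (hHc : IsCompact H) (c : ℝ) :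
    MeasurableSet {z : Cot n M | ∃ t ∈ returnTimes g d H z, t ≤ c} := by
  have h : {z : Cot n M | ∃ t ∈ returnTimes g d H z, t ≤ c} = Prod.snd ''
      ((Icc ε c ×ˢ unitConormal g d H) ∩ {q : ℝ × Cot n M | q.2 ∈ unitLoopSet g d H q.1}) := by
    ext z
    constructor
    · rintro ⟨t, ht, htc⟩
      exact ⟨(t, z), ⟨⟨⟨hε.le_of_mem_returnTimes ht, htc⟩, ht.2.2⟩, ht.2⟩, rfl⟩
    · rintro ⟨⟨t, z'⟩, ⟨⟨ht, -⟩, hz'⟩, rfl⟩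
      exact ⟨t, ⟨hε.1.trans_le ht.1, hz'⟩, ht.2⟩
  rw [h]
  exact (((isCompact_Icc.prod (isCompact_unitConormal hH hHc)).inter_right
    (isClosed_unitLoopSet hH hHc)).image continuous_snd).isClosed.measurableSet

theorem IsSeparation.measurableSet_returnSet (hε : IsSeparation g d H ε)
    (hH : IsEmbeddedSubmanifold (n := n) d H) (hHc : IsCompact H) :
    MeasurableSet (returnSet g d H) := by
  have h : returnSet g d H = ⋃ k : ℕ, {z : Cot n M | ∃ t ∈ returnTimes g d H z, t ≤ k} := by
    ext z
    constructor
    · rintro ⟨t, ht⟩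
      obtain ⟨k, hk⟩ := exists_nat_ge t
      exact mem_iUnion.2 ⟨k, t, ht, hk⟩
    · intro hz
      obtain ⟨k, t, ht, -⟩ := mem_iUnion.1 hz
      exact ⟨t, ht⟩
  rw [h]
  exact MeasurableSet.iUnion fun k => hε.measurableSet_exists_le hH hHc k

theorem IsSeparation.measurable_firstReturnTime (hε : IsSeparation g d H ε)
    (hH : IsEmbeddedSubmanifold (n := n) d H) (hHc : IsCompact H) :
    Measurable (firstReturnTime g d H) := by
  refine measurable_of_Iic fun c => ?_
  rcases lt_or_ge c 0 with hc | hc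
  · have h : firstReturnTime g d H ⁻¹' Iic c = ∅ := eq_empty_of_forall_notMem fun z hz => by
      have h1 : 0 ≤ firstReturnTime g d H z := Real.sInf_nonneg fun _ ht => ht.1.le
      exact (hc.trans_le h1).not_ge hz
    rw [h]
    exact MeasurableSet.empty
  · have h : firstReturnTime g d H ⁻¹' Iic c =
        {z : Cot n M | ∃ t ∈ returnTimes g d H z, t ≤ c} ∪ (returnSet g d H)ᶜ := by
      ext z
      by_cases hz : z ∈ returnSet g d H
      · refine ⟨fun h => Or.inl ⟨_, hε.firstReturnTime_mem hH hHc hz, h⟩, ?_⟩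
        rintro (⟨t, ht, htc⟩ | h)
        · exact (firstReturnTime_le ht).trans htc
        · exact absurd hz h
      · refine ⟨fun _ => Or.inr hz, fun _ => ?_⟩
        rw [mem_preimage, firstReturnTime_of_notMem hz]
        exact hc
    rw [h]
    exact (hε.measurableSet_exists_le hH hHc c).union (hε.measurableSet_returnSet hH hHc).compl

/-- Strips on which the first return time is continuous. -/
def timeStrip (g : Metric n M) (d : ℕ) (H : Set M) (ε : ℝ) (k : ℕ) : Set (Cot n M) :=
  firstReturnTime g d H ⁻¹' Icc (k * (ε / 2)) (k * (ε / 2) + ε / 2)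

theorem IsSeparation.measurableSet_timeStrip (hε : IsSeparation g d H ε)
    (hH : IsEmbeddedSubmanifold (n := n) d H) (hHc : IsCompact H) (k : ℕ) :
    MeasurableSet (timeStrip g d H ε k) :=
  hε.measurable_firstReturnTime hH hHc measurableSet_Icc

theorem IsSeparation.exists_mem_timeStrip (hε : IsSeparation g d H ε) (z : Cot n M) :
    ∃ k, z ∈ timeStrip g d H ε k := by
  have h0 : 0 ≤ firstReturnTime g d H z := Real.sInf_nonneg fun _ ht => ht.1.le
  have he : 0 < ε / 2 := half_pos hε.1
  refine ⟨⌊firstReturnTime g d H z / (ε / 2)⌋₊, ?_, ?_⟩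
  · exact (le_div_iff₀ he).1 (Nat.floor_le (div_nonneg h0 he.le))
  · have := (div_lt_iff₀ he).1 (Nat.lt_floor_add_one (firstReturnTime g d H z / (ε / 2)))
    linarith

/-- The width ε / 2 of the strips lies below the separation ε. -/
theorem IsSeparation.continuousOn_firstReturnTime (hε : IsSeparation g d H ε)
    (hH : IsEmbeddedSubmanifold (n := n) d H) (hHc : IsCompact H) (k : ℕ) :
    ContinuousOn (firstReturnTime g d H) (returnSet g d H ∩ timeStrip g d H ε k) :=
  hε.continuousOn_time hH hHc (fun _ hz => (hε.firstReturnTime_mem hH hHc hz.1).2)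
    (half_lt_self hε.1) fun _ hz => hz.2

theorem IsSeparation.measurable_of_continuousOn (hε : IsSeparation g d H ε)
    (hH : IsEmbeddedSubmanifold (n := n) d H) (hHc : IsCompact H) {β : Type*} [TopologicalSpace β]
    [MeasurableSpace β] [BorelSpace β] {f : Cot n M → β} (hf : ContinuousOn f (returnSet g d H)ᶜ)
    (hf' : ∀ k, ContinuousOn f (returnSet g d H ∩ timeStrip g d H ε k)) : Measurable f := by
  have hB := hε.measurableSet_returnSet (g := g) hH hHc
  refine measurable_of_continuousOn_iUnion (ι := Option ℕ)
    (s := fun i => i.elim (returnSet g d H)ᶜ fun k => returnSet g d H ∩ timeStrip g d H ε k)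
    (Option.rec hB.compl fun k => hB.inter (hε.measurableSet_timeStrip hH hHc k)) (fun z => ?_)
    (Option.rec hf hf')
  by_cases hz : z ∈ returnSet g d H
  · obtain ⟨k, hk⟩ := hε.exists_mem_timeStrip (g := g) (d := d) (H := H) z
    exact ⟨some k, hz, hk⟩
  · exact ⟨none, hz⟩

theorem returnMap_of_notMem {z : Cot n M} (hz : z ∉ returnSet g d H) : returnMap g d H z = z := by
  rw [returnMap, firstReturnTime_of_notMem hz, geodesicFlow_zero]

theorem IsSeparation.measurable_returnMap (hε : IsSeparation g d H ε)
    (hH : IsEmbeddedSubmanifold (n := n) d H) (hHc : IsCompact H) :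
    Measurable (returnMap g d H) := by
  refine hε.measurable_of_continuousOn hH hHc
    (continuousOn_id.congr fun z hz => returnMap_of_notMem hz) fun k z hz => ?_
  have h0 : z.2 ≠ 0 := (hε.firstReturnTime_mem hH hHc hz.1).2.2.1.2.1
  exact ContinuousAt.comp_continuousWithinAt (g := fun q : ℝ × Cot n M => geodesicFlow g q.1 q.2)
    (f := fun z => (firstReturnTime g d H z, z)) (continuousAt_geodesicFlow g _ h0)
    ((hε.continuousOn_firstReturnTime hH hHc k z hz).prodMk continuousWithinAt_id)

open Classical in
/-- The square root of the Jacobian of the first return map, extended by `0`. -/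
def returnWeight (g : Metric n M) (d : ℕ) (H : Set M) (z : Cot n M) : ℝ :=
  if z ∈ returnSet g d H then √(jacobian g d H (firstReturnTime g d H z) z) else 0

theorem returnWeight_nonneg (z : Cot n M) : 0 ≤ returnWeight g d H z := by
  unfold returnWeight
  split_ifs
  exacts [Real.sqrt_nonneg _, le_rfl]

theorem IsSeparation.measurable_returnWeight (hε : IsSeparation g d H ε)
    (hH : IsEmbeddedSubmanifold (n := n) d H) (hHc : IsCompact H) :
    Measurable (returnWeight g d H) := by
  refine hε.measurable_of_continuousOn hH hHc
    ((continuousOn_const (c := (0 : ℝ))).congr fun z hz => if_neg hz) fun k => ?_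
  refine ContinuousOn.congr ?_ fun z hz => if_pos hz.1
  exact Real.continuous_sqrt.comp_continuousOn ((continuousOn_jacobian hH).comp
    (f := fun z => (firstReturnTime g d H z, z))
    ((hε.continuousOn_firstReturnTime hH hHc k).prodMk continuousOn_id)
    fun z hz => (hε.firstReturnTime_mem hH hHc hz.1).2.1)

theorem IsSeparation.returnWeight_sq (hε : IsSeparation g d H ε)
    (hH : IsEmbeddedSubmanifold (n := n) d H) (hHc : IsCompact H) {z : Cot n M}
    (hz : z ∈ returnSet g d H) :
    returnWeight g d H z ^ 2 = jacobian g d H (firstReturnTime g d H z) z := by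
  rw [returnWeight, if_pos hz, Real.sq_sqrt
    (jacobian_pos hH (hε.firstReturnTime_mem hH hHc hz).2.1).le]

/-- If z had the strictly smaller return time, going from z' to the common image and back to z would
be a loop of z' of positive time shorter than its first return. -/
theorem IsSeparation.le_firstReturnTime_of_returnMap_eq (hε : IsSeparation g d H ε)
    (hH : IsEmbeddedSubmanifold (n := n) d H) (hHc : IsCompact H) {z z' : Cot n M}
    (hz : z ∈ returnSet g d H) (hz' : z' ∈ returnSet g d H)
    (h : returnMap g d H z = returnMap g d H z') :
    firstReturnTime g d H z' ≤ firstReturnTime g d H z := by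
  by_contra! hlt
  have h1 := neg_mem_loopSet hH (hε.firstReturnTime_mem hH hHc hz).2.1
  change returnMap g d H z ∈ _ at h1
  have hm := hε.firstReturnTime_mem hH hHc hz'
  rw [h] at h1
  have h2 := mem_loopSet_add hH hm.2.1 h1
  have h4 := firstReturnTime_le (t := -firstReturnTime g d H z + firstReturnTime g d H z')
    (z := z') ⟨by linarith, h2, hm.2.2⟩
  linarith [(hε.firstReturnTime_mem hH hHc hz).1]

theorem IsSeparation.injOn_returnMap (hε : IsSeparation g d H ε)
    (hH : IsEmbeddedSubmanifold (n := n) d H) (hHc : IsCompact H) :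
    InjOn (returnMap g d H) (returnSet g d H) := by
  intro z hz z' hz' h
  have ht := le_antisymm (hε.le_firstReturnTime_of_returnMap_eq hH hHc hz' hz h.symm)
    (hε.le_firstReturnTime_of_returnMap_eq hH hHc hz hz' h)
  rw [returnMap, returnMap, ht] at h
  have h2 := congrArg (geodesicFlow g (-firstReturnTime g d H z')) h
  rwa [geodesicFlow_neg_apply, geodesicFlow_neg_apply] at h2

/-- The return map is injective on its domain and has Jacobian w² there, and w is 0 elsewhere. The
inequality is the contraction property of the transfer operator. -/
theorem IsSeparation.lintegral_returnWeight_le (hε : IsSeparation g d H ε)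
    (hH : IsEmbeddedSubmanifold (n := n) d H) (hHc : IsCompact H) (F : Cot n M → ℝ≥0∞)
    (hF : Measurable F) :
    ∫⁻ z, ENNReal.ofReal (returnWeight g d H z ^ 2) * F (returnMap g d H z)
      ∂(lerayMeasure g d H) ≤ ∫⁻ z, F z ∂(lerayMeasure g d H) := by
  have hB := hε.measurableSet_returnSet (g := g) hH hHc
  refine le_trans (le_of_eq ?_) (setLIntegral_unit_returnMap_le hH hHc hB
    (fun z hz => (hε.firstReturnTime_mem hH hHc hz).2) (hε.injOn_returnMap hH hHc)
    (hε.measurableSet_timeStrip hH hHc)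
    (fun z _ => mem_iUnion.2 (hε.exists_mem_timeStrip z))
    (hε.continuousOn_firstReturnTime hH hHc) hF)
  rw [← lintegral_indicator hB]
  refine lintegral_congr fun z => ?_
  by_cases hz : z ∈ returnSet g d H
  · rw [indicator_of_mem hz, hε.returnWeight_sq hH hHc hz]
    rfl
  · simp [indicator_of_notMem hz, returnWeight, if_neg hz]

open WeightedTransfer

theorem IsSeparation.tendsto_average (hε : IsSeparation g d H ε)
    (hH : IsEmbeddedSubmanifold (n := n) d H) (hHc : IsCompact H)
    (hinv : ∀ f : Cot n M → ℝ, IsInvariantDensity g d H f →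
      ∀ᵐ z ∂(lerayMeasure g d H), f z = 0) :
    Tendsto (fun N : ℕ => (N : ℝ)⁻¹ * ∑ k ∈ Finset.range N,
      ∫ z, iterates (returnWeight g d H) (returnMap g d H) k z ∂(lerayMeasure g d H))
      atTop (𝓝 0) := by
  have hfin := isFiniteMeasure_lerayMeasure (g := g) hH hHc
  refine tendsto_average_integral_iterates (hε.lintegral_returnWeight_le hH hHc)
    (hε.measurable_returnWeight hH hHc) (hε.measurable_returnMap hH hHc) fun f hf hf0 hff => ?_
  -- The single equation f = w² · (f ∘ R) contains both cases of invariance, because w² is J_𝐓 on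
  -- the return set and 0 off it.
  refine hinv f ⟨hf, .of_forall hf0, ?_, ?_⟩
  · filter_upwards [hff] with z hz hne
    rw [hε.returnWeight_sq hH hHc hne, mul_comm] at hz
    exact hz
  · filter_upwards [hff] with z hz hne
    have : z ∉ returnSet g d H := fun h => h.ne_empty hne
    rw [hz, returnWeight, if_neg this]
    simp

/-- The function `√J_t` on `SΣ_t`, extended by `0`. -/
def loopWeight (g : Metric n M) (d : ℕ) (H : Set M) (t : ℝ) : Cot n M → ℝ :=
  (unitLoopSet g d H t).indicator fun z => √(jacobian g d H t z)

theorem loopWeight_nonneg (t : ℝ) (z : Cot n M) : 0 ≤ loopWeight g d H t z :=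
  indicator_nonneg (fun _ _ => Real.sqrt_nonneg _) _

/-- A loop of time t is either the first return or the first return followed by a loop of the
remaining time; in the second case √J_t factors by the cocycle property. -/
theorem loopWeight_le_returnWeight_mul (hε : IsSeparation g d H ε)
    (hH : IsEmbeddedSubmanifold (n := n) d H) (hHc : IsCompact H) {t : ℝ} (ht : 0 < t)
    (z : Cot n M) : loopWeight g d H t z ≤
      (if t = firstReturnTime g d H z then returnWeight g d H z else 0) +
      (if firstReturnTime g d H z < t then returnWeight g d H z *
        loopWeight g d H (t - firstReturnTime g d H z) (returnMap g d H z) else 0) := by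
  have hw := returnWeight_nonneg (g := g) (d := d) (H := H) z
  have h0 : 0 ≤ (if t = firstReturnTime g d H z then returnWeight g d H z else 0) +
      (if firstReturnTime g d H z < t then returnWeight g d H z *
        loopWeight g d H (t - firstReturnTime g d H z) (returnMap g d H z) else 0) := by
    refine add_nonneg ?_ ?_ <;> split_ifs
    exacts [hw, le_rfl, mul_nonneg hw (loopWeight_nonneg _ _), le_rfl]
  by_cases hz : z ∈ unitLoopSet g d H t
  swap
  · rwa [loopWeight, indicator_of_notMem hz]
  have hzB : z ∈ returnSet g d H := ⟨t, ht, hz⟩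
  have hm := hε.firstReturnTime_mem hH hHc hzB
  rw [loopWeight, indicator_of_mem hz]
  rcases (firstReturnTime_le ⟨ht, hz⟩).eq_or_lt with h | h
  · rw [if_pos h.symm, if_neg h.not_lt, add_zero, returnWeight, if_pos hzB, h]
  · have h1 : z ∈ loopSet g d H (t - firstReturnTime g d H z + firstReturnTime g d H z) := by
      rw [sub_add_cancel]
      exact hz.1
    have h2 := mem_loopSet_of_add hH hm.2.1 h1
    have h3 : returnMap g d H z ∈ unitLoopSet g d H (t - firstReturnTime g d H z) :=
      ⟨h2, geodesicFlow_mem_unitConormal hm.2⟩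
    have h4 := jacobian_add hH hm.2.1 h2
    rw [sub_add_cancel] at h4
    rw [if_neg h.ne', if_pos h, zero_add, returnWeight, if_pos hzB, loopWeight,
      indicator_of_mem h3, h4, mul_comm, Real.sqrt_mul (jacobian_pos hH hm.2.1).le]
    rfl

/-- The k-th iterate is √J at the k-th return where it exists. Returns are at least ε apart, so the
times in question are among the first m returns; the induction peels off the first one. -/
theorem sum_loopWeight_le (hε : IsSeparation g d H ε)
    (hH : IsEmbeddedSubmanifold (n := n) d H) (hHc : IsCompact H) (m : ℕ) {z : Cot n M}
    (hz : z ∈ unitConormal g d H) (S : Finset ℝ) (hS : ∀ t ∈ S, 0 < t ∧ t < (m + 1) * ε) :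
    ∑ t ∈ S, loopWeight g d H t z ≤
      ∑ k ∈ Finset.range m, iterates (returnWeight g d H) (returnMap g d H) (k + 1) z := by
  induction m generalizing z S with
  | zero =>
    rw [Finset.range_zero, Finset.sum_empty]
    -- For m = 0 all times lie in (0, ε), where there is no loop.
    refine Finset.sum_nonpos fun t ht => ?_
    have h1 := hS t ht
    rw [loopWeight, indicator_of_notMem]
    intro hzt
    have := hε.le_of_mem_returnTimes ⟨h1.1, hzt⟩
    push_cast at h1
    linarith [h1.2]
  | succ m ih =>
    by_cases hzB : z ∈ returnSet g d H
    swap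
    · refine le_trans (Finset.sum_nonpos fun t ht => ?_) (Finset.sum_nonneg fun k _ =>
        iterates_nonneg returnWeight_nonneg _ _)
      rw [loopWeight, indicator_of_notMem]
      exact fun hzt => hzB ⟨t, (hS t ht).1, hzt⟩
    set τ := firstReturnTime g d H z with hτ
    have hm := hε.firstReturnTime_mem hH hHc hzB
    have hw := returnWeight_nonneg (g := g) (d := d) (H := H) z
    have hετ : ε ≤ τ := hε.le_of_mem_returnTimes hm
    -- Subtracting τ ≥ ε lowers the bound by at least one ε, so the later times fit the induction
    -- hypothesis at the returned point.
    have ih' := ih (geodesicFlow_mem_unitConormal hm.2)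
      ((S.filter (τ < ·)).image (· - τ)) (by
        intro s hs
        obtain ⟨t, ht, rfl⟩ := Finset.mem_image.1 hs
        obtain ⟨htS, htτ⟩ := Finset.mem_filter.1 ht
        have h1 := (hS t htS).2
        push_cast at h1
        exact ⟨sub_pos.2 htτ, by linarith⟩)
    rw [Finset.sum_image fun a _ b _ h => sub_left_injective h] at ih'
    calc ∑ t ∈ S, loopWeight g d H t z
        ≤ ∑ t ∈ S, ((if t = τ then returnWeight g d H z else 0) +
          (if τ < t then returnWeight g d H z *
            loopWeight g d H (t - τ) (returnMap g d H z) else 0)) :=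
          Finset.sum_le_sum fun t ht => loopWeight_le_returnWeight_mul hε hH hHc (hS t ht).1 z
      _ = (if τ ∈ S then returnWeight g d H z else 0) + returnWeight g d H z *
          ∑ t ∈ S.filter (τ < ·), loopWeight g d H (t - τ) (returnMap g d H z) := by
          rw [Finset.sum_add_distrib, Finset.sum_ite_eq', Finset.mul_sum, Finset.sum_filter]
      _ ≤ returnWeight g d H z * 1 + returnWeight g d H z * ∑ k ∈ Finset.range m,
          iterates (returnWeight g d H) (returnMap g d H) (k + 1) (returnMap g d H z) := by
          refine add_le_add ?_ (mul_le_mul_of_nonneg_left ih' hw)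
          split_ifs
          · rw [mul_one]
          · rwa [mul_one]
      _ = ∑ k ∈ Finset.range (m + 1),
          iterates (returnWeight g d H) (returnMap g d H) (k + 1) z := by
          rw [Finset.sum_range_succ', add_comm, Finset.mul_sum]
          rfl

end
end ConormalFlow
end

/-! ### Sums of |q(t)| over loop times and the limit of their averages. -/

noncomputable section
namespace ConormalFlow
section
variable {n : ℕ} {M : Type*} [TopologicalSpace M] [ChartedSpace (Rn n) M]
variable [IsManifold 𝓘(ℝ, Rn n) ∞ M]
variable {φ ψ χ : OpenPartialHomeomorph M (Rn n)} {g : Metric n M} {H : Set M} {d : ℕ}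
variable [T2Space M] [CompactSpace M] {ε : ℝ}

open WeightedTransfer

theorem measurable_loopWeight (hH : IsEmbeddedSubmanifold (n := n) d H) (hHc : IsCompact H)
    (t : ℝ) : Measurable (loopWeight g d H t) := by
  have hm := measurableSet_unitLoopSet (g := g) hH hHc t
  refine measurable_of_continuousOn_iUnion (ι := Bool)
    (s := fun b => cond b (unitLoopSet g d H t) (unitLoopSet g d H t)ᶜ)
    (Bool.rec hm.compl hm) (fun z => ?_) (Bool.rec ?_ ?_)
  · by_cases hz : z ∈ unitLoopSet g d H t
    · exact ⟨true, hz⟩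
    · exact ⟨false, hz⟩
  · exact (continuousOn_const (c := (0 : ℝ))).congr fun z hz => indicator_of_notMem hz _
  · refine ContinuousOn.congr ?_ fun z hz => indicator_of_mem hz _
    exact Real.continuous_sqrt.comp_continuousOn ((continuousOn_jacobian hH).comp
      (f := fun z => (t, z)) (Continuous.continuousOn (by fun_prop)) fun z hz => hz.1)

theorem ae_sum_loopWeight_le (hε : IsSeparation g d H ε)
    (hH : IsEmbeddedSubmanifold (n := n) d H) (hHc : IsCompact H) (m : ℕ) (S : Finset ℝ)
    (hS : ∀ t ∈ S, 0 < t ∧ t < (m + 1) * ε) :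
    ∀ᵐ z ∂(lerayMeasure g d H), ∑ t ∈ S, loopWeight g d H t z ≤
      ∑ k ∈ Finset.range m, iterates (returnWeight g d H) (returnMap g d H) (k + 1) z := by
  filter_upwards [ae_mem_unitConormal hH hHc.isClosed] with z hz
  exact sum_loopWeight_le hε hH hHc m hz S hS

theorem IsSeparation.integrable_iterates (hε : IsSeparation g d H ε)
    (hH : IsEmbeddedSubmanifold (n := n) d H) (hHc : IsCompact H) (k : ℕ) :
    Integrable (iterates (returnWeight g d H) (returnMap g d H) k) (lerayMeasure g d H) :=
  have := isFiniteMeasure_lerayMeasure (g := g) hH hHc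
  WeightedTransfer.integrable_iterates (hε.lintegral_returnWeight_le hH hHc)
    (hε.measurable_returnWeight hH hHc) (hε.measurable_returnMap hH hHc) k

theorem IsSeparation.integrable_loopWeight (hε : IsSeparation g d H ε)
    (hH : IsEmbeddedSubmanifold (n := n) d H) (hHc : IsCompact H) {t : ℝ} (ht : 0 < t) :
    Integrable (loopWeight g d H t) (lerayMeasure g d H) := by
  obtain ⟨m, hm⟩ := exists_nat_gt (t / ε)
  have h := ae_sum_loopWeight_le hε hH hHc m {t} (fun s hs => by
    rw [Finset.mem_singleton.1 hs]
    have := (div_lt_iff₀ hε.1).1 hm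
    exact ⟨ht, by linarith [hε.1]⟩)
  refine Integrable.mono' (integrable_finsetSum (Finset.range m)
    fun k _ => hε.integrable_iterates hH hHc (k + 1))
    (measurable_loopWeight hH hHc t).aestronglyMeasurable ?_
  filter_upwards [h] with z hz
  rw [Real.norm_of_nonneg (loopWeight_nonneg t z)]
  simpa using hz

/-- The integral of `√J_t` over `SΣ_t`. -/
def loopIntegral (g : Metric n M) (d : ℕ) (H : Set M) (t : ℝ) : ℝ :=
  ∫ z, loopWeight g d H t z ∂(lerayMeasure g d H)

/-- The integrals of the iterates of the transfer operator of the first return map. -/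
def iterateIntegral (g : Metric n M) (d : ℕ) (H : Set M) (k : ℕ) : ℝ :=
  ∫ z, iterates (returnWeight g d H) (returnMap g d H) k z ∂(lerayMeasure g d H)

theorem iterateIntegral_nonneg (k : ℕ) : 0 ≤ iterateIntegral g d H k :=
  integral_nonneg fun z => iterates_nonneg returnWeight_nonneg k z

theorem sum_loopIntegral_le (hε : IsSeparation g d H ε)
    (hH : IsEmbeddedSubmanifold (n := n) d H) (hHc : IsCompact H) (m : ℕ) (S : Finset ℝ)
    (hS : ∀ t ∈ S, 0 < t ∧ t < (m + 1) * ε) :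
    ∑ t ∈ S, loopIntegral g d H t ≤ ∑ k ∈ Finset.range (m + 1), iterateIntegral g d H k := by
  calc ∑ t ∈ S, loopIntegral g d H t
      = ∫ z, ∑ t ∈ S, loopWeight g d H t z ∂(lerayMeasure g d H) :=
        (integral_finsetSum S fun t ht => hε.integrable_loopWeight hH hHc (hS t ht).1).symm
    _ ≤ ∫ z, ∑ k ∈ Finset.range m,
          iterates (returnWeight g d H) (returnMap g d H) (k + 1) z ∂(lerayMeasure g d H) :=
        integral_mono_ae (integrable_finsetSum S
          fun t ht => hε.integrable_loopWeight hH hHc (hS t ht).1)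
          (integrable_finsetSum _ fun k _ => hε.integrable_iterates hH hHc (k + 1))
          (ae_sum_loopWeight_le hε hH hHc m S hS)
    _ = ∑ k ∈ Finset.range m, iterateIntegral g d H (k + 1) :=
        integral_finsetSum _ fun k _ => hε.integrable_iterates hH hHc (k + 1)
    -- The nonnegative term k = 0 is added so that the bound is a partial sum as in the ergodic
    -- average.
    _ ≤ _ := by
        rw [Finset.sum_range_succ']
        exact le_add_of_nonneg_right (iterateIntegral_nonneg 0)

/-- Change of variables under G^{-t} with F = √J_t. As J_{-t}(z) and J_t(G^{-t} z) are inverse to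
each other, the factor J_{-t}(z) times √J_t(G^{-t} z) is √J_{-t}(z). -/
theorem loopIntegral_neg_le (hε : IsSeparation g d H ε)
    (hH : IsEmbeddedSubmanifold (n := n) d H) (hHc : IsCompact H) {t : ℝ} (ht : 0 < t) :
    loopIntegral g d H (-t) ≤ loopIntegral g d H t := by
  have hm := measurableSet_unitLoopSet (g := g) hH hHc (-t)
  have hmt := measurable_loopWeight (g := g) hH hHc
  have key := setLIntegral_unit_returnMap_le hH hHc hm (θ := fun _ => -t) (fun z hz => hz)
    (fun z _ z' _ h => by
      have := congrArg (geodesicFlow g t) h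
      simpa only [geodesicFlow_apply_neg] using this)
    (C := fun _ => univ) (fun _ => MeasurableSet.univ) (fun z _ => mem_iUnion.2 ⟨0, mem_univ z⟩)
    (fun _ => continuousOn_const) (hmt t).ennreal_ofReal
  have hle : ∫⁻ z, ENNReal.ofReal (loopWeight g d H (-t) z) ∂(lerayMeasure g d H) ≤
      ∫⁻ z, ENNReal.ofReal (loopWeight g d H t z) ∂(lerayMeasure g d H) := by
    refine le_trans (le_of_eq ?_) key
    rw [← lintegral_indicator hm]
    refine lintegral_congr fun z => ?_
    by_cases hz : z ∈ unitLoopSet g d H (-t)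
    · have h1 := neg_mem_loopSet hH hz.1
      have h2 := jacobian_neg_mul hH hz.1
      rw [neg_neg] at h1 h2
      have hJ := jacobian_pos hH hz.1
      rw [loopWeight, indicator_of_mem hz, indicator_of_mem hz, loopWeight,
        indicator_of_mem (show geodesicFlow g (-t) z ∈ unitLoopSet g d H t from
          ⟨h1, geodesicFlow_mem_unitConormal hz⟩), ← ENNReal.ofReal_mul hJ.le]
      congr 1
      rw [eq_inv_of_mul_eq_one_left h2, Real.sqrt_inv, ← div_eq_mul_inv, Real.div_sqrt]
    · rw [loopWeight, indicator_of_notMem hz, indicator_of_notMem hz, ENNReal.ofReal_zero]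
  rw [loopIntegral, loopIntegral,
    integral_eq_lintegral_of_nonneg_ae (.of_forall (loopWeight_nonneg _))
      (hmt _).aestronglyMeasurable,
    integral_eq_lintegral_of_nonneg_ae (.of_forall (loopWeight_nonneg _))
      (hmt _).aestronglyMeasurable]
  exact ENNReal.toReal_mono (hε.integrable_loopWeight hH hHc ht).lintegral_lt_top.ne hle

/-- An integer power of i has modulus one, so the Maslov index disappears. -/
theorem norm_q_le (hH : IsEmbeddedSubmanifold (n := n) d H) (hHc : IsCompact H) (t : ℝ) :
    ‖q g d H t‖ ≤ ((2 * Real.pi) ^ (n - d))⁻¹ * loopIntegral g d H t := by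
  rw [q, norm_mul, norm_inv, norm_pow]
  have h1 : ‖(2 * Real.pi : ℂ)‖ = 2 * Real.pi := by
    rw [norm_mul, Complex.norm_ofNat, Complex.norm_real, Real.norm_of_nonneg Real.pi_pos.le]
  rw [h1]
  refine mul_le_mul_of_nonneg_left ((norm_integral_le_integral_norm _).trans (le_of_eq ?_))
    (by positivity)
  rw [loopIntegral, loopWeight, integral_indicator (measurableSet_unitLoopSet hH hHc t)]
  refine integral_congr_ae (.of_forall fun z => ?_)
  simp only [norm_mul, norm_zpow, Complex.norm_I, one_zpow, one_mul, Complex.norm_real]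
  exact Real.norm_of_nonneg (Real.sqrt_nonneg _)

theorem sum_norm_q_le (hε : IsSeparation g d H ε)
    (hH : IsEmbeddedSubmanifold (n := n) d H) (hHc : IsCompact H) (m : ℕ) (S : Finset ℝ)
    (hS : ∀ t ∈ S, t ≠ 0 ∧ |t| < (m + 1) * ε) :
    ∑ t ∈ S, ‖q g d H t‖ ≤ 2 * ((2 * Real.pi) ^ (n - d))⁻¹ *
      ∑ k ∈ Finset.range (m + 1), iterateIntegral g d H k := by
  -- Positive and negative times are bounded separately by the same sum, whence the factor 2.
  have hpos := sum_loopIntegral_le hε hH hHc m (S.filter (0 < ·)) fun t ht => by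
    obtain ⟨h1, h2⟩ := Finset.mem_filter.1 ht
    exact ⟨h2, (le_abs_self t).trans_lt (hS t h1).2⟩
  have hneg := sum_loopIntegral_le hε hH hHc m ((S.filter fun t => ¬ 0 < t).image (-·))
    fun s hs => by
      obtain ⟨t, ht, rfl⟩ := Finset.mem_image.1 hs
      obtain ⟨h1, h2⟩ := Finset.mem_filter.1 ht
      exact ⟨neg_pos.2 (lt_of_le_of_ne (not_lt.1 h2) (hS t h1).1),
        (neg_le_abs t).trans_lt (hS t h1).2⟩
  rw [Finset.sum_image fun a _ b _ h => neg_injective h] at hneg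
  have hneg' : ∑ t ∈ S.filter (fun t => ¬ 0 < t), loopIntegral g d H t ≤
      ∑ t ∈ S.filter (fun t => ¬ 0 < t), loopIntegral g d H (-t) := by
    refine Finset.sum_le_sum fun t ht => ?_
    obtain ⟨h1, h2⟩ := Finset.mem_filter.1 ht
    have := loopIntegral_neg_le hε hH hHc
      (neg_pos.2 (lt_of_le_of_ne (not_lt.1 h2) (hS t h1).1))
    rwa [neg_neg] at this
  calc ∑ t ∈ S, ‖q g d H t‖
      ≤ ∑ t ∈ S, ((2 * Real.pi) ^ (n - d))⁻¹ * loopIntegral g d H t :=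
        Finset.sum_le_sum fun t _ => norm_q_le hH hHc t
    _ = ((2 * Real.pi) ^ (n - d))⁻¹ * (∑ t ∈ S.filter (0 < ·), loopIntegral g d H t +
          ∑ t ∈ S.filter (fun t => ¬ 0 < t), loopIntegral g d H t) := by
        rw [← Finset.mul_sum, Finset.sum_filter_add_sum_filter_not]
    _ ≤ ((2 * Real.pi) ^ (n - d))⁻¹ * (2 *
          ∑ k ∈ Finset.range (m + 1), iterateIntegral g d H k) := by
        refine mul_le_mul_of_nonneg_left ?_ (by positivity)
        linarith
    _ = _ := by ring

/-- With m = ⌊T / ε⌋ the condition |t| ≤ T implies |t| < (m + 1)ε. The bound is uniform over finite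
sets of times, which yields summability. -/
theorem sum_norm_q_subtype_le (hε : IsSeparation g d H ε)
    (hH : IsEmbeddedSubmanifold (n := n) d H) (hHc : IsCompact H) {T : ℝ}
    (S : Finset ↥(loopTimes g d H ∩ Icc (-T) T)) :
    ∑ t ∈ S, ‖q g d H t‖ ≤ 2 * ((2 * Real.pi) ^ (n - d))⁻¹ *
      ∑ k ∈ Finset.range (⌊T / ε⌋₊ + 1), iterateIntegral g d H k := by
  have h := sum_norm_q_le hε hH hHc ⌊T / ε⌋₊ (S.map (Function.Embedding.subtype _))
    fun t ht => by
      obtain ⟨t', -, rfl⟩ := Finset.mem_map.1 ht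
      refine ⟨t'.2.1.1, (abs_le.2 t'.2.2).trans_lt ?_⟩
      exact (div_lt_iff₀ hε.1).1 (Nat.lt_floor_add_one (T / ε))
  rwa [Finset.sum_map] at h

theorem summable_norm_q (hε : IsSeparation g d H ε)
    (hH : IsEmbeddedSubmanifold (n := n) d H) (hHc : IsCompact H) (T : ℝ) :
    Summable fun t : ↥(loopTimes g d H ∩ Icc (-T) T) => ‖q g d H t‖ :=
  summable_of_sum_le (fun _ => norm_nonneg _) (sum_norm_q_subtype_le hε hH hHc)

theorem averagingCondition_of_tendsto (hε : IsSeparation g d H ε)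
    (hH : IsEmbeddedSubmanifold (n := n) d H) (hHc : IsCompact H)
    (hlim : Tendsto (fun N : ℕ => (N : ℝ)⁻¹ * ∑ k ∈ Finset.range N, iterateIntegral g d H k)
      atTop (𝓝 0)) : AveragingCondition g d H := by
  refine ⟨summable_norm_q hε hH hHc, ?_⟩
  set c : ℝ := 2 * ((2 * Real.pi) ^ (n - d))⁻¹ with hc
  have hc0 : 0 ≤ c := by positivity
  have hN : Tendsto (fun T : ℝ => ⌊T / ε⌋₊ + 1) atTop atTop :=
    (tendsto_add_atTop_nat 1).comp
      (tendsto_nat_floor_atTop.comp (tendsto_id.atTop_div_const hε.1))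
  have hlim2 := (hlim.comp hN).const_mul (c * (1 / ε + 1))
  rw [mul_zero] at hlim2
  refine tendsto_of_tendsto_of_tendsto_of_le_of_le' tendsto_const_nhds hlim2 ?_ ?_
  · filter_upwards [eventually_ge_atTop (0 : ℝ)] with T hT
    exact mul_nonneg (by positivity) (tsum_nonneg fun _ => norm_nonneg _)
  · filter_upwards [eventually_ge_atTop (1 : ℝ)] with T hT
    have hT0 : 0 < T := zero_lt_one.trans_le hT
    set A := ∑ k ∈ Finset.range (⌊T / ε⌋₊ + 1), iterateIntegral g d H k with hA
    have hA0 : 0 ≤ A := Finset.sum_nonneg fun k _ => iterateIntegral_nonneg k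
    have h1 : ∑' t : ↥(loopTimes g d H ∩ Icc (-T) T), ‖q g d H t‖ ≤ c * A :=
      (summable_norm_q hε hH hHc T).tsum_le_of_sum_le (sum_norm_q_subtype_le hε hH hHc)
    have hfl : (⌊T / ε⌋₊ : ℝ) ≤ T / ε := Nat.floor_le (div_nonneg hT0.le hε.1.le)
    -- The number N of iterates is at most T / ε + 1, and 1 ≤ T turns this into a multiple of T; so
    -- dividing by T costs only the constant 1 / ε + 1 against dividing by N.
    have h2 : ((⌊T / ε⌋₊ + 1 : ℕ) : ℝ) ≤ (1 / ε + 1) * T := by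
      push_cast
      have : (1 / ε + 1) * T = T / ε + T := by ring
      linarith
    have hN0 : (0 : ℝ) < ((⌊T / ε⌋₊ + 1 : ℕ) : ℝ) := by positivity
    have h3 : 1 / T ≤ (1 / ε + 1) * ((⌊T / ε⌋₊ + 1 : ℕ) : ℝ)⁻¹ := by
      rw [← div_eq_mul_inv, div_le_div_iff₀ hT0 hN0, one_mul]
      exact h2
    calc 1 / T * ∑' t : ↥(loopTimes g d H ∩ Icc (-T) T), ‖q g d H t‖
        ≤ ((1 / ε + 1) * ((⌊T / ε⌋₊ + 1 : ℕ) : ℝ)⁻¹) * (c * A) :=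
          mul_le_mul h3 h1 (tsum_nonneg fun _ => norm_nonneg _)
            ((one_div_pos.2 hT0).le.trans h3)
      _ = c * (1 / ε + 1) * (((⌊T / ε⌋₊ + 1 : ℕ) : ℝ)⁻¹ * A) := by ring

end
end ConormalFlow
end

theorem mainTheorem5 {n d : ℕ} {M : Type*} [TopologicalSpace M] [CompactSpace M] [T2Space M]
    [ChartedSpace (EuclideanSpace ℝ (Fin n)) M]
    [IsManifold (modelWithCornersSelf ℝ (EuclideanSpace ℝ (Fin n))) ∞ M]
    (g : ConormalFlow.Metric n M) (H : Set M) (hHcompact : IsCompact H)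
    (hH : ConormalFlow.IsEmbeddedSubmanifold (n := n) d H)
    (hinv : ∀ f : ConormalFlow.Cot n M → ℝ, ConormalFlow.IsInvariantDensity g d H f →
      ∀ᵐ z ∂(ConormalFlow.lerayMeasure g d H), f z = 0) :
    ConormalFlow.AveragingCondition g d H := by
  obtain ⟨ε, hε0, hε⟩ := ConormalFlow.exists_separation (g := g) hH hHcompact
  have hsep : ConormalFlow.IsSeparation g d H ε := ⟨hε0, hε⟩
  exact ConormalFlow.averagingCondition_of_tendsto hsep hH hHcompact
    (hsep.tendsto_average hH hHcompact hinv)
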